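/- \textbf{Conventions.} $\log$ is the base-$2$ logarithm and $\ln$ the natural one. $G$ denotes a $k$-partite graph with blocks $V_1,\dots,V_k$ of size $n$, and $\mathcal G(n,k,p)$ is the distribution on such graphs in which each pair of vertices in distinct blocks is an edge independently with probability $p$ (and there are no edges inside a block). For $B\subseteq[k]$ and $Q_i\subseteq V_i$ put $Q_B=\prod_{i\in B}Q_i$; a rectangle is $Q=Q_{[k]}$, and a tuple $t\in Q_B$ has $|t|=|B|$. The rectangle $Q$ is $s$-small if $|Q_i|\le s$ for all $i\in[k]$, and $(s,A)$-large if $|Q_i|>s$ for all $i\in A$. $N^\cap(t,R)$ is the set of vertices in $R$ adjacent to every vertex of $t$ (so $N^\cap(\emptyset,R)=R$), and $x\in(1\pm\beta)y$ means $(1-\beta)y\le x\le(1+\beta)y$. $G$ has $(\beta,p)$-bounded common neighborhoods from $Q_A$ to $R$ if $|N^\cap(t,R)|\in(1\pm\beta)p^{|t|}|R|$ for all $B\subseteq A$ and $t\in Q_B$. \textbf{Cores.} For a graph $H$ on $[k]$ let $\mathrm{vc}(H)$ be its vertex cover number and $V(E(H))$ its set of non-isolated vertices. Sets of vertices are ordered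 lexicographically: $U$ precedes $V$ if the least element of their symmetric difference is in $U$. Let $W$ be the first minimum vertex cover of $H$, let $U_1\subseteq[k]\setminus W$ be the first inclusion-maximal set such that $H$ has a matching from $U_1$ into $W$ covering $U_1$, and let $U_2\subseteq[k]\setminus(W\cup U_1)$ be the first inclusion-maximal set such that $H$ has a matching from $U_2$ into $W$ covering $U_2$. Then $\mathrm{core}(H)=H[W\cup U_1\cup U_2]$, viewed as a graph on $[k]$. A core is a graph $F$ in the image of this map, and $E^\star_F=\bigcup_{H:\,\mathrm{core}(H)=F}E(H)\setminus E(F)$. Write $E[B]$ for the edges of $E$ inside $B$, and $\mathcal H(F,E)=\{H: E(H)=E(F)\cup E',\ E'\subseteq E\}$. \textbf{Character sums.} For $p\in(0,1]$ let $\chi_e(G)=(1-p)/p$ if $e\in E(G)$ and $\chi_e(G)=-1$ otherwise, and let $\chi_{H[B](t)}(G)=\prod_{\{i,j\}\in E(H[B])}\chi_{\{t_i,t_j\}}(G)$ for $t\in Q_B$. $G$ has $s$-bounded character sums over $Q_B$ for $F$ if $\bigl|\sum_{t\in Q_B}\sum_{H\in\mathcal H(F,E^\star_F[B])}\chi_{H[B](t)}(G)\bigr|\le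 s$. \textbf{Well-behaved graphs.} Let $C,K>0$. A $k$-partite graph $G$ with blocks of size $n$ is $D$-well-behaved with constants $C,K$ if, for $p=n^{-2/D}$, the following hold. \begin{enumerate} \item For all $A\subseteq[k]$ with $|A|\le D/4$ and all $i\in[k]\setminus A$, $G$ has $(1/k,p)$-bounded common neighborhoods from $V_A=\prod_{j\in A}V_j$ to $V_i$. \item For all integers $0\le\ell\le D/4$, all real $s\ge Ck^4\ell\ln n/p^{2\ell}$ and all rectangles $Q$ such that each $Q_i$ satisfies $|Q_i|\ge 2s$ or $|Q_i|=0$, there is a set $W$ of at most $s$ vertices such that, for all $S\subseteq[k]$ with $|S|\le\ell$, all $t\in\prod_{i\in S}(Q_i\setminus W)$ and all $j\in[k]\setminus S$, $|N^\cap(t,Q_j\setminus W)|\in(1\pm 1/k)p^{|t|}|Q_j\setminus W|$. \item For every core $F$ with $\mathrm{vc}(F)\le D/4$, every $(n/2,V(E(F)))$-large rectangle $Q$ and every real $\lambda<1-\log(k)/\log(n)$, $G$ has $s$-bounded character sums over $Q_{[k]}$ for $F$, where $s=6\,p^{-|E(F)|}\,n^{k-\lambda\,\mathrm{vc}(F)/4}$.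 \item Let $F$ be a core with $\mathrm{vc}(F)\le D/4$, let $\Lambda\ge 20k\log n$ be real, let $B\subseteq[k]$ and let $A=V(E(F))\cap B$. For every $(4\Lambda)$-small and $(\Lambda,B)$-large rectangle $Q$: if $G$ has $(3/k,p)$-bounded common neighborhoods from $Q_A$ to $Q_i$ for every $i\in B\setminus A$, then $G$ has $s$-bounded character sums over $Q_B$ for $F$, where $s=K\,p^{-|E(F[B])|}\,\bigl(\Lambda/(10k\log n)\bigr)^{-\mathrm{vc}(F[B])/4}\,|Q_B|$. \end{enumerate} \textbf{Theorem.} There are absolute constants $C,K>0$ such that for every $\varepsilon>0$ there is $N$ such that for all integers $n\ge N$, all integers $k\ge1$ with $k\le n^{1/5}$ and all real $D$ with $4\le D\le 2\log n$, a random graph $G\sim\mathcal G(n,k,n^{-2/D})$ is $D$-well-behaved with constants $C,K$ with probability at least $1-\varepsilon$. In other words, $G$ is asymptotically almost surely $D$-well-behaved. -/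

import Mathlib

open scoped Finset

namespace CliqueSA

/-- `U` precedes `V` lexicographically: the least element of the symmetric difference of `U` and
`V` lies in `U`. -/
def LexLT {k : ℕ} (U V : Finset (Fin k)) : Prop :=
  ∃ a ∈ U, a ∉ V ∧ ∀ b < a, b ∈ U ↔ b ∈ V

/-- `U` is the lexicographically first set with property `P`. -/
def IsLexFirst {k : ℕ} (P : Finset (Fin k) → Prop) (U : Finset (Fin k)) : Prop :=
  P U ∧ ∀ V, P V → V ≠ U → LexLT U V

open Classical in
/-- The lexicographically first set with property `P` (and `∅` if no set has property `P`). -/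
noncomputable def lexFirst {k : ℕ} (P : Finset (Fin k) → Prop) : Finset (Fin k) :=
  if h : ∃ U, IsLexFirst P U then h.choose else ∅

theorem LexLT.trans {k : ℕ} {U V W : Finset (Fin k)} (h : LexLT U V) (h' : LexLT V W) :
    LexLT U W := by
  obtain ⟨a, haU, haV, ha⟩ := h
  obtain ⟨b, hbV, hbW, hb⟩ := h'
  rcases lt_trichotomy a b with hab | rfl | hab
  · exact ⟨a, haU, fun h => haV ((hb a hab).2 h),
      fun c hc => (ha c hc).trans (hb c (hc.trans hab))⟩
  · exact absurd hbV haV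
  · exact ⟨b, (ha b hab).2 hbV, hbW, fun c hc => (ha c (hc.trans hab)).trans (hb c hc)⟩

theorem LexLT.irrefl {k : ℕ} (U : Finset (Fin k)) : ¬ LexLT U U := by
  rintro ⟨a, h, h', -⟩
  exact h' h

theorem LexLT.total {k : ℕ} {U V : Finset (Fin k)} (h : U ≠ V) : LexLT U V ∨ LexLT V U := by
  have hne : (symmDiff U V).Nonempty := by
    rw [Finset.nonempty_iff_ne_empty]
    intro h0
    exact h (symmDiff_eq_bot.1 h0)
  have hm := Finset.min'_mem _ hne
  have hlt : ∀ b < (symmDiff U V).min' hne, (b ∈ U ↔ b ∈ V) := by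
    intro b hb
    by_contra hc
    have : b ∈ symmDiff U V := by
      rw [Finset.mem_symmDiff]; tauto
    exact absurd (Finset.min'_le _ b this) (not_le.2 hb)
  rw [Finset.mem_symmDiff] at hm
  rcases hm with hm | hm
  · exact Or.inl ⟨_, hm.1, hm.2, hlt⟩
  · exact Or.inr ⟨_, hm.1, hm.2, fun b hb => (hlt b hb).symm⟩

/-- If some set has property `P`, then `lexFirst P` is indeed the lexicographically first one. -/
theorem isLexFirst_lexFirst {k : ℕ} {P : Finset (Fin k) → Prop} (h : ∃ U, P U) :
    IsLexFirst P (lexFirst P) := by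
  have hex : ∃ U, IsLexFirst P U := by
    have : IsTrans (Finset (Fin k)) LexLT := ⟨fun _ _ _ => LexLT.trans⟩
    have : Std.Irrefl (α := Finset (Fin k)) LexLT := ⟨LexLT.irrefl⟩
    have wf : WellFounded (LexLT (k := k)) := Finite.wellFounded_of_trans_of_irrefl _
    obtain ⟨U, hU, hmin⟩ := wf.has_min {U | P U} h
    exact ⟨U, hU, fun V hV hne => (LexLT.total hne).resolve_left (hmin V hV)⟩
  unfold lexFirst
  rw [dif_pos hex]
  exact hex.choose_spec

/-! ### Cores of pattern graphs -/

/-- The minimum size of a vertex cover, as a natural number. -/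
noncomputable def vc {V : Type*} (H : SimpleGraph V) : ℕ := H.vertexCoverNum.toNat

/-- `W` is a vertex cover of `H` of minimum size. -/
def IsMinVertexCover {k : ℕ} (H : SimpleGraph (Fin k)) (W : Finset (Fin k)) : Prop :=
  H.IsVertexCover (W : Set (Fin k)) ∧
    ∀ W' : Finset (Fin k), H.IsVertexCover (W' : Set (Fin k)) → #W ≤ #W'

/-- `H` has a matching from `U` to `W` that covers all of `U`; the matching pairs `u` with `f u`. -/
def HasMatching {k : ℕ} (H : SimpleGraph (Fin k)) (U W : Finset (Fin k)) : Prop :=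
  ∃ f : Fin k → Fin k, Set.InjOn f (U : Set (Fin k)) ∧ ∀ u ∈ U, f u ∈ W ∧ H.Adj u (f u)

/-- The lexicographically first minimum vertex cover of `H`. -/
noncomputable def coreW {k : ℕ} (H : SimpleGraph (Fin k)) : Finset (Fin k) :=
  lexFirst (IsMinVertexCover H)

/-- The lexicographically first inclusion-maximal set outside of `W` that can be matched to `W`. -/
noncomputable def coreU₁ {k : ℕ} (H : SimpleGraph (Fin k)) : Finset (Fin k) :=
  lexFirst (Maximal fun U => Disjoint U (coreW H) ∧ HasMatching H U (coreW H))

/-- The lexicographically first inclusion-maximal set outside of `W ∪ U₁` that can be matched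
to `W`. -/
noncomputable def coreU₂ {k : ℕ} (H : SimpleGraph (Fin k)) : Finset (Fin k) :=
  lexFirst (Maximal fun U => Disjoint U (coreW H ∪ coreU₁ H) ∧ HasMatching H U (coreW H))

/-- The core `H[W ∪ U₁ ∪ U₂]` of a pattern graph `H`, again as a graph on all `k` labelled
vertices (the vertices outside of `W ∪ U₁ ∪ U₂` are isolated). -/
noncomputable def core {k : ℕ} (H : SimpleGraph (Fin k)) : SimpleGraph (Fin k) where
  Adj i j := i ∈ coreW H ∪ coreU₁ H ∪ coreU₂ H ∧ j ∈ coreW H ∪ coreU₁ H ∪ coreU₂ H ∧ H.Adj i j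
  symm := ⟨fun _ _ h => ⟨h.2.1, h.1, h.2.2.symm⟩⟩
  loopless := ⟨fun _ h => h.2.2.ne rfl⟩

/-- `F` is a core graph: it lies in the image of the map `core`. -/
def IsCore {k : ℕ} (F : SimpleGraph (Fin k)) : Prop :=
  ∃ H : SimpleGraph (Fin k), core H = F

/-- The edge set `E⋆_F`: all edges in `E(H) \ E(F)` for some `H` whose core is `F`. -/
def eStar {k : ℕ} (F : SimpleGraph (Fin k)) : Set (Sym2 (Fin k)) :=
  {e | ∃ H : SimpleGraph (Fin k), core H = F ∧ e ∈ H.edgeSet \ F.edgeSet}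

/-- `E[B]`: the edges in `E` with both endpoints in `B`. -/
def edgesWithin {k : ℕ} (E : Set (Sym2 (Fin k))) (B : Finset (Fin k)) : Set (Sym2 (Fin k)) :=
  {e ∈ E | ∀ i ∈ e, i ∈ B}

open Classical in
/-- The family `ℋ(F, E)` of all pattern graphs `H` with `E(H) = E(F) ∪ E'` for some `E' ⊆ E`. -/
noncomputable def family {k : ℕ} (F : SimpleGraph (Fin k)) (E : Set (Sym2 (Fin k))) :
    Finset (SimpleGraph (Fin k)) :=
  Finset.univ.filter fun H => ∃ E' ⊆ E, H.edgeSet = F.edgeSet ∪ E'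

/-- The induced subgraph `H[B]`, on the vertex set `B`. -/
def restrict {k : ℕ} (H : SimpleGraph (Fin k)) (B : Finset (Fin k)) : SimpleGraph B :=
  H.comap fun i : B => (i : Fin k)

open Classical in
/-- The set `V(E(F)) ∩ B` of the vertices in `B` that are not isolated in `F`. -/
noncomputable def supportIn {k : ℕ} (F : SimpleGraph (Fin k)) (B : Finset (Fin k)) :
    Finset (Fin k) :=
  B.filter fun i => i ∈ F.support

/-! ### Tuples and rectangles

The vertex set consists of the blocks `V_i = {i} × Fin n` for `i : Fin k`. A rectangle is given by
its sides `Q i ⊆ Fin n`, and a tuple over the blocks in `B` is a function `t : B → Fin n`. -/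

/-- The vertices of a graph with `k` blocks of size `n`. -/
abbrev Vertex (k n : ℕ) : Type := Fin k × Fin n

/-- The vertex that the tuple `t` picks in block `i`. -/
def vert {k n : ℕ} {B : Finset (Fin k)} (t : B → Fin n) (i : B) : Vertex k n := ((i : Fin k), t i)

/-- The side `Q_i` of a rectangle as a set of vertices of block `i`. -/
def side {k n : ℕ} (Q : Fin k → Finset (Fin n)) (i : Fin k) : Finset (Vertex k n) :=
  (Q i).image fun a => (i, a)

open Classical in
/-- The common neighbourhood `N^∩(t, R)` of a tuple `t` in a vertex set `R`. -/
noncomputable def commonNbrs {k n : ℕ} (G : SimpleGraph (Vertex k n)) {B : Finset (Fin k)}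
    (t : B → Fin n) (R : Finset (Vertex k n)) : Finset (Vertex k n) :=
  R.filter fun v => ∀ i : B, G.Adj (vert t i) v

/-- `|N^∩(t, R)| ∈ (1 ± β) p^{|t|} |R|`. -/
def ExpectedNbrs {k n : ℕ} (G : SimpleGraph (Vertex k n)) (β p : ℝ) {B : Finset (Fin k)}
    (t : B → Fin n) (R : Finset (Vertex k n)) : Prop :=
  (#(commonNbrs G t R) : ℝ) ∈
    Set.Icc ((1 - β) * (p ^ #B * (#R : ℝ))) ((1 + β) * (p ^ #B * (#R : ℝ)))

/-- `G` has `(β, p)`-bounded common neighbourhoods from `Q_A` to `R`. -/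
def BoundedCommonNbrs {k n : ℕ} (G : SimpleGraph (Vertex k n)) (β p : ℝ)
    (A : Finset (Fin k)) (Q : Fin k → Finset (Fin n)) (R : Finset (Vertex k n)) : Prop :=
  ∀ B ⊆ A, ∀ t : B → Fin n, (∀ i : B, t i ∈ Q i) → ExpectedNbrs G β p t R

/-- `G` has `(β, p, d)`-bounded common neighbourhoods in every block. -/
def BoundedCommonNbrsInBlocks {k n : ℕ} (G : SimpleGraph (Vertex k n)) (β p d : ℝ) : Prop :=
  ∀ A : Finset (Fin k), (#A : ℝ) ≤ d → ∀ i ∉ A,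
    BoundedCommonNbrs G β p A (fun _ => Finset.univ) (side (fun _ => Finset.univ) i)

/-- `G` has `(s, w, β, p, d)`-bounded error sets. -/
def BoundedErrorSets {k n : ℕ} (G : SimpleGraph (Vertex k n)) (s w β p : ℝ) (d : ℕ) : Prop :=
  ∀ Q : Fin k → Finset (Fin n), (∀ i, s ≤ (#(Q i) : ℝ) ∨ #(Q i) = 0) →
    ∃ W : Finset (Vertex k n), (#W : ℝ) ≤ w ∧
      ∀ S : Finset (Fin k), #S ≤ d →
        ∀ t : S → Fin n, (∀ i : S, vert t i ∈ side Q i \ W) →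
          ∀ j ∉ S, ExpectedNbrs G β p t (side Q j \ W)

/-! ### Character sums -/

open Classical in
/-- The character `χ_e(G)`. -/
noncomputable def chi {V : Type*} (p : ℝ) (G : SimpleGraph V) (e : Sym2 V) : ℝ :=
  if e ∈ G.edgeSet then (1 - p) / p else -1

open Classical in
/-- The edge set `H[B](t)` for a tuple `t` over the blocks in `B`: the edges `{t_i, t_j}` for
`{i, j} ∈ E(H[B])`. -/
noncomputable def edgesOn {k n : ℕ} (H : SimpleGraph (Fin k)) {B : Finset (Fin k)}
    (t : B → Fin n) : Finset (Sym2 (Vertex k n)) :=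
  (restrict H B).edgeFinset.image (Sym2.map (vert t))

/-- The sum of `χ_{H[B](t)}(G)` over all `t ∈ Q_B` and all `H ∈ ℋ(F, E⋆_F[B])`. -/
noncomputable def charSum {k n : ℕ} (p : ℝ) (G : SimpleGraph (Vertex k n))
    (F : SimpleGraph (Fin k)) (B : Finset (Fin k)) (Q : Fin k → Finset (Fin n)) : ℝ :=
  ∑ t ∈ Fintype.piFinset (fun i : B => Q i), ∑ H ∈ family F (edgesWithin (eStar F) B),
    ∏ e ∈ edgesOn H t, chi p G e

/-- `G` has `s`-bounded character sums over `Q_B` for `F`. -/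
def BoundedCharSums {k n : ℕ} (p : ℝ) (G : SimpleGraph (Vertex k n))
    (F : SimpleGraph (Fin k)) (B : Finset (Fin k)) (Q : Fin k → Finset (Fin n)) (s : ℝ) : Prop :=
  |charSum p G F B Q| ≤ s

/-- The rectangle `Q` is `s`-small. -/
def IsSmall {k n : ℕ} (s : ℝ) (Q : Fin k → Finset (Fin n)) : Prop :=
  ∀ i, (#(Q i) : ℝ) ≤ s

/-- The rectangle `Q` is `(s, A)`-large. -/
def IsLarge {k n : ℕ} (s : ℝ) (A : Finset (Fin k)) (Q : Fin k → Finset (Fin n)) : Prop :=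
  ∀ i ∈ A, s < (#(Q i) : ℝ)

/-! ### Well-behaved graphs -/

/-- The edge probability `n^{-2/D}`. -/
noncomputable def edgeProb (n : ℕ) (D : ℝ) : ℝ := (n : ℝ) ^ (-2 / D)

/-- `G` is a `D`-well-behaved `k`-partite graph with blocks of size `n`. The constant `C` is the
one in the bound on the error sets, `K` is the implicit constant of the localized bound on
character sums. -/
structure WellBehaved {k n : ℕ} (C K D : ℝ) (G : SimpleGraph (Vertex k n)) : Prop where
  kPartite : ∀ u v, G.Adj u v → u.1 ≠ v.1
  commonNbrs : BoundedCommonNbrsInBlocks G (1 / k) (edgeProb n D) (D / 4)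
  errorSets : ∀ (l : ℕ) (s : ℝ), (l : ℝ) ≤ D / 4 →
    C * (k : ℝ) ^ 4 * l * Real.log n / edgeProb n D ^ (2 * l) ≤ s →
    BoundedErrorSets G (2 * s) s (1 / k) (edgeProb n D) l
  charSums : ∀ F : SimpleGraph (Fin k), IsCore F → (vc F : ℝ) ≤ D / 4 →
    ∀ Q : Fin k → Finset (Fin n), IsLarge ((n : ℝ) / 2) (supportIn F Finset.univ) Q →
    ∀ lam : ℝ, lam < 1 - Real.log k / Real.log n →
      BoundedCharSums (edgeProb n D) G F Finset.univ Q
        (6 * (edgeProb n D ^ F.edgeSet.ncard)⁻¹ * (n : ℝ) ^ ((k : ℝ) - lam * vc F / 4))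
  localCharSums : ∀ F : SimpleGraph (Fin k), IsCore F → (vc F : ℝ) ≤ D / 4 →
    ∀ L : ℝ, 20 * k * Real.logb 2 n ≤ L →
    ∀ (B : Finset (Fin k)) (Q : Fin k → Finset (Fin n)), IsSmall (4 * L) Q → IsLarge L B Q →
    (∀ i ∈ B \ supportIn F B,
      BoundedCommonNbrs G (3 / k) (edgeProb n D) (supportIn F B) Q (side Q i)) →
      BoundedCharSums (edgeProb n D) G F B Q
        (K * ((edgeProb n D ^ (restrict F B).edgeSet.ncard)⁻¹ *
          (L / (10 * k * Real.logb 2 n)) ^ (-(vc (restrict F B) : ℝ) / 4) *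
          ∏ i ∈ B, (#(Q i) : ℝ)))

/-! ### The random graph -/

/-- The potential edges: the pairs of vertices in distinct blocks. -/
def potentialEdges (k n : ℕ) : Set (Sym2 (Vertex k n)) :=
  {e | ∃ u v : Vertex k n, u.1 ≠ v.1 ∧ e = s(u, v)}

/-- The distribution `𝒢(n, k, p)`: every potential edge is included independently with
probability `p`, and no other edge is. -/
noncomputable def randomGraph (n k : ℕ) (p : unitInterval) :
    MeasureTheory.Measure (SimpleGraph (Vertex k n)) :=
  (ProbabilityTheory.setBernoulli (potentialEdges k n) p).map SimpleGraph.fromEdgeSet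

instance (n k : ℕ) (p : unitInterval) :
    MeasureTheory.IsProbabilityMeasure (randomGraph n k p) :=
  MeasureTheory.Measure.isProbabilityMeasure_map
    SimpleGraph.measurable_fromEdgeSet.aemeasurable

end CliqueSA

/-!
The random graph `𝒢(n, k, p)` is modelled by a finite product of Bernoulli variables, one for each pair
of vertices (`weight`, `expectation`, `prob`); `prob_le_randomGraph_real` transfers bounds from this
space to the measure `randomGraph`. An outcome is `Typical` if it avoids a list of exceptional events,
`Typical.wellBehaved` shows deterministically that typical outcomes are well-behaved, and
`prob_not_typical_le` bounds the probability of an atypical outcome by `4 / n`.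

*Common neighbourhoods.* The number of common neighbours of at most `D / 4` vertices in a block is
binomial with mean at least `n ^ (1 / 2)`, so Chernoff's bound (`prob_deviates_le`) beats the
`n ^ O(log n)` choices of these vertices.

*Error sets.* For a fixed set `R` in a block, disjoint sets of at most `l` vertices have deviating
common neighbourhoods in `R` independently (`prob_forall_deviates_le`). Hence there is no large family
of disjoint deviating sets, simultaneously for all large `R` (`prob_not_fewDeviations_le`). The union of
a maximal such family for each block meets every deviating set. It is so small that removing it
from the sides of the rectangle only changes the sizes of the common neighbourhoods slightly
(`boundedErrorSets_of_fewDeviations`).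

*Character sums.* Summing over `ℋ(F, E⋆_F[B])` replaces the characters of the edges in `E⋆_F[B]` by
factors `1 + χ_e` (`charSum_eq`), and `1 + χ_e` is `p⁻¹` times the indicator of `e`. By an exchange
argument based on Hall's theorem, every edge in `E⋆_F` joins the first minimum vertex cover of `F` to
a vertex that is isolated in `F` (`exists_of_mem_eStar`). Summing over the coordinates of the isolated
blocks therefore gives normalized sizes of common neighbourhoods, each of which is at most `1 + O(1 / k)`
by assumption, so that their product is bounded. What remains is a multilinear form in the characters
of `F[B]`. A maximal matching of `F[B]` has at least `vc (F[B]) / 2` edges (`exists_matching`). Handling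
these edges one by one, Hoeffding's inequality with the remaining characters as coefficients gains a
factor `g` for each of them, up to a failure probability of `exp (-2 |P_i| |P_j| g²)` for every choice
of the other coordinates (`prob_sum_matchingChar_gt_le`, `prob_charSum_gt_le`), where `P` is the
rectangle over which the sum is taken. Over full blocks, `g² = k / n` makes this beat the number
`2 ^ (nk)` of rectangles. For rectangles with sides between `m` and `4m`, `g² = 10 k log n / m` makes it
beat their number, which is roughly `n ^ (4mk)`. The exponent `vc / 4` is then the one of `g²`.
-/

namespace CliqueSA

/-! ### Finite product Bernoulli spaces -/

section Bernoulli

variable {ι : Type*} [Fintype ι]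

/-- The weight of the outcome `ω` when the coordinates are independent and coordinate `i` is `true`
with probability `q i`. -/
def weight (q : ι → ℝ) (ω : ι → Bool) : ℝ := ∏ i, if ω i then q i else 1 - q i

open Classical in
/-- The outcome that agrees with `ω'` on `S` and with `ω` off `S`. -/
noncomputable def resample (S : Set ι) (ω' ω : ι → Bool) : ι → Bool :=
  fun i => if i ∈ S then ω' i else ω i

/-- All parameters lie in the unit interval. -/
def IsParam {ι : Type*} (q : ι → ℝ) : Prop := ∀ i, 0 ≤ q i ∧ q i ≤ 1

theorem weight_nonneg {q : ι → ℝ} (hq : IsParam q) (ω : ι → Bool) : 0 ≤ weight q ω :=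
  Finset.prod_nonneg fun i _ => by
    split_ifs
    · exact (hq i).1
    · linarith [(hq i).2]

theorem weight_mul_weight_resample (q : ι → ℝ) (S : Set ι) (ω ω' : ι → Bool) :
    weight q (resample S ω' ω) * weight q (resample S ω ω') = weight q ω * weight q ω' := by
  simp only [weight, ← Finset.prod_mul_distrib]
  refine Finset.prod_congr rfl fun i _ => ?_
  by_cases h : i ∈ S
  · simp only [resample, if_pos h]; ring
  · simp only [resample, if_neg h]

variable [DecidableEq ι]

/-- The expectation of `f` in the product Bernoulli space with parameters `q`. -/
def expectation (q : ι → ℝ) (f : (ι → Bool) → ℝ) : ℝ := ∑ ω, weight q ω * f ω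

open Classical in
/-- The probability of the event `A` in the product Bernoulli space with parameters `q`. -/
noncomputable def prob (q : ι → ℝ) (A : (ι → Bool) → Prop) : ℝ :=
  expectation q fun ω => if A ω then 1 else 0

/-- Functions of single coordinates are independent. -/
theorem expectation_prod (q : ι → ℝ) (g : ι → Bool → ℝ) :
    expectation q (fun ω => ∏ i, g i (ω i)) = ∏ i, (q i * g i true + (1 - q i) * g i false) := by
  have h := Fintype.prod_sum (κ := fun _ : ι => Bool)
    (fun i b => (if b then q i else 1 - q i) * g i b)
  simp only [Fintype.sum_bool, if_true, Bool.false_eq_true, if_false] at h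
  rw [h, expectation]
  refine Finset.sum_congr rfl fun ω _ => ?_
  rw [weight, Finset.prod_mul_distrib]

theorem sum_weight (q : ι → ℝ) : ∑ ω, weight q ω = 1 := by
  have h := expectation_prod q fun _ _ => 1
  simpa [expectation] using h

theorem expectation_const (q : ι → ℝ) (c : ℝ) : expectation q (fun _ => c) = c := by
  rw [expectation, ← Finset.sum_mul, sum_weight, one_mul]

theorem expectation_mono {q : ι → ℝ} (hq : IsParam q) {f g : (ι → Bool) → ℝ}
    (h : ∀ ω, f ω ≤ g ω) : expectation q f ≤ expectation q g :=
  Finset.sum_le_sum fun ω _ => mul_le_mul_of_nonneg_left (h ω) (weight_nonneg hq ω)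

theorem expectation_add (q : ι → ℝ) (f g : (ι → Bool) → ℝ) :
    expectation q (fun ω => f ω + g ω) = expectation q f + expectation q g := by
  simp only [expectation, mul_add, Finset.sum_add_distrib]

theorem expectation_const_mul (q : ι → ℝ) (c : ℝ) (f : (ι → Bool) → ℝ) :
    expectation q (fun ω => c * f ω) = c * expectation q f := by
  simp only [expectation, Finset.mul_sum]
  exact Finset.sum_congr rfl fun ω _ => by ring

theorem expectation_sum (q : ι → ℝ) {κ : Type*} (s : Finset κ) (f : κ → (ι → Bool) → ℝ) :
    expectation q (fun ω => ∑ a ∈ s, f a ω) = ∑ a ∈ s, expectation q (f a) := by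
  simp only [expectation, Finset.mul_sum]
  exact Finset.sum_comm

/-- Redrawing the coordinates in `S` does not change the distribution. The reason is that swapping
the coordinates in `S` of two independent outcomes is an involution that preserves the weight of the
pair. -/
theorem expectation_resample (q : ι → ℝ) (S : Set ι) (f : (ι → Bool) → ℝ) :
    expectation q (fun ω => expectation q fun ω' => f (resample S ω' ω)) = expectation q f := by
  let φ : (ι → Bool) × (ι → Bool) → (ι → Bool) × (ι → Bool) :=
    fun x => (resample S x.2 x.1, resample S x.1 x.2)
  have hφ : Function.Involutive φ := by
    rintro ⟨ω, ω'⟩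
    simp only [φ, Prod.mk.injEq]
    constructor <;> · funext i; by_cases h : i ∈ S <;> simp [resample, h]
  have h1 : expectation q (fun ω => expectation q fun ω' => f (resample S ω' ω)) =
      ∑ x : (ι → Bool) × (ι → Bool), weight q (φ x).1 * weight q (φ x).2 * f (φ x).1 := by
    simp only [expectation, Finset.mul_sum, Fintype.sum_prod_type]
    refine Finset.sum_congr rfl fun ω _ => Finset.sum_congr rfl fun ω' _ => ?_
    simp only [φ, weight_mul_weight_resample]
    ring
  have h2 := Equiv.sum_comp (hφ.toPerm φ)
    (fun x : (ι → Bool) × (ι → Bool) => weight q x.1 * weight q x.2 * f x.1)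
  rw [h1]
  refine h2.trans ?_
  simp only [Fintype.sum_prod_type, expectation]
  refine Finset.sum_congr rfl fun ω _ => ?_
  rw [← Finset.sum_mul, ← Finset.mul_sum, sum_weight, mul_one]

/-- Functions of disjoint sets of coordinates are independent. -/
theorem expectation_mul_of_dependsOn (q : ι → ℝ) {S : Set ι} {f g : (ι → Bool) → ℝ}
    (hf : DependsOn f S) (hg : DependsOn g Sᶜ) :
    expectation q (fun ω => f ω * g ω) = expectation q f * expectation q g := by
  rw [← expectation_resample q S]
  have h : ∀ ω ω', f (resample S ω' ω) * g (resample S ω' ω) = g ω * f ω' := by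
    intro ω ω'
    rw [mul_comm, hg (y := ω) fun i hi => by simp [resample, show i ∉ S from hi],
      hf (y := ω') fun i hi => by simp [resample, hi]]
  simp only [h, expectation_const_mul]
  simp only [mul_comm _ (expectation q f), expectation_const_mul]

theorem expectation_prod_of_dependsOn (q : ι → ℝ) {κ : Type*} (s : Finset κ) (D : κ → Set ι)
    (hD : (s : Set κ).PairwiseDisjoint D) (f : κ → (ι → Bool) → ℝ)
    (hf : ∀ a ∈ s, DependsOn (f a) (D a)) :
    expectation q (fun ω => ∏ a ∈ s, f a ω) = ∏ a ∈ s, expectation q (f a) := by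
  classical
  induction s using Finset.induction_on with
  | empty => simp [expectation_const]
  | insert a s ha ih =>
    simp only [Finset.prod_insert ha]
    rw [expectation_mul_of_dependsOn q (S := D a) (hf a (Finset.mem_insert_self a s)) ?_, ih]
    · exact hD.subset (by simp)
    · exact fun b hb => hf b (Finset.mem_insert_of_mem hb)
    · intro ω ω' h
      refine Finset.prod_congr rfl fun b hb => hf b (Finset.mem_insert_of_mem hb) fun i hi => h i ?_
      have hab : a ≠ b := fun h => ha (h ▸ hb)
      have := hD (by simp) (by simp [hb]) hab
      exact fun hi' => Set.disjoint_left.1 this hi' hi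

theorem prob_nonneg {q : ι → ℝ} (hq : IsParam q) (A : (ι → Bool) → Prop) : 0 ≤ prob q A := by
  classical
  rw [← expectation_const q 0]
  exact expectation_mono hq fun ω => by split_ifs <;> norm_num

theorem prob_mono {q : ι → ℝ} (hq : IsParam q) {A B : (ι → Bool) → Prop}
    (h : ∀ ω, A ω → B ω) : prob q A ≤ prob q B := by
  classical
  refine expectation_mono hq fun ω => ?_
  by_cases hA : A ω
  · simp [hA, h ω hA]
  · rw [if_neg hA]; split_ifs <;> norm_num

theorem prob_le_expectation {q : ι → ℝ} (hq : IsParam q) {A : (ι → Bool) → Prop}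
    {f : (ι → Bool) → ℝ} (hf : ∀ ω, 0 ≤ f ω) (h : ∀ ω, A ω → 1 ≤ f ω) :
    prob q A ≤ expectation q f := by
  classical
  refine expectation_mono hq fun ω => ?_
  split_ifs with hA
  · exact h ω hA
  · exact hf ω

theorem prob_exists_le {q : ι → ℝ} (hq : IsParam q) {κ : Type*} (s : Finset κ)
    (A : κ → (ι → Bool) → Prop) :
    prob q (fun ω => ∃ a ∈ s, A a ω) ≤ ∑ a ∈ s, prob q (A a) := by
  classical
  simp only [prob]
  rw [← expectation_sum]
  refine expectation_mono hq fun ω => ?_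
  split_ifs with h
  · obtain ⟨a, ha, hA⟩ := h
    calc (1 : ℝ) = if A a ω then 1 else 0 := by rw [if_pos hA]
      _ ≤ _ := Finset.single_le_sum (f := fun a => if A a ω then (1 : ℝ) else 0)
          (fun b _ => by split_ifs <;> norm_num) ha
  · exact Finset.sum_nonneg fun b _ => by split_ifs <;> norm_num

theorem prob_or_le {q : ι → ℝ} (hq : IsParam q) (A B : (ι → Bool) → Prop) :
    prob q (fun ω => A ω ∨ B ω) ≤ prob q A + prob q B := by
  classical
  simp only [prob]
  rw [← expectation_add]
  refine expectation_mono hq fun ω => ?_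
  by_cases hA : A ω <;> by_cases hB : B ω <;> simp [hA, hB]

theorem prob_not (q : ι → ℝ) (A : (ι → Bool) → Prop) :
    prob q (fun ω => ¬ A ω) = 1 - prob q A := by
  classical
  rw [eq_sub_iff_add_eq]
  simp only [prob]
  rw [← expectation_add, ← expectation_const q 1]
  refine Finset.sum_congr rfl fun ω _ => ?_
  by_cases h : A ω <;> simp [h, expectation_const]

/-- If an event has probability at most `b` for every choice of the coordinates outside `S`, then it
has probability at most `b`. -/
theorem prob_le_of_resample {q : ι → ℝ} (hq : IsParam q) (S : Set ι) (A : (ι → Bool) → Prop)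
    {b : ℝ} (h : ∀ ω, prob q (fun ω' => A (resample S ω' ω)) ≤ b) : prob q A ≤ b := by
  classical
  have h1 := expectation_resample q S fun ω => if A ω then 1 else 0
  rw [prob, ← h1, ← expectation_const q b]
  exact expectation_mono hq h

/-- A coordinate that is `true` with probability `0` is almost surely `false`. -/
theorem prob_coord_eq_zero {q : ι → ℝ} {i : ι} (hi : q i = 0) :
    prob q (fun ω => ω i = true) = 0 := by
  classical
  rw [prob, expectation]
  refine Finset.sum_eq_zero fun ω _ => ?_
  by_cases h : ω i = true
  · rw [weight, Finset.prod_eq_zero (Finset.mem_univ i) (by simp [h, hi]), zero_mul]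
  · simp [h]

end Bernoulli

/-! ### Tail bounds -/

/-- Hoeffding's lemma for a centred Bernoulli variable. -/
theorem bernoulli_mgf_le {p : ℝ} (hp0 : 0 ≤ p) (hp1 : p ≤ 1) (x : ℝ) :
    p * Real.exp (x * (1 - p)) + (1 - p) * Real.exp (-(x * p)) ≤ Real.exp (x ^ 2 / 8) := by
  let P : unitInterval := ⟨p, hp0, hp1⟩
  have hm : ∀ f : ℝ → ℝ, ∫ z, f z ∂(ProbabilityTheory.bernoulliMeasure (1 - p) (-p) P) =
      p * f (1 - p) + (1 - p) * f (-p) := fun f => by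
    rw [ProbabilityTheory.integral_bernoulliMeasure]; simp [P]
  have h := (ProbabilityTheory.hasSubgaussianMGF_of_mem_Icc_of_integral_eq_zero
    (μ := ProbabilityTheory.bernoulliMeasure (1 - p) (-p) P) (X := fun z => z)
    (a := -p) (b := 1 - p) (by fun_prop) ?_ ?_).mgf_le x
  · rw [ProbabilityTheory.mgf, hm (fun z => Real.exp (x * z))] at h
    have e1 : x * -p = -(x * p) := by ring
    rw [e1] at h
    refine h.trans (le_of_eq ?_)
    congr 1
    have : (1 - p - -p) = 1 := by ring
    rw [this]
    push_cast
    simp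
    ring
  · rw [ProbabilityTheory.bernoulliMeasure_def]
    rw [MeasureTheory.ae_add_measure_iff]
    constructor
    · refine MeasureTheory.Measure.ae_smul_measure ?_ _
      rw [MeasureTheory.ae_dirac_eq]
      exact ⟨by linarith, le_refl _⟩
    · refine MeasureTheory.Measure.ae_smul_measure ?_ _
      rw [MeasureTheory.ae_dirac_eq]
      exact ⟨le_refl _, by linarith⟩
  · rw [hm (fun z => z)]; ring

section Hoeffding

variable {ι : Type*} [Fintype ι] [DecidableEq ι]

theorem expectation_coord (q : ι → ℝ) (i : ι) (g : Bool → ℝ) :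
    expectation q (fun ω => g (ω i)) = q i * g true + (1 - q i) * g false := by
  have h := expectation_prod q fun j b => if j = i then g b else 1
  simp only [Finset.prod_ite_eq', Finset.mem_univ, if_true] at h
  rw [h, Finset.prod_eq_single i]
  · simp
  · intro j _ hj
    simp [hj]
  · simp

/-- The character of a single potential edge as a function of its indicator. -/
noncomputable def chiVal (p : ℝ) (b : Bool) : ℝ := if b then (1 - p) / p else -1

theorem abs_chiVal_le {p : ℝ} (hp0 : 0 < p) (hp1 : p ≤ 1) (b : Bool) : |chiVal p b| ≤ p⁻¹ := by
  have h1 : 1 ≤ p⁻¹ := (one_le_inv₀ hp0).2 hp1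
  unfold chiVal
  split_ifs
  · rw [abs_of_nonneg (div_nonneg (by linarith) hp0.le), div_eq_mul_inv]
    exact mul_le_of_le_one_left (by positivity) (by linarith)
  · simpa using h1

theorem expectation_exp_chiVal_le {q : ι → ℝ} {i : ι} {p : ℝ} (hp0 : 0 < p) (hp1 : p ≤ 1)
    (hi : q i = p) {B x : ℝ} (hx : |x| ≤ B) :
    expectation q (fun ω => Real.exp (x * chiVal p (ω i))) ≤ Real.exp ((B / p) ^ 2 / 8) := by
  rw [expectation_coord q i fun b => Real.exp (x * chiVal p b), hi]
  have h := bernoulli_mgf_le hp0.le hp1 (x / p)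
  have e1 : x * chiVal p true = x / p * (1 - p) := by simp [chiVal]; ring
  have e2 : x * chiVal p false = -(x / p * p) := by simp [chiVal]; field_simp
  rw [e1, e2]
  refine h.trans (Real.exp_le_exp.2 ?_)
  have : (x / p) ^ 2 ≤ (B / p) ^ 2 := by
    rw [div_pow, div_pow]
    exact div_le_div_of_nonneg_right (sq_le_sq' (by linarith [neg_abs_le x]) ((le_abs_self x).trans hx))
      (by positivity)
  linarith

theorem expectation_exp_sum_chiVal_le {q : ι → ℝ} (hq : IsParam q) {κ : Type*} (T : Finset κ)
    (e : κ → ι)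
    (he : Set.InjOn e T) {p : ℝ} (hp0 : 0 < p) (hp1 : p ≤ 1) (hqe : ∀ x ∈ T, q (e x) = p)
    {c : κ → ℝ} {B : ℝ} (hc : ∀ x ∈ T, |c x| ≤ B) (l : ℝ) :
    expectation q (fun ω => Real.exp (l * ∑ x ∈ T, c x * chiVal p (ω (e x)))) ≤
      Real.exp (T.card * ((|l| * B / p) ^ 2 / 8)) := by
  have h1 : ∀ ω : ι → Bool, Real.exp (l * ∑ x ∈ T, c x * chiVal p (ω (e x))) =
      ∏ x ∈ T, Real.exp (l * c x * chiVal p (ω (e x))) := fun ω => by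
    rw [Finset.mul_sum, Real.exp_sum]
    exact Finset.prod_congr rfl fun x _ => by rw [mul_assoc]
  simp only [h1]
  rw [expectation_prod_of_dependsOn q T (fun x => {e x})
    (fun x hx y hy hxy => Set.disjoint_singleton.2 fun h => hxy (he hx hy h))
    (fun x ω => Real.exp (l * c x * chiVal p (ω (e x))))
    (fun x _ ω ω' h => by simp only [h (e x) rfl]), Real.exp_nat_mul, ← Finset.prod_const]
  refine Finset.prod_le_prod (fun x _ => ?_) fun x hx => ?_
  · rw [← expectation_const q 0]
    exact expectation_mono hq fun ω => (Real.exp_pos _).le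
  · exact expectation_exp_chiVal_le hp0 hp1 (hqe x hx)
      (by rw [abs_mul]; exact mul_le_mul_of_nonneg_left (hc x hx) (abs_nonneg l))

/-- Hoeffding's inequality for linear combinations of characters. -/
theorem prob_abs_sum_chiVal_gt_le {q : ι → ℝ} (hq : IsParam q) {κ : Type*} (T : Finset κ)
    (e : κ → ι) (he : Set.InjOn e T) {p : ℝ} (hp0 : 0 < p) (hp1 : p ≤ 1)
    (hqe : ∀ x ∈ T, q (e x) = p) (c : κ → ℝ) (B : ℝ) {g : ℝ} (hg : 0 ≤ g) :
    prob q (fun ω => (∀ x ∈ T, |c x| ≤ B) ∧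
      T.card * (B * (g / p)) < |∑ x ∈ T, c x * chiVal p (ω (e x))|) ≤
      2 * Real.exp (-(2 * T.card * g ^ 2)) := by
  by_cases hc : ∀ x ∈ T, |c x| ≤ B
  swap
  · simp only [hc, false_and]
    refine (prob_le_expectation hq (f := fun _ => 0) (fun _ => le_rfl) fun _ h => h.elim).trans ?_
    rw [expectation_const]
    positivity
  by_cases hB : 0 < B
  swap
  · have h0 : ∀ x ∈ T, c x = 0 := fun x hx =>
      abs_nonpos_iff.1 ((hc x hx).trans (not_lt.1 hB))
    refine (prob_le_expectation hq (f := fun _ => 0) (fun _ => le_rfl) fun ω h => ?_).trans ?_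
    · exfalso
      have h2 := h.2
      rw [Finset.sum_eq_zero fun x hx => by rw [h0 x hx, zero_mul], abs_zero] at h2
      rcases T.eq_empty_or_nonempty with rfl | ⟨x, hx⟩
      · simp at h2
      · have hB0 : B = 0 := le_antisymm (not_lt.1 hB) ((abs_nonneg _).trans (hc x hx))
        simp [hB0] at h2
    · rw [expectation_const]
      positivity
  -- the optimal exponent in Markov's inequality
  set l : ℝ := 4 * g * p / B with hl
  have hl0 : 0 ≤ l := by positivity
  set s : ℝ := T.card * (B * (g / p)) with hs
  let Y : (ι → Bool) → ℝ := fun ω => ∑ x ∈ T, c x * chiVal p (ω (e x))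
  have key : prob q (fun ω => (∀ x ∈ T, |c x| ≤ B) ∧ s < |Y ω|) ≤
      expectation q (fun ω => Real.exp (-(l * s)) * (Real.exp (l * Y ω) + Real.exp (-l * Y ω))) := by
    refine prob_le_expectation hq (fun ω => by positivity) fun ω h => ?_
    rw [mul_add, ← Real.exp_add, ← Real.exp_add]
    rcases lt_abs.1 h.2 with h | h
    · have : 1 ≤ Real.exp (-(l * s) + l * Y ω) := Real.one_le_exp (by nlinarith)
      linarith [Real.exp_pos (-(l * s) + -l * Y ω)]
    · have : 1 ≤ Real.exp (-(l * s) + -l * Y ω) := Real.one_le_exp (by nlinarith)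
      linarith [Real.exp_pos (-(l * s) + l * Y ω)]
  refine key.trans ?_
  rw [expectation_const_mul, expectation_add]
  have h1 := expectation_exp_sum_chiVal_le hq T e he hp0 hp1 hqe hc l
  have h2 := expectation_exp_sum_chiVal_le hq T e he hp0 hp1 hqe hc (-l)
  rw [abs_neg] at h2
  have h3 : Real.exp (-(l * s)) * Real.exp (T.card * ((|l| * B / p) ^ 2 / 8)) =
      Real.exp (-(2 * T.card * g ^ 2)) := by
    rw [← Real.exp_add, abs_of_nonneg hl0, hl, hs]
    congr 1
    field_simp
    ring
  calc _ ≤ Real.exp (-(l * s)) * (Real.exp (T.card * ((|l| * B / p) ^ 2 / 8)) +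
        Real.exp (T.card * ((|l| * B / p) ^ 2 / 8))) :=
        mul_le_mul_of_nonneg_left (add_le_add h1 h2) (Real.exp_pos _).le
    _ = _ := by rw [mul_add, h3]; ring

/-- Hoeffding's inequality with random coefficients that are independent of the characters. -/
theorem prob_abs_sum_mul_chiVal_gt_le {q : ι → ℝ} (hq : IsParam q) {κ : Type*} (T : Finset κ)
    (e : κ → ι) (he : Set.InjOn e T) {p : ℝ} (hp0 : 0 < p) (hp1 : p ≤ 1)
    (hqe : ∀ x ∈ T, q (e x) = p) (S : Set ι) (hS : ∀ x ∈ T, e x ∈ S)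
    (c : κ → (ι → Bool) → ℝ) (hc : ∀ x ∈ T, DependsOn (c x) Sᶜ) (B : ℝ) {g : ℝ} (hg : 0 ≤ g) :
    prob q (fun ω => (∀ x ∈ T, |c x ω| ≤ B) ∧
      T.card * (B * (g / p)) < |∑ x ∈ T, c x ω * chiVal p (ω (e x))|) ≤
      2 * Real.exp (-(2 * T.card * g ^ 2)) := by
  refine prob_le_of_resample hq S _ fun ω => ?_
  refine le_trans (prob_mono hq fun ω' h => ?_)
    (prob_abs_sum_chiVal_gt_le hq T e he hp0 hp1 hqe (fun x => c x ω) B hg)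
  have hcω : ∀ x ∈ T, c x (resample S ω' ω) = c x ω := fun x hx =>
    hc x hx fun i hi => by simp [resample, show i ∉ S from hi]
  have heω : ∀ x ∈ T, resample S ω' ω (e x) = ω' (e x) := fun x hx => by simp [resample, hS x hx]
  refine ⟨fun x hx => by rw [← hcω x hx]; exact h.1 x hx, ?_⟩
  have h2 := h.2
  rwa [Finset.sum_congr rfl fun x hx => by rw [hcω x hx, heω x hx]] at h2

end Hoeffding

/-! ### Multilinear forms in independent blocks of characters -/

section Chaos

variable {k n : ℕ}

/-- Averaging over a single coordinate does not change the sum over a rectangle. -/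
theorem card_mul_sum_piFinset (R : Fin k → Finset (Fin n)) (i : Fin k)
    (g : (Fin k → Fin n) → ℝ) :
    #(R i) * ∑ τ ∈ Fintype.piFinset R, g τ =
      ∑ τ ∈ Fintype.piFinset R, ∑ a ∈ R i, g (Function.update τ i a) := by
  have h1 : ∑ τ ∈ Fintype.piFinset R, ∑ a ∈ R i, g (Function.update τ i a) =
      ∑ x ∈ Fintype.piFinset R ×ˢ R i, g (Function.update x.1 i x.2) := by
    rw [Finset.sum_product]
  have h2 : #(R i) * ∑ τ ∈ Fintype.piFinset R, g τ =
      ∑ x ∈ Fintype.piFinset R ×ˢ R i, g x.1 := by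
    rw [Finset.sum_product, Finset.mul_sum]
    simp
  rw [h1, h2]
  symm
  -- exchanging the value at `i` with the extra value is an involution
  refine Finset.sum_nbij' (fun x => (Function.update x.1 i x.2, x.1 i))
    (fun x => (Function.update x.1 i x.2, x.1 i)) ?_ ?_ ?_ ?_ ?_
  · rintro ⟨τ, a⟩ hx
    simp only [Finset.mem_product, Fintype.mem_piFinset] at hx ⊢
    refine ⟨fun j => ?_, hx.1 i⟩
    by_cases hj : j = i
    · subst hj; simpa using hx.2
    · simpa [hj] using hx.1 j
  · rintro ⟨τ, a⟩ hx
    simp only [Finset.mem_product, Fintype.mem_piFinset] at hx ⊢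
    refine ⟨fun j => ?_, hx.1 i⟩
    by_cases hj : j = i
    · subst hj; simpa using hx.2
    · simpa [hj] using hx.1 j
  · rintro ⟨τ, a⟩ _; simp
  · rintro ⟨τ, a⟩ _; simp
  · rintro ⟨τ, a⟩ _; rfl

/-- The potential edges between the blocks `i` and `j`. -/
def blockEdges (n : ℕ) (i j : Fin k) : Set (Sym2 (Vertex k n)) :=
  {e | ∃ a b : Fin n, e = s((i, a), (j, b))}

/-- The two pairs of blocks have no block in common. -/
def PairDisjoint (x y : Fin k × Fin k) : Prop :=
  x.1 ≠ y.1 ∧ x.1 ≠ y.2 ∧ x.2 ≠ y.1 ∧ x.2 ≠ y.2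

theorem PairDisjoint.disjoint_blockEdges {x y : Fin k × Fin k} (h : PairDisjoint x y) :
    Disjoint (blockEdges n x.1 x.2) (blockEdges n y.1 y.2) := by
  rw [Set.disjoint_left]
  rintro _ ⟨a, b, rfl⟩ ⟨a', b', he⟩
  rw [Sym2.eq_iff] at he
  rcases he with he | he
  · exact h.1 (Prod.ext_iff.1 he.1).1
  · exact h.2.1 (Prod.ext_iff.1 he.1).1

/-- The union of the edge sets between the pairs of blocks in the list `M`. -/
def listEdges (n : ℕ) (M : List (Fin k × Fin k)) : Set (Sym2 (Vertex k n)) :=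
  {e | ∃ x ∈ M, e ∈ blockEdges n x.1 x.2}

/-- The product of the characters of the tuple `τ` over the pairs of blocks in `M`. -/
noncomputable def matchingChar (p : ℝ) (M : List (Fin k × Fin k))
    (ω : Sym2 (Vertex k n) → Bool) (τ : Fin k → Fin n) : ℝ :=
  (M.map fun x => chiVal p (ω s((x.1, τ x.1), (x.2, τ x.2)))).prod

theorem matchingChar_cons (p : ℝ) (x : Fin k × Fin k) (M : List (Fin k × Fin k))
    (ω : Sym2 (Vertex k n) → Bool) (τ : Fin k → Fin n) :
    matchingChar p (x :: M) ω τ =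
      chiVal p (ω s((x.1, τ x.1), (x.2, τ x.2))) * matchingChar p M ω τ := by
  simp [matchingChar]

theorem matchingChar_update (p : ℝ) (x : Fin k × Fin k) (M : List (Fin k × Fin k))
    (hM : ∀ y ∈ M, PairDisjoint x y) (ω : Sym2 (Vertex k n) → Bool) (τ : Fin k → Fin n)
    (a b : Fin n) :
    matchingChar p M ω (Function.update (Function.update τ x.1 a) x.2 b) =
      matchingChar p M ω τ := by
  unfold matchingChar
  congr 1
  refine List.map_congr_left fun y hy => ?_
  obtain ⟨h1, h2, h3, h4⟩ := hM y hy
  simp [Function.update_of_ne h1.symm, Function.update_of_ne h2.symm,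
    Function.update_of_ne h3.symm, Function.update_of_ne h4.symm]

/-- The average of `χ · c` over the coordinates in the pair `x` of blocks. -/
noncomputable def pairAverage (p : ℝ) (R : Fin k → Finset (Fin n)) (x : Fin k × Fin k)
    (c : (Fin k → Fin n) → (Sym2 (Vertex k n) → Bool) → ℝ) (τ : Fin k → Fin n)
    (ω : Sym2 (Vertex k n) → Bool) : ℝ :=
  (∑ y ∈ R x.1 ×ˢ R x.2, c (Function.update (Function.update τ x.1 y.1) x.2 y.2) ω *
    chiVal p (ω s((x.1, y.1), (x.2, y.2)))) / (#(R x.1) * #(R x.2))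

theorem sum_matchingChar_cons (p : ℝ) (R : Fin k → Finset (Fin n)) (x : Fin k × Fin k)
    (hx : x.1 ≠ x.2) (M : List (Fin k × Fin k)) (hM : ∀ y ∈ M, PairDisjoint x y)
    (hR1 : (R x.1).Nonempty) (hR2 : (R x.2).Nonempty)
    (c : (Fin k → Fin n) → (Sym2 (Vertex k n) → Bool) → ℝ) (ω : Sym2 (Vertex k n) → Bool) :
    ∑ τ ∈ Fintype.piFinset R, matchingChar p (x :: M) ω τ * c τ ω =
      ∑ τ ∈ Fintype.piFinset R, matchingChar p M ω τ * pairAverage p R x c τ ω := by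
  have h1 : (0 : ℝ) < #(R x.1) := by exact_mod_cast hR1.card_pos
  have h2 : (0 : ℝ) < #(R x.2) := by exact_mod_cast hR2.card_pos
  set g : (Fin k → Fin n) → ℝ := fun τ => matchingChar p (x :: M) ω τ * c τ ω with hg
  have key : (#(R x.1) : ℝ) * (#(R x.2) * ∑ τ ∈ Fintype.piFinset R, g τ) =
      ∑ τ ∈ Fintype.piFinset R, ∑ a ∈ R x.1, ∑ b ∈ R x.2,
        g (Function.update (Function.update τ x.1 a) x.2 b) := by
    rw [card_mul_sum_piFinset R x.2 g, card_mul_sum_piFinset R x.1]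
  have h3 : ∑ τ ∈ Fintype.piFinset R, g τ = (∑ τ ∈ Fintype.piFinset R, ∑ a ∈ R x.1, ∑ b ∈ R x.2,
        g (Function.update (Function.update τ x.1 a) x.2 b)) / (#(R x.1) * #(R x.2)) := by
    rw [← key]; field_simp
  rw [h3, Finset.sum_div]
  refine Finset.sum_congr rfl fun τ _ => ?_
  rw [pairAverage, Finset.sum_product, ← mul_div_assoc, Finset.mul_sum]
  congr 1
  refine Finset.sum_congr rfl fun a _ => ?_
  rw [Finset.mul_sum]
  refine Finset.sum_congr rfl fun b _ => ?_
  simp only [hg, matchingChar_cons, matchingChar_update p x M hM]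
  rw [Function.update_self, Function.update_of_ne hx, Function.update_self]
  ring

theorem dependsOn_pairAverage (p : ℝ) (R : Fin k → Finset (Fin n)) (x : Fin k × Fin k)
    (M : List (Fin k × Fin k)) (hM : ∀ y ∈ M, PairDisjoint x y)
    (c : (Fin k → Fin n) → (Sym2 (Vertex k n) → Bool) → ℝ)
    (hc : ∀ τ, DependsOn (c τ) (listEdges n (x :: M))ᶜ) (τ : Fin k → Fin n) :
    DependsOn (pairAverage p R x c τ) (listEdges n M)ᶜ := by
  intro ω ω' h
  unfold pairAverage
  congr 1
  refine Finset.sum_congr rfl fun y _ => ?_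
  congr 1
  · refine hc _ fun e he => h e fun ⟨z, hz, he'⟩ => he ⟨z, List.mem_cons_of_mem _ hz, he'⟩
  · rw [h]
    rintro ⟨z, hz, he⟩
    exact Set.disjoint_left.1 (hM z hz).disjoint_blockEdges ⟨y.1, y.2, rfl⟩ he

/-- A multilinear form in the characters of pairwise disjoint pairs of blocks, with coefficients
that are bounded and independent of these characters, gains a factor `g` for each pair of blocks
with overwhelming probability. Each pair is handled by Hoeffding's inequality, which turns the
coefficients into new ones that no longer involve the two blocks of the pair. -/
theorem prob_sum_matchingChar_gt_le {q : Sym2 (Vertex k n) → ℝ} (hq : IsParam q) {p : ℝ}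
    (hp0 : 0 < p) (hp1 : p ≤ 1) (R : Fin k → Finset (Fin n)) {g N : ℝ} (hg : 0 ≤ g)
    (M : List (Fin k × Fin k)) (hpw : M.Pairwise PairDisjoint) (hne : ∀ x ∈ M, x.1 ≠ x.2)
    (hqp : ∀ x ∈ M, ∀ a b : Fin n, q s((x.1, a), (x.2, b)) = p)
    (hN : ∀ x ∈ M, N ≤ 2 * (#(R x.1) * #(R x.2)) * g ^ 2)
    (c : (Fin k → Fin n) → (Sym2 (Vertex k n) → Bool) → ℝ)
    (hc : ∀ τ, DependsOn (c τ) (listEdges n M)ᶜ) (C₀ : ℝ) :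
    prob q (fun ω => (∀ τ ∈ Fintype.piFinset R, |c τ ω| ≤ C₀) ∧
      #(Fintype.piFinset R) * (C₀ * (g / p) ^ M.length) <
        |∑ τ ∈ Fintype.piFinset R, matchingChar p M ω τ * c τ ω|) ≤
      M.length * (#(Fintype.piFinset R) * (2 * Real.exp (-N))) := by
  have hfalse : ∀ A : (Sym2 (Vertex k n) → Bool) → Prop, (∀ ω, ¬ A ω) → prob q A ≤ 0 := by
    intro A hA
    refine (prob_le_expectation hq (f := fun _ => 0) (fun _ => le_rfl)
      fun ω h => (hA ω h).elim).trans (expectation_const q 0).le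
  rcases (Fintype.piFinset R).eq_empty_or_nonempty with h0 | ⟨τ₀, hτ₀⟩
  · simp [h0, hfalse (fun ω => False) fun _ h => h]
  have hRne : ∀ i, (R i).Nonempty := fun i => ⟨τ₀ i, Fintype.mem_piFinset.1 hτ₀ i⟩
  induction M generalizing c C₀ with
  | nil =>
    refine (hfalse _ fun ω h => ?_).trans (by simp)
    obtain ⟨h1, h2⟩ := h
    refine absurd h2 (not_lt.2 ?_)
    simp only [matchingChar, List.map_nil, List.prod_nil, one_mul, List.length_nil, pow_zero,
      mul_one]
    refine (Finset.abs_sum_le_sum_abs _ _).trans ?_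
    refine (Finset.sum_le_card_nsmul _ _ C₀ h1).trans ?_
    rw [nsmul_eq_mul]
  | cons x M ih =>
    rw [List.pairwise_cons] at hpw
    have hx := hne x List.mem_cons_self
    let T := R x.1 ×ˢ R x.2
    let E : (Fin k → Fin n) → (Sym2 (Vertex k n) → Bool) → Prop := fun τ ω =>
      (∀ y ∈ T, |c (Function.update (Function.update τ x.1 y.1) x.2 y.2) ω| ≤ C₀) ∧
      #T * (C₀ * (g / p)) < |∑ y ∈ T,
        c (Function.update (Function.update τ x.1 y.1) x.2 y.2) ω *
          chiVal p (ω s((x.1, y.1), (x.2, y.2)))|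
    have hE : ∀ τ, prob q (E τ) ≤ 2 * Real.exp (-N) := by
      intro τ
      refine (prob_abs_sum_mul_chiVal_gt_le hq T (fun y => s((x.1, y.1), (x.2, y.2))) ?_ hp0 hp1
        (fun y _ => hqp x List.mem_cons_self _ _) (blockEdges n x.1 x.2)
        (fun y _ => ⟨y.1, y.2, rfl⟩)
        (fun y => c (Function.update (Function.update τ x.1 y.1) x.2 y.2))
        (fun y _ ω ω' h => hc _ fun e he => h e fun he' =>
          he ⟨x, List.mem_cons_self, he'⟩) C₀ hg).trans ?_
      · intro y _ z _ hyz
        rw [Sym2.eq_iff] at hyz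
        rcases hyz with hyz | hyz
        · exact Prod.ext (Prod.ext_iff.1 hyz.1).2 (Prod.ext_iff.1 hyz.2).2
        · exact absurd (Prod.ext_iff.1 hyz.1).1 hx
      · have := hN x List.mem_cons_self
        have hT : (#T : ℝ) = #(R x.1) * #(R x.2) := by
          simp [T, Finset.card_product]
        rw [hT]
        gcongr
    have ih' := ih hpw.2 (fun y hy => hne y (List.mem_cons_of_mem _ hy))
      (fun y hy => hqp y (List.mem_cons_of_mem _ hy))
      (fun y hy => hN y (List.mem_cons_of_mem _ hy)) (pairAverage p R x c)
      (dependsOn_pairAverage p R x M hpw.1 c hc) (C₀ * (g / p))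
    have hsub := prob_mono hq (A := fun ω => (∀ τ ∈ Fintype.piFinset R, |c τ ω| ≤ C₀) ∧
      #(Fintype.piFinset R) * (C₀ * (g / p) ^ (x :: M).length) <
        |∑ τ ∈ Fintype.piFinset R, matchingChar p (x :: M) ω τ * c τ ω|)
      (B := fun ω => (∃ τ ∈ Fintype.piFinset R, E τ ω) ∨
        ((∀ τ ∈ Fintype.piFinset R, |pairAverage p R x c τ ω| ≤ C₀ * (g / p)) ∧
        #(Fintype.piFinset R) * (C₀ * (g / p) * (g / p) ^ M.length) <
        |∑ τ ∈ Fintype.piFinset R, matchingChar p M ω τ * pairAverage p R x c τ ω|)) ?_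
    · refine hsub.trans ((prob_or_le hq _ _).trans ?_)
      have h1 := (prob_exists_le hq (Fintype.piFinset R) E).trans
        (Finset.sum_le_card_nsmul _ _ _ fun τ _ => hE τ)
      rw [nsmul_eq_mul] at h1
      refine (add_le_add h1 ih').trans (le_of_eq ?_)
      push_cast [List.length_cons]
      ring
    · rintro ω ⟨h1, h2⟩
      by_cases hEx : ∃ τ ∈ Fintype.piFinset R, E τ ω
      · exact Or.inl hEx
      refine Or.inr ⟨fun τ hτ => ?_, ?_⟩
      · have hτE : ¬ E τ ω := fun h => hEx ⟨τ, hτ, h⟩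
        have hb : ∀ y ∈ T,
            |c (Function.update (Function.update τ x.1 y.1) x.2 y.2) ω| ≤ C₀ := by
          intro y hy
          refine h1 _ (Fintype.mem_piFinset.2 fun i => ?_)
          have hy := Finset.mem_product.1 hy
          by_cases h2 : i = x.2
          · subst h2; simpa using hy.2
          · by_cases h3 : i = x.1
            · subst h3; simpa [h2] using hy.1
            · simpa [h2, h3] using Fintype.mem_piFinset.1 hτ i
        have hle := not_lt.1 fun h => hτE ⟨hb, h⟩
        have hT : (#T : ℝ) = #(R x.1) * #(R x.2) := by
          simp [T, Finset.card_product]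
        have hTpos : (0 : ℝ) < #(R x.1) * #(R x.2) :=
          mul_pos (by exact_mod_cast (hRne _).card_pos) (by exact_mod_cast (hRne _).card_pos)
        rw [pairAverage, abs_div, abs_of_pos hTpos, div_le_iff₀ hTpos, mul_comm _ (_ * _), ← hT]
        exact hle
      · rw [sum_matchingChar_cons p R x hx M hpw.1 (hRne _) (hRne _) c ω] at h2
        rw [List.length_cons, pow_succ] at h2
        refine lt_of_eq_of_lt ?_ h2
        ring

end Chaos

/-! ### Cores and matchings of pattern graphs -/

section Cores

variable {k : ℕ}

open Classical in
/-- The neighbours in `W` of the vertices in `T`. -/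
noncomputable def nbrsIn (H : SimpleGraph (Fin k)) (W T : Finset (Fin k)) : Finset (Fin k) :=
  W.filter fun w => ∃ x ∈ T, H.Adj x w

theorem mem_nbrsIn {H : SimpleGraph (Fin k)} {W T : Finset (Fin k)} {w : Fin k} :
    w ∈ nbrsIn H W T ↔ w ∈ W ∧ ∃ x ∈ T, H.Adj x w := by
  classical
  simp [nbrsIn]

/-- The nontrivial direction of Hall's marriage theorem. -/
theorem hasMatching_of_card_le {H : SimpleGraph (Fin k)} {W U : Finset (Fin k)}
    (h : ∀ T ⊆ U, #T ≤ #(nbrsIn H W T)) : HasMatching H U W := by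
  classical
  obtain ⟨f, hf, hfm⟩ := (Finset.all_card_le_biUnion_card_iff_exists_injective
    (fun x : U => nbrsIn H W {(x : Fin k)})).1 (by
      intro s
      have h1 := h (s.map (Function.Embedding.subtype _)) (by
        intro x hx
        obtain ⟨y, -, rfl⟩ := Finset.mem_map.1 hx
        exact y.2)
      rw [Finset.card_map] at h1
      refine h1.trans (Finset.card_le_card fun w hw => ?_)
      obtain ⟨hw, x, hx, hxw⟩ := mem_nbrsIn.1 hw
      obtain ⟨y, hy, rfl⟩ := Finset.mem_map.1 hx
      exact Finset.mem_biUnion.2 ⟨y, hy, mem_nbrsIn.2 ⟨hw, y, by simp, hxw⟩⟩)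
  refine ⟨fun x => if hx : x ∈ U then f ⟨x, hx⟩ else x, ?_, ?_⟩
  · intro x hx y hy hxy
    have hx : x ∈ U := hx
    have hy : y ∈ U := hy
    simp only [hx, hy, dif_pos] at hxy
    simpa using hf hxy
  · intro u hu
    simp only [hu, dif_pos]
    obtain ⟨h1, x, hx, h2⟩ := mem_nbrsIn.1 (hfm ⟨u, hu⟩)
    rw [Finset.mem_singleton] at hx
    subst hx
    exact ⟨h1, h2⟩

/-- If a matching cannot be extended by the vertex `x`, then `x` together with some of the matched
vertices has all its neighbours among the partners of the latter. -/
theorem exists_tight_of_not_hasMatching {H : SimpleGraph (Fin k)} {W U : Finset (Fin k)}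
    {f : Fin k → Fin k} (hinj : Set.InjOn f (U : Set (Fin k)))
    (hf : ∀ u ∈ U, f u ∈ W ∧ H.Adj u (f u)) {x : Fin k} (hx : ¬ HasMatching H (insert x U) W) :
    ∃ T ⊆ U, nbrsIn H W (insert x T) ⊆ T.image f := by
  classical
  have h : ∃ T ⊆ insert x U, #(nbrsIn H W T) < #T := by
    by_contra! h
    exact hx (hasMatching_of_card_le h)
  obtain ⟨T', hT', hlt⟩ := h
  have himg : ∀ T ⊆ U, T.image f ⊆ nbrsIn H W T := by
    intro T hT w hw
    obtain ⟨u, hu, rfl⟩ := Finset.mem_image.1 hw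
    exact mem_nbrsIn.2 ⟨(hf u (hT hu)).1, u, hu, (hf u (hT hu)).2⟩
  have hcard : ∀ T ⊆ U, #(T.image f) = #T := fun T hT =>
    Finset.card_image_of_injOn (hinj.mono (by exact_mod_cast hT))
  have hxT : x ∈ T' := by
    by_contra hxT
    have hTU : T' ⊆ U := (Finset.subset_insert_iff_of_notMem hxT).1 hT'
    have := Finset.card_le_card (himg T' hTU)
    rw [hcard T' hTU] at this
    omega
  refine ⟨T'.erase x, Finset.subset_insert_iff.1 hT', ?_⟩
  have hTU : T'.erase x ⊆ U := Finset.subset_insert_iff.1 hT'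
  rw [Finset.insert_erase hxT]
  have hsub : (T'.erase x).image f ⊆ nbrsIn H W T' := (himg _ hTU).trans (by
    intro w hw
    obtain ⟨h1, y, hy, h2⟩ := mem_nbrsIn.1 hw
    exact mem_nbrsIn.2 ⟨h1, y, Finset.mem_of_mem_erase hy, h2⟩)
  refine (Finset.eq_of_subset_of_card_le hsub ?_).symm.subset
  rw [hcard _ hTU, Finset.card_erase_of_mem hxT]
  omega

theorem exists_isMinVertexCover (H : SimpleGraph (Fin k)) : ∃ W, IsMinVertexCover H W := by
  classical
  obtain ⟨W, hW, hmin⟩ := (Finset.univ.filter fun W : Finset (Fin k) =>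
    H.IsVertexCover (W : Set (Fin k))).exists_min_image (fun W => #W)
    ⟨Finset.univ, by simp [SimpleGraph.IsVertexCover]⟩
  exact ⟨W, (Finset.mem_filter.1 hW).2, fun W' hW' => hmin W' (by simpa using hW')⟩

theorem isMinVertexCover_coreW (H : SimpleGraph (Fin k)) : IsMinVertexCover H (coreW H) :=
  (isLexFirst_lexFirst (exists_isMinVertexCover H)).1

theorem maximal_lexFirst {P : Finset (Fin k) → Prop} (h : P ∅) :
    Maximal P (lexFirst (Maximal P)) := by
  refine (isLexFirst_lexFirst (P := Maximal P) ?_).1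
  obtain ⟨U, -, hU⟩ := (Set.toFinite {U | P U}).exists_le_maximal h
  exact ⟨U, hU⟩

theorem hasMatching_empty (H : SimpleGraph (Fin k)) (W : Finset (Fin k)) : HasMatching H ∅ W :=
  ⟨id, by simp, by simp⟩

theorem maximal_coreU₁ (H : SimpleGraph (Fin k)) :
    Maximal (fun U => Disjoint U (coreW H) ∧ HasMatching H U (coreW H)) (coreU₁ H) :=
  maximal_lexFirst ⟨Finset.disjoint_empty_left _, hasMatching_empty _ _⟩

theorem maximal_coreU₂ (H : SimpleGraph (Fin k)) :
    Maximal (fun U => Disjoint U (coreW H ∪ coreU₁ H) ∧ HasMatching H U (coreW H)) (coreU₂ H) :=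
  maximal_lexFirst ⟨Finset.disjoint_empty_left _, hasMatching_empty _ _⟩

theorem not_hasMatching_insert_of_maximal {H : SimpleGraph (Fin k)} {X W U : Finset (Fin k)}
    (h : Maximal (fun U => Disjoint U X ∧ HasMatching H U W) U) {x : Fin k} (hx : x ∉ U)
    (hX : x ∉ X) : ¬ HasMatching H (insert x U) W := by
  intro hm
  have hle := h.2 (y := insert x U) ⟨by
    rw [Finset.disjoint_insert_left]
    exact ⟨hX, h.1.1⟩, hm⟩ (Finset.subset_insert x U)
  exact hx (hle (Finset.mem_insert_self x U))

/-- The vertices outside of a core have all their neighbours in every minimum vertex cover of the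
core. Otherwise two disjoint systems of partners, one in `U₁` and one in `U₂`, would allow one to
exchange part of the cover for a smaller set. -/
theorem mem_of_isMinVertexCover_core {H : SimpleGraph (Fin k)} {W' : Finset (Fin k)}
    (hW' : IsMinVertexCover (core H) W') {v w : Fin k}
    (hv : v ∉ coreW H ∪ coreU₁ H ∪ coreU₂ H) (hw : w ∈ coreW H) (hvw : H.Adj v w) :
    w ∈ W' := by
  classical
  by_contra hwW'
  simp only [Finset.mem_union, not_or] at hv
  obtain ⟨⟨hvW, hvU1⟩, hvU2⟩ := hv
  have hm1 := maximal_coreU₁ H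
  have hm2 := maximal_coreU₂ H
  obtain ⟨f₁, hinj1, hf1⟩ := hm1.1.2
  obtain ⟨f₂, hinj2, hf2⟩ := hm2.1.2
  have hd1 := hm1.1.1
  have hd2 := hm2.1.1
  rw [Finset.disjoint_union_right] at hd2
  obtain ⟨T, hTU, hT⟩ := exists_tight_of_not_hasMatching hinj2 hf2
    (not_hasMatching_insert_of_maximal hm2 hvU2 (by simp [hvW, hvU1]))
  have hex : ∀ x ∈ insert v T, ∃ S ⊆ coreU₁ H, nbrsIn H (coreW H) (insert x S) ⊆ S.image f₁ := by
    intro x hx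
    refine exists_tight_of_not_hasMatching hinj1 hf1 (not_hasMatching_insert_of_maximal hm1 ?_ ?_)
    · rcases Finset.mem_insert.1 hx with rfl | hx
      · exact hvU1
      · exact fun h => Finset.disjoint_left.1 hd2.2 (hTU hx) h
    · rcases Finset.mem_insert.1 hx with rfl | hx
      · exact hvW
      · exact fun h => Finset.disjoint_left.1 hd2.1 (hTU hx) h
  choose! S hSU hS using hex
  let T₁ := (insert v T).biUnion S
  have hT1U : T₁ ⊆ coreU₁ H := Finset.biUnion_subset.2 hSU
  have hmemT : ∀ x ∈ T₁, ∀ z ∈ coreW H, H.Adj x z → z ∈ T₁.image f₁ := by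
    intro x hx z hz hxz
    obtain ⟨y, hy, hxy⟩ := Finset.mem_biUnion.1 hx
    have := hS y hy (mem_nbrsIn.2 ⟨hz, x, Finset.mem_insert_of_mem hxy, hxz⟩)
    exact Finset.image_subset_image (Finset.subset_biUnion_of_mem S hy) this
  have hmemT' : ∀ x ∈ insert v T, ∀ z ∈ coreW H, H.Adj x z → z ∈ T₁.image f₁ := by
    intro x hx z hz hxz
    have := hS x hx (mem_nbrsIn.2 ⟨hz, x, Finset.mem_insert_self _ _, hxz⟩)
    exact Finset.image_subset_image (Finset.subset_biUnion_of_mem S hx) this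
  have hcov := (isMinVertexCover_coreW H).1
  -- exchange `T ∪ T₁` for the partners of `T₁`
  let W'' := (W' \ (T ∪ T₁)) ∪ T₁.image f₁
  have hcov'' : (core H).IsVertexCover (W'' : Set (Fin k)) := by
    have aux : ∀ x y, (core H).Adj x y → x ∈ W' → x ∈ W'' ∨ y ∈ W'' := by
      intro x y hxy hx
      by_cases hxT : x ∈ T ∪ T₁
      · right
        have hxW : x ∉ coreW H := by
          rcases Finset.mem_union.1 hxT with h | h
          · exact fun h' => Finset.disjoint_left.1 hd2.1 (hTU h) h'
          · exact fun h' => Finset.disjoint_left.1 hd1 (hT1U h) h'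
        have hy : y ∈ coreW H := by
          rcases hcov hxy.2.2 with h | h
          · exact absurd h hxW
          · exact h
        refine Finset.mem_union_right _ ?_
        rcases Finset.mem_union.1 hxT with h | h
        · exact hmemT' x (Finset.mem_insert_of_mem h) y hy hxy.2.2
        · exact hmemT x h y hy hxy.2.2
      · exact Or.inl (Finset.mem_union_left _ (Finset.mem_sdiff.2 ⟨hx, hxT⟩))
    intro x y hxy
    rcases hW'.1 hxy with h | h
    · exact aux x y hxy h
    · exact (aux y x hxy.symm h).symm
  have hle := hW'.2 W'' hcov''
  -- every partner outside of `W'` is compensated by an element of `W' ∩ T₁`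
  have hcard1 : #(T₁.image f₁ \ W') ≤ #(W' ∩ T₁) := by
    refine (Finset.card_le_card (t := (W' ∩ T₁).image f₁) fun z hz => ?_).trans
      Finset.card_image_le
    obtain ⟨hz1, hz2⟩ := Finset.mem_sdiff.1 hz
    obtain ⟨x, hx, rfl⟩ := Finset.mem_image.1 hz1
    refine Finset.mem_image.2 ⟨x, Finset.mem_inter.2 ⟨?_, hx⟩, rfl⟩
    have hadj : (core H).Adj x (f₁ x) :=
      ⟨by simp [hT1U hx], by simp [(hf1 x (hT1U hx)).1], (hf1 x (hT1U hx)).2⟩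
    exact (hW'.1 hadj).resolve_right hz2
  -- the partner of `w` in `T` is a further element of `W'` that is given up
  obtain ⟨x, hxT, hxw⟩ := Finset.mem_image.1
    (hT (mem_nbrsIn.2 ⟨hw, v, Finset.mem_insert_self _ _, hvw⟩))
  have hxW' : x ∈ W' := by
    have hadj : (core H).Adj x (f₂ x) :=
      ⟨by simp [hTU hxT], by simp [(hf2 x (hTU hxT)).1], (hf2 x (hTU hxT)).2⟩
    rw [hxw] at hadj
    exact (hW'.1 hadj).resolve_right hwW'
  have hxT1 : x ∉ T₁ := fun h => Finset.disjoint_left.1 hd2.2 (hTU hxT) (hT1U h)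
  have hcard2 : #(W' ∩ T₁) + 1 ≤ #(W' ∩ (T ∪ T₁)) := by
    rw [← Finset.card_insert_of_notMem (a := x) (s := W' ∩ T₁) (by simp [hxT1])]
    refine Finset.card_le_card (Finset.insert_subset (by simp [hxW', hxT]) ?_)
    exact Finset.inter_subset_inter_left Finset.subset_union_right
  have hcard3 : #W'' ≤ #(W' \ (T ∪ T₁)) + #(T₁.image f₁ \ W') := by
    -- the partners lie in the cover of `H`, which is disjoint from `T ∪ T₁`
    have hdisj : ∀ z ∈ T₁.image f₁, z ∉ T ∪ T₁ := by
      intro z hz hzT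
      obtain ⟨y, hy, rfl⟩ := Finset.mem_image.1 hz
      have hyW := (hf1 y (hT1U hy)).1
      rcases Finset.mem_union.1 hzT with h | h
      · exact Finset.disjoint_left.1 hd2.1 (hTU h) hyW
      · exact Finset.disjoint_left.1 hd1 (hT1U h) hyW
    refine (Finset.card_le_card fun z hz => ?_).trans (Finset.card_union_le _ _)
    rcases Finset.mem_union.1 hz with h | h
    · exact Finset.mem_union_left _ h
    · by_cases hzW : z ∈ W'
      · exact Finset.mem_union_left _ (Finset.mem_sdiff.2 ⟨hzW, hdisj z h⟩)
      · exact Finset.mem_union_right _ (Finset.mem_sdiff.2 ⟨h, hzW⟩)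
  have hcard4 := Finset.card_sdiff_add_card_inter W' (T ∪ T₁)
  omega

/-- A vertex of a minimum vertex cover is not isolated. -/
theorem mem_support_of_mem_coreW {F : SimpleGraph (Fin k)} {w : Fin k} (hw : w ∈ coreW F) :
    w ∈ F.support := by
  classical
  by_contra hs
  obtain ⟨hcov, hmin⟩ := isMinVertexCover_coreW F
  have h := hmin ((coreW F).erase w) (by
    intro x y hxy
    have hx : x ≠ w := fun h => hs ⟨y, h ▸ hxy⟩
    have hy : y ≠ w := fun h => hs ⟨x, h ▸ hxy.symm⟩
    simpa [hx, hy] using hcov hxy)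
  rw [Finset.card_erase_of_mem hw] at h
  have := Finset.card_pos.2 ⟨w, hw⟩
  omega

/-- The edges in `E⋆_F` run between the first minimum vertex cover of `F` and the isolated vertices
of `F`. -/
theorem exists_of_mem_eStar {F : SimpleGraph (Fin k)} {e : Sym2 (Fin k)} (he : e ∈ eStar F) :
    ∃ w v, w ∈ coreW F ∧ v ∉ F.support ∧ e = s(w, v) := by
  obtain ⟨H, rfl, heH, heF⟩ := he
  -- an edge at `x ∈ W` that is not in the core leaves the core
  have aux : ∀ x y, H.Adj x y → x ∈ coreW H → ¬ (core H).Adj x y →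
      x ∈ coreW (core H) ∧ y ∉ (core H).support := by
    intro x y hxy hx hn
    have hy : y ∉ coreW H ∪ coreU₁ H ∪ coreU₂ H := fun hy => hn ⟨by simp [hx], hy, hxy⟩
    exact ⟨mem_of_isMinVertexCover_core (isMinVertexCover_coreW _) hy hx hxy.symm,
      fun ⟨z, hz⟩ => hy hz.1⟩
  induction e using Sym2.ind with
  | _ x y =>
    rw [SimpleGraph.mem_edgeSet] at heH heF
    rcases (isMinVertexCover_coreW H).1 heH with hx | hy
    · exact ⟨x, y, (aux x y heH hx heF).1, (aux x y heH hx heF).2, rfl⟩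
    · have h := aux y x heH.symm hy fun h => heF h.symm
      exact ⟨y, x, h.1, h.2, Sym2.eq_swap⟩

theorem card_coreW (F : SimpleGraph (Fin k)) : #(coreW F) = vc F := by
  obtain ⟨hcov, hmin⟩ := isMinVertexCover_coreW F
  obtain ⟨s, hs, hsc⟩ := F.vertexCoverNum_exists
  lift s to Finset (Fin k) using s.toFinite
  have h1 := hmin s hsc
  have h2 := hcov.vertexCoverNum_le
  rw [Set.encard_coe_eq_coe_finsetCard] at hs h2
  rw [← hs] at h2
  have h3 : #s ≤ #(coreW F) := by exact_mod_cast h2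
  rw [vc, ← hs, ENat.toNat_natCast]
  omega

/-- A maximal matching inside `S` covers all edges inside `S` by its endpoints. -/
theorem exists_matching_and_cover (F : SimpleGraph (Fin k)) (S : Finset (Fin k)) :
    ∃ M : List (Fin k × Fin k), M.Pairwise PairDisjoint ∧
      (∀ x ∈ M, x.1 ∈ S ∧ x.2 ∈ S ∧ F.Adj x.1 x.2) ∧
      ∃ C : Finset (Fin k), #C ≤ 2 * M.length ∧
        ∀ i ∈ S, ∀ j ∈ S, F.Adj i j → i ∈ C ∨ j ∈ C := by
  classical
  induction S using Finset.strongInduction with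
  | H S ih =>
    by_cases h : ∃ i ∈ S, ∃ j ∈ S, F.Adj i j
    swap
    · push Not at h
      exact ⟨[], List.Pairwise.nil, by simp, ∅, by simp, fun i hi j hj hij => absurd hij (h i hi j hj)⟩
    obtain ⟨i, hi, j, hj, hij⟩ := h
    obtain ⟨M, hM, hMS, C, hC, hcov⟩ := ih ((S.erase i).erase j)
      ((Finset.erase_subset _ _).trans_ssubset (Finset.erase_ssubset hi))
    refine ⟨(i, j) :: M, List.pairwise_cons.2 ⟨fun y hy => ?_, hM⟩, fun x hx => ?_,
      insert i (insert j C), ?_, ?_⟩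
    · have h := hMS y hy
      simp only [Finset.mem_erase] at h
      exact ⟨h.1.2.1.symm, h.2.1.2.1.symm, h.1.1.symm, h.2.1.1.symm⟩
    · rcases List.mem_cons.1 hx with rfl | hx
      · exact ⟨hi, hj, hij⟩
      · have h := hMS x hx
        simp only [Finset.mem_erase] at h
        exact ⟨h.1.2.2, h.2.1.2.2, h.2.2⟩
    · have h1 := Finset.card_insert_le i (insert j C)
      have h2 := Finset.card_insert_le j C
      rw [List.length_cons]
      omega
    · intro a ha b hb hab
      simp only [Finset.mem_insert]
      by_contra! hn
      rcases hcov a (by simp [hn.1.1, hn.1.2.1, ha]) b (by simp [hn.2.1, hn.2.2.1, hb]) hab with h | h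
      · exact hn.1.2.2 h
      · exact hn.2.2.2 h

/-- `F[B]` has a matching of at least half the size of a minimum vertex cover. -/
theorem exists_matching (F : SimpleGraph (Fin k)) (B : Finset (Fin k)) :
    ∃ M : List (Fin k × Fin k), M.Pairwise PairDisjoint ∧
      (∀ x ∈ M, x.1 ∈ B ∧ x.2 ∈ B ∧ F.Adj x.1 x.2) ∧ vc (restrict F B) ≤ 2 * M.length := by
  classical
  obtain ⟨M, hM, hMS, C, hC, hcov⟩ := exists_matching_and_cover F B
  refine ⟨M, hM, hMS, le_trans ?_ hC⟩
  have h1 : (restrict F B).IsVertexCover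
      ((C.subtype (· ∈ B) : Finset B) : Set B) := by
    intro x y hxy
    simpa using hcov x x.2 y y.2 hxy
  have h2 := h1.vertexCoverNum_le
  rw [Set.encard_coe_eq_coe_finsetCard] at h2
  have h3 : vc (restrict F B) ≤ #(C.subtype (· ∈ B)) := ENat.toNat_le_of_le_natCast h2
  refine h3.trans ?_
  rw [Finset.card_subtype]
  exact Finset.card_filter_le _ _

end Cores

/-! ### Expanding the character sums -/

section Expansion

variable {k n : ℕ}

/-- The vertex that the full tuple `τ` picks in block `i`. -/
def pick (τ : Fin k → Fin n) (i : Fin k) : Vertex k n := (i, τ i)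

theorem pick_injective (τ : Fin k → Fin n) : Function.Injective (pick τ) :=
  fun _ _ h => (Prod.ext_iff.1 h).1

/-- The character at the edge that the full tuple `τ` picks between the two blocks in `e`. -/
noncomputable def chiAt (p : ℝ) (G : SimpleGraph (Vertex k n)) (τ : Fin k → Fin n)
    (e : Sym2 (Fin k)) : ℝ :=
  chi p G (Sym2.map (pick τ) e)

open Classical in
/-- The edges in `E` with both endpoints in `B`, as a finset. -/
noncomputable def withinFinset (E : Set (Sym2 (Fin k))) (B : Finset (Fin k)) :
    Finset (Sym2 (Fin k)) :=
  Finset.univ.filter fun e => e ∈ E ∧ ∀ i ∈ e, i ∈ B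

theorem mem_withinFinset {E : Set (Sym2 (Fin k))} {B : Finset (Fin k)} {e : Sym2 (Fin k)} :
    e ∈ withinFinset E B ↔ e ∈ E ∧ ∀ i ∈ e, i ∈ B := by
  classical
  simp [withinFinset]

/-- The rectangle with the sides of `Q` in the blocks in `B` and a single vertex elsewhere. -/
def fillRect (a₀ : Fin n) (B : Finset (Fin k)) (Q : Fin k → Finset (Fin n)) (i : Fin k) :
    Finset (Fin n) :=
  if i ∈ B then Q i else {a₀}

theorem fillRect_of_mem (a₀ : Fin n) {B : Finset (Fin k)} (Q : Fin k → Finset (Fin n)) {i : Fin k}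
    (hi : i ∈ B) : fillRect a₀ B Q i = Q i := if_pos hi

theorem card_piFinset_fillRect (a₀ : Fin n) (B : Finset (Fin k)) (Q : Fin k → Finset (Fin n)) :
    (#(Fintype.piFinset (fillRect a₀ B Q)) : ℝ) = ∏ i ∈ B, (#(Q i) : ℝ) := by
  rw [Fintype.card_piFinset, Nat.cast_prod, ← Finset.prod_subset (Finset.subset_univ B)]
  · exact Finset.prod_congr rfl fun i hi => by rw [fillRect_of_mem a₀ Q hi]
  · intro i _ hi
    simp [fillRect, hi]

theorem edgeSet_restrict_mem {H : SimpleGraph (Fin k)} {B : Finset (Fin k)} {x y : B} :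
    s(x, y) ∈ (restrict H B).edgeSet ↔ s((x : Fin k), (y : Fin k)) ∈ H.edgeSet := Iff.rfl

theorem image_val_edgeSet_restrict (H : SimpleGraph (Fin k)) (B : Finset (Fin k)) :
    Sym2.map (fun i : B => (i : Fin k)) '' (restrict H B).edgeSet =
      withinFinset H.edgeSet B := by
  ext e
  simp only [Set.mem_image, Finset.mem_coe, mem_withinFinset]
  constructor
  · rintro ⟨e, he, rfl⟩
    induction e using Sym2.ind with
    | _ x y => exact ⟨edgeSet_restrict_mem.1 he, by simp⟩
  · rintro ⟨he, hB⟩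
    induction e using Sym2.ind with
    | _ x y =>
      exact ⟨s(⟨x, hB x (by simp)⟩, ⟨y, hB y (by simp)⟩), he, rfl⟩

theorem ncard_edgeSet_restrict (H : SimpleGraph (Fin k)) (B : Finset (Fin k)) :
    (restrict H B).edgeSet.ncard = #(withinFinset H.edgeSet B) := by
  rw [← Set.ncard_coe_finset, ← image_val_edgeSet_restrict,
    Set.ncard_image_of_injective _ (Sym2.map.injective Subtype.val_injective)]

theorem ncard_edgeSet (H : SimpleGraph (Fin k)) :
    H.edgeSet.ncard = #(withinFinset H.edgeSet Finset.univ) := by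
  rw [← Set.ncard_coe_finset]
  congr 1
  ext e
  simp [mem_withinFinset]

theorem prod_edgesOn (p : ℝ) (G : SimpleGraph (Vertex k n)) (H : SimpleGraph (Fin k))
    (B : Finset (Fin k)) (τ : Fin k → Fin n) :
    ∏ e ∈ edgesOn H (fun i : B => τ i), chi p G e =
      ∏ e ∈ withinFinset H.edgeSet B, chiAt p G τ e := by
  classical
  have h : edgesOn H (fun i : B => τ i) =
      (withinFinset H.edgeSet B).image (Sym2.map (pick τ)) := by
    rw [← Finset.coe_inj, Finset.coe_image, ← image_val_edgeSet_restrict, ← Set.image_comp,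
      edgesOn, Finset.coe_image, SimpleGraph.coe_edgeFinset]
    refine Set.image_congr fun e _ => ?_
    rw [Function.comp_apply, Sym2.map_map]
    rfl
  rw [h, Finset.prod_image]
  · rfl
  · exact fun _ _ _ _ h => Sym2.map.injective (pick_injective τ) h

/-- Summing over all pattern graphs between `F` and `F ∪ E⋆` turns the characters of `E⋆` into the
factors `1 + χ`. -/
theorem sum_family_prod (F : SimpleGraph (Fin k)) (B : Finset (Fin k)) (X : Sym2 (Fin k) → ℝ) :
    ∑ H ∈ family F (edgesWithin (eStar F) B), ∏ e ∈ withinFinset H.edgeSet B, X e =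
      (∏ e ∈ withinFinset F.edgeSet B, X e) * ∏ e ∈ withinFinset (eStar F) B, (1 + X e) := by
  classical
  have hstar : ∀ e ∈ eStar F, e ∉ F.edgeSet ∧ ¬ e.IsDiag := by
    rintro e ⟨H, -, heH, heF⟩
    exact ⟨heF, H.not_isDiag_of_mem_edgeSet heH⟩
  have hedge : ∀ E' ⊆ withinFinset (eStar F) B,
      (SimpleGraph.fromEdgeSet (F.edgeSet ∪ (E' : Set (Sym2 (Fin k))))).edgeSet =
        F.edgeSet ∪ (E' : Set (Sym2 (Fin k))) := by
    intro E' hE'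
    rw [SimpleGraph.edgeSet_fromEdgeSet]
    refine sdiff_eq_left.2 (Set.disjoint_left.2 fun e he hd => ?_)
    rcases he with he | he
    · exact F.not_isDiag_of_mem_edgeSet he hd
    · exact (hstar e (mem_withinFinset.1 (hE' he)).1).2 hd
  have hsub : ∀ H : SimpleGraph (Fin k),
      withinFinset (eStar F ∩ H.edgeSet) B ⊆ withinFinset (eStar F) B := fun H e he =>
    mem_withinFinset.2 ⟨(mem_withinFinset.1 he).1.1, (mem_withinFinset.1 he).2⟩
  rw [Finset.prod_one_add, Finset.mul_sum]
  symm
  refine Finset.sum_nbij'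
    (fun E' => SimpleGraph.fromEdgeSet (F.edgeSet ∪ (E' : Set (Sym2 (Fin k)))))
    (fun H => withinFinset (eStar F ∩ H.edgeSet) B) ?_ ?_ ?_ ?_ ?_
  · intro E' hE'
    rw [Finset.mem_powerset] at hE'
    rw [family, Finset.mem_filter]
    exact ⟨Finset.mem_univ _, E', fun e he => mem_withinFinset.1 (hE' he), hedge E' hE'⟩
  · intro H _
    exact Finset.mem_powerset.2 (hsub H)
  · intro E' hE'
    rw [Finset.mem_powerset] at hE'
    ext e
    rw [mem_withinFinset, hedge E' hE']
    constructor
    · rintro ⟨⟨h1, h2 | h2⟩, -⟩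
      · exact absurd h2 (hstar e h1).1
      · exact h2
    · intro h
      have := mem_withinFinset.1 (hE' h)
      exact ⟨⟨this.1, Or.inr h⟩, this.2⟩
  · intro H hH
    rw [family, Finset.mem_filter] at hH
    obtain ⟨-, E', hE', hHE⟩ := hH
    rw [← SimpleGraph.edgeSet_inj, hedge _ (hsub H)]
    ext e
    simp only [Set.mem_union, Finset.mem_coe, mem_withinFinset, Set.mem_inter_iff, hHE]
    constructor
    · rintro (h | ⟨⟨-, h⟩, -⟩)
      · exact Or.inl h
      · exact h
    · rintro (h | h)
      · exact Or.inl h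
      · exact Or.inr ⟨⟨(hE' h).1, Or.inr h⟩, (hE' h).2⟩
  · intro E' hE'
    rw [Finset.mem_powerset] at hE'
    have : withinFinset (SimpleGraph.fromEdgeSet (F.edgeSet ∪ (E' : Set (Sym2 (Fin k))))).edgeSet B =
        withinFinset F.edgeSet B ∪ E' := by
      ext e
      rw [mem_withinFinset, hedge E' hE', Finset.mem_union, mem_withinFinset]
      constructor
      · rintro ⟨h | h, hB⟩
        · exact Or.inl ⟨h, hB⟩
        · exact Or.inr h
      · rintro (h | h)
        · exact ⟨Or.inl h.1, h.2⟩
        · exact ⟨Or.inr h, (mem_withinFinset.1 (hE' h)).2⟩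
    rw [this, Finset.prod_union]
    refine Finset.disjoint_left.2 fun e h1 h2 => ?_
    exact (hstar e (mem_withinFinset.1 (hE' h2)).1).1 (mem_withinFinset.1 h1).1

/-- Summing over `ℋ(F, E⋆_F[B])` amounts to a factor `1 + χ_e` for each edge `e ∈ E⋆_F[B]`. The sum
runs over full tuples, with the constant coordinate `a₀` in the blocks outside of `B`. -/
theorem charSum_eq (p : ℝ) (G : SimpleGraph (Vertex k n)) (F : SimpleGraph (Fin k))
    (B : Finset (Fin k)) (Q : Fin k → Finset (Fin n)) (a₀ : Fin n) :
    charSum p G F B Q = ∑ τ ∈ Fintype.piFinset (fillRect a₀ B Q),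
      (∏ e ∈ withinFinset F.edgeSet B, chiAt p G τ e) *
        ∏ e ∈ withinFinset (eStar F) B, (1 + chiAt p G τ e) := by
  classical
  rw [charSum]
  refine Finset.sum_nbij' (fun t i => if h : i ∈ B then t ⟨i, h⟩ else a₀) (fun τ i => τ i)
    ?_ ?_ ?_ ?_ ?_
  · intro t ht
    rw [Fintype.mem_piFinset] at ht ⊢
    intro i
    by_cases hi : i ∈ B
    · simpa [hi, fillRect] using ht ⟨i, hi⟩
    · simp [hi, fillRect]
  · intro τ hτ
    rw [Fintype.mem_piFinset] at hτ ⊢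
    intro i
    simpa [fillRect] using hτ i
  · intro t _
    funext i
    simp
  · intro τ hτ
    rw [Fintype.mem_piFinset] at hτ
    funext i
    by_cases hi : i ∈ B
    · simp [hi]
    · have := hτ i
      simp only [fillRect, hi, if_false, Finset.mem_singleton] at this
      simp [hi, this]
  · intro t _
    rw [← sum_family_prod]
    refine Finset.sum_congr rfl fun H _ => ?_
    rw [← prod_edgesOn]
    congr 2
    funext i
    simp

end Expansion

/-! ### Concentration of the character sums -/

section CharSums

variable {k n : ℕ}

/-- The graph whose potential edges are given by the outcome `ω`. -/
def graphOf (ω : Sym2 (Vertex k n) → Bool) : SimpleGraph (Vertex k n) :=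
  SimpleGraph.fromEdgeSet {e | ω e = true}

theorem mem_edgeSet_graphOf {ω : Sym2 (Vertex k n) → Bool} {e : Sym2 (Vertex k n)}
    (he : ¬ e.IsDiag) : e ∈ (graphOf ω).edgeSet ↔ ω e = true := by
  rw [graphOf, SimpleGraph.edgeSet_fromEdgeSet]
  exact ⟨fun h => h.1, fun h => ⟨h, he⟩⟩

theorem graphOf_adj {ω : Sym2 (Vertex k n) → Bool} {u v : Vertex k n} (h : u ≠ v) :
    (graphOf ω).Adj u v ↔ ω s(u, v) = true := by
  rw [← SimpleGraph.mem_edgeSet, mem_edgeSet_graphOf (by simpa using h)]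

theorem chiAt_graphOf (p : ℝ) (ω : Sym2 (Vertex k n) → Bool) (τ : Fin k → Fin n)
    {i j : Fin k} (h : i ≠ j) :
    chiAt p (graphOf ω) τ s(i, j) = chiVal p (ω s((i, τ i), (j, τ j))) := by
  have hne : ((i, τ i) : Vertex k n) ≠ (j, τ j) := fun h' => h (Prod.ext_iff.1 h').1
  have : Sym2.map (pick τ) s(i, j) = s((i, τ i), (j, τ j)) := rfl
  rw [chiAt, chi, this, chiVal]
  simp only [mem_edgeSet_graphOf (ω := ω) (e := s((i, τ i), (j, τ j))) (by simpa using hne)]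

/-- `1 + χ_e` is the normalized indicator of the edge `e`. -/
theorem one_add_chiVal {p : ℝ} (hp : 0 < p) (b : Bool) :
    1 + chiVal p b = if b then p⁻¹ else 0 := by
  unfold chiVal
  split_ifs
  · field_simp; ring
  · ring

/-- The average of `h` over the side of `R` in block `v`. -/
noncomputable def sideAverage (R : Fin k → Finset (Fin n)) (v : Fin k)
    (h : (Fin k → Fin n) → ℝ) (τ : Fin k → Fin n) : ℝ :=
  (∑ a ∈ R v, h (Function.update τ v a)) / #(R v)

/-- Factors that are the only ones to involve their block can be replaced by their averages. -/
theorem sum_mul_prod_eq_sum_mul_prod_sideAverage (R : Fin k → Finset (Fin n)) (s : Finset (Fin k))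
    (hR : ∀ v ∈ s, (R v).Nonempty) (g : (Fin k → Fin n) → ℝ)
    (h : Fin k → (Fin k → Fin n) → ℝ)
    (hg : ∀ v ∈ s, ∀ τ a, g (Function.update τ v a) = g τ)
    (hh : ∀ v ∈ s, ∀ u ∈ s, u ≠ v → ∀ τ a, h u (Function.update τ v a) = h u τ) :
    ∑ τ ∈ Fintype.piFinset R, g τ * ∏ v ∈ s, h v τ =
      ∑ τ ∈ Fintype.piFinset R, g τ * ∏ v ∈ s, sideAverage R v (h v) τ := by
  induction s using Finset.induction_on generalizing g with
  | empty => simp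
  | insert v s hv ih =>
    have hvs : v ∈ insert v s := Finset.mem_insert_self v s
    have hs : ∀ {u}, u ∈ s → u ∈ insert v s := fun hu => Finset.mem_insert_of_mem hu
    have hne : ∀ {u}, u ∈ s → u ≠ v := fun hu h => hv (h ▸ hu)
    have h1 := ih (fun u hu => hR u (hs hu)) (fun τ => g τ * h v τ)
      (fun u hu τ a => by
        simp only [hg u (hs hu), hh u (hs hu) v hvs (hne hu).symm])
      (fun u hu w hw => hh u (hs hu) w (hs hw))
    have hpos : (0 : ℝ) < #(R v) := by exact_mod_cast (hR v hvs).card_pos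
    set G : (Fin k → Fin n) → ℝ := fun τ => g τ * ∏ u ∈ s, sideAverage R u (h u) τ with hG
    have hGv : ∀ τ a, G (Function.update τ v a) = G τ := by
      intro τ a
      simp only [hG, hg v hvs]
      congr 1
      refine Finset.prod_congr rfl fun u hu => ?_
      simp only [sideAverage]
      congr 1
      refine Finset.sum_congr rfl fun b _ => ?_
      rw [Function.update_comm (hne hu).symm, hh v hvs u (hs hu) (hne hu)]
    have h2 : ∑ τ ∈ Fintype.piFinset R, G τ * h v τ =
        ∑ τ ∈ Fintype.piFinset R, G τ * sideAverage R v (h v) τ := by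
      have := card_mul_sum_piFinset R v (fun τ => G τ * h v τ)
      refine mul_left_cancel₀ hpos.ne' (this.trans ?_)
      rw [Finset.mul_sum]
      refine Finset.sum_congr rfl fun τ _ => ?_
      simp only [hGv, ← Finset.mul_sum, sideAverage]
      field_simp
    calc _ = ∑ τ ∈ Fintype.piFinset R, g τ * h v τ * ∏ u ∈ s, h u τ := by
          refine Finset.sum_congr rfl fun τ _ => ?_
          rw [Finset.prod_insert hv]; ring
      _ = ∑ τ ∈ Fintype.piFinset R, G τ * h v τ := by
          rw [h1]
          refine Finset.sum_congr rfl fun τ _ => ?_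
          simp only [hG]; ring
      _ = _ := by
          rw [h2]
          refine Finset.sum_congr rfl fun τ _ => ?_
          rw [Finset.prod_insert hv]; simp only [hG]; ring

open Classical in
/-- The blocks in `B` that are joined to block `v` by an edge in `E⋆_F`. -/
noncomputable def starNbrs (F : SimpleGraph (Fin k)) (B : Finset (Fin k)) (v : Fin k) :
    Finset (Fin k) :=
  B.filter fun w => s(w, v) ∈ eStar F

theorem mem_starNbrs {F : SimpleGraph (Fin k)} {B : Finset (Fin k)} {v w : Fin k} :
    w ∈ starNbrs F B v ↔ w ∈ B ∧ s(w, v) ∈ eStar F := by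
  classical
  simp [starNbrs]

theorem mem_supportIn {F : SimpleGraph (Fin k)} {B : Finset (Fin k)} {v : Fin k} :
    v ∈ supportIn F B ↔ v ∈ B ∧ v ∈ F.support := by
  classical
  simp [supportIn]

theorem mem_coreW_of_mem_eStar {F : SimpleGraph (Fin k)} {v w : Fin k} (hv : v ∉ F.support)
    (h : s(w, v) ∈ eStar F) : w ∈ coreW F := by
  obtain ⟨w', v', hw', -, he⟩ := exists_of_mem_eStar h
  rw [Sym2.eq_iff] at he
  rcases he with he | he
  · exact he.1 ▸ hw'
  · exact absurd (mem_support_of_mem_coreW hw') (he.2 ▸ hv)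

theorem starNbrs_subset_coreW {F : SimpleGraph (Fin k)} {B : Finset (Fin k)} {v : Fin k}
    (hv : v ∉ F.support) : starNbrs F B v ⊆ coreW F := fun _ hw =>
  mem_coreW_of_mem_eStar hv (mem_starNbrs.1 hw).2

theorem starNbrs_subset_supportIn {F : SimpleGraph (Fin k)} {B : Finset (Fin k)} {v : Fin k}
    (hv : v ∉ F.support) : starNbrs F B v ⊆ supportIn F B := fun _ hw =>
  mem_supportIn.2 ⟨(mem_starNbrs.1 hw).1,
    mem_support_of_mem_coreW (starNbrs_subset_coreW hv hw)⟩

/-- The edges of `E⋆_F` inside `B`, grouped by their endpoint that is isolated in `F`. -/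
theorem prod_withinFinset_eStar (F : SimpleGraph (Fin k)) (B : Finset (Fin k))
    (X : Sym2 (Fin k) → ℝ) :
    ∏ e ∈ withinFinset (eStar F) B, X e =
      ∏ v ∈ B \ supportIn F B, ∏ w ∈ starNbrs F B v, X s(w, v) := by
  classical
  rw [Finset.prod_sigma' (B \ supportIn F B) (fun v => starNbrs F B v) fun v w => X s(w, v)]
  symm
  refine Finset.prod_bij (fun x _ => s(x.2, x.1)) ?_ ?_ ?_ ?_
  · rintro ⟨v, w⟩ hx
    rw [Finset.mem_sigma, Finset.mem_sdiff] at hx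
    have hw := mem_starNbrs.1 hx.2
    refine mem_withinFinset.2 ⟨hw.2, ?_⟩
    simpa using ⟨hw.1, hx.1.1⟩
  · rintro ⟨v, w⟩ hx ⟨v', w'⟩ hx' he
    simp only [Finset.mem_sigma, Finset.mem_sdiff, mem_supportIn, not_and] at hx hx'
    have hw := starNbrs_subset_coreW (hx.1.2 hx.1.1) hx.2
    rcases Sym2.eq_iff.1 he with h | h
    · obtain ⟨h1, h2⟩ := h
      dsimp only at h1 h2
      subst h1 h2; rfl
    · have h1 : w = v' := h.1
      exact absurd (mem_support_of_mem_coreW hw) (h1 ▸ hx'.1.2 hx'.1.1)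
  · intro e he
    obtain ⟨he1, he2⟩ := mem_withinFinset.1 he
    obtain ⟨w, v, -, hv, rfl⟩ := exists_of_mem_eStar he1
    have hwB := he2 w (by simp)
    have hvB := he2 v (by simp)
    refine ⟨⟨v, w⟩, ?_, rfl⟩
    rw [Finset.mem_sigma, Finset.mem_sdiff, mem_supportIn]
    exact ⟨⟨hvB, fun h => hv h.2⟩, mem_starNbrs.2 ⟨hwB, he1⟩⟩
  · intro _ _; rfl

theorem card_commonNbrs_side (G : SimpleGraph (Vertex k n)) {S : Finset (Fin k)} (t : S → Fin n)
    (Q : Fin k → Finset (Fin n)) (v : Fin k) [DecidablePred fun a => ∀ i : S, G.Adj (vert t i) (v, a)] :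
    #(commonNbrs G t (side Q v)) = #((Q v).filter fun a => ∀ i : S, G.Adj (vert t i) (v, a)) := by
  classical
  rw [← Finset.card_image_of_injective (f := fun a : Fin n => ((v, a) : Vertex k n)) _
    (fun a b h => (Prod.ext_iff.1 h).2)]
  congr 1
  ext x
  simp only [commonNbrs, side, Finset.mem_filter, Finset.mem_image]
  constructor
  · rintro ⟨⟨a, ha, rfl⟩, h⟩
    exact ⟨a, ⟨ha, h⟩, rfl⟩
  · rintro ⟨a, ⟨ha, h⟩, rfl⟩
    exact ⟨⟨a, ha, rfl⟩, h⟩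

open Classical in
/-- The contribution of the isolated block `v` to the term of the tuple `τ` in a character sum. -/
noncomputable def starFactor (p : ℝ) (ω : Sym2 (Vertex k n) → Bool) (F : SimpleGraph (Fin k))
    (B : Finset (Fin k)) (Q : Fin k → Finset (Fin n)) (v : Fin k) (τ : Fin k → Fin n) : ℝ :=
  if τ v ∈ Q v then ∏ w ∈ starNbrs F B v, (1 + chiVal p (ω s((w, τ w), (v, τ v)))) else 0

/-- The average contribution of the block `v` is the normalized size of a common neighbourhood. -/
theorem sideAverage_starFactor {p : ℝ} (hp : 0 < p) (ω : Sym2 (Vertex k n) → Bool)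
    (F : SimpleGraph (Fin k)) (B : Finset (Fin k)) (Q R : Fin k → Finset (Fin n)) {v : Fin k}
    (hv : v ∉ F.support) (hQR : Q v ⊆ R v) (τ : Fin k → Fin n) :
    sideAverage R v (starFactor p ω F B Q v) τ =
      #(commonNbrs (graphOf ω) (fun i : starNbrs F B v => τ i) (side Q v)) *
        (p ^ #(starNbrs F B v))⁻¹ / #(R v) := by
  classical
  have hne : ∀ w ∈ starNbrs F B v, w ≠ v := fun w hw h =>
    hv (h ▸ (mem_supportIn.1 (starNbrs_subset_supportIn hv hw)).2)
  rw [sideAverage, card_commonNbrs_side]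
  congr 1
  rw [Finset.card_filter, Nat.cast_sum, Finset.sum_mul]
  have h1 : ∑ a ∈ R v, starFactor p ω F B Q v (Function.update τ v a) =
      ∑ a ∈ Q v, starFactor p ω F B Q v (Function.update τ v a) := by
    symm
    refine Finset.sum_subset hQR fun a _ ha => ?_
    simp [starFactor, ha]
  rw [h1]
  refine Finset.sum_congr rfl fun a ha => ?_
  rw [starFactor, if_pos (by simpa using ha), ← inv_pow, ← Finset.prod_const]
  have h2 : ∏ w ∈ starNbrs F B v, (1 + chiVal p (ω s((w, Function.update τ v a w),
      (v, Function.update τ v a v)))) =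
      ∏ w ∈ starNbrs F B v, if ω s((w, τ w), (v, a)) then p⁻¹ else 0 := by
    refine Finset.prod_congr rfl fun w hw => ?_
    rw [one_add_chiVal hp, Function.update_self, Function.update_of_ne (hne w hw)]
  rw [h2]
  have hadj : ∀ w ∈ starNbrs F B v, ((graphOf ω).Adj (w, τ w) (v, a) ↔ ω s((w, τ w), (v, a)) = true) :=
    fun w hw => graphOf_adj fun h => hne w hw (Prod.ext_iff.1 h).1
  split_ifs with hall
  · rw [Nat.cast_one, one_mul]
    exact Finset.prod_congr rfl fun w hw => if_pos ((hadj w hw).1 (hall ⟨w, hw⟩))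
  · rw [Nat.cast_zero, zero_mul]
    push Not at hall
    obtain ⟨⟨w, hw⟩, hwn⟩ := hall
    exact Finset.prod_eq_zero hw (if_neg fun h => hwn ((hadj w hw).2 h))

/-- The common neighbourhoods that occur in the character sum of `F` over `Q_B` have at most
`1 + β` times the size expected relative to the rectangle `P`. -/
def StarNbrsBounded (β p : ℝ) (F : SimpleGraph (Fin k)) (B : Finset (Fin k))
    (Q P : Fin k → Finset (Fin n)) (ω : Sym2 (Vertex k n) → Bool) : Prop :=
  ∀ v ∈ B \ supportIn F B, ∀ τ : Fin k → Fin n, (∀ i ∈ supportIn F B, τ i ∈ Q i) →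
    (#(commonNbrs (graphOf ω) (fun i : starNbrs F B v => τ i) (side Q v)) : ℝ) ≤
      (1 + β) * (p ^ #(starNbrs F B v) * #(P v))

open Classical in
/-- The coefficient of the tuple `τ` in the character sum of `F`, seen as a multilinear form in the
characters of the matching `M`. -/
noncomputable def matchingCoeff (p : ℝ) (F : SimpleGraph (Fin k)) (B : Finset (Fin k))
    (Q R : Fin k → Finset (Fin n)) (M : List (Fin k × Fin k)) (τ : Fin k → Fin n)
    (ω : Sym2 (Vertex k n) → Bool) : ℝ :=
  (if ∀ i ∈ supportIn F B, τ i ∈ Q i then 1 else 0) *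
    (∏ e ∈ withinFinset F.edgeSet B \ (M.map fun x => s(x.1, x.2)).toFinset,
      chiAt p (graphOf ω) τ e) *
    ∏ v ∈ B \ supportIn F B, sideAverage R v (starFactor p ω F B Q v) τ

theorem nodup_map_of_pairwise {M : List (Fin k × Fin k)} (hM : M.Pairwise PairDisjoint) :
    (M.map fun x => s(x.1, x.2)).Nodup := by
  rw [List.Nodup, List.pairwise_map]
  refine hM.imp fun {x y} h he => ?_
  rcases Sym2.eq_iff.1 he with h' | h'
  · exact h.1 h'.1
  · exact h.2.1 h'.1

theorem matchingChar_eq_prod (p : ℝ) {M : List (Fin k × Fin k)} (hM : M.Pairwise PairDisjoint)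
    (hne : ∀ x ∈ M, x.1 ≠ x.2) (ω : Sym2 (Vertex k n) → Bool) (τ : Fin k → Fin n) :
    matchingChar p M ω τ =
      ∏ e ∈ (M.map fun x => s(x.1, x.2)).toFinset, chiAt p (graphOf ω) τ e := by
  rw [List.prod_toFinset _ (nodup_map_of_pairwise hM), List.map_map, matchingChar]
  congr 1
  refine List.map_congr_left fun x hx => ?_
  rw [Function.comp_apply, chiAt_graphOf p ω τ (hne x hx)]

/-- A character sum as a multilinear form in the characters of a matching `M ⊆ F[B]`. The sum over the
rectangle `Q` is extended by zero to a larger rectangle `P`, and the blocks that are isolated in `F`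
are averaged out. -/
theorem charSum_eq_sum_matchingChar {p : ℝ} (ω : Sym2 (Vertex k n) → Bool)
    (F : SimpleGraph (Fin k)) (B : Finset (Fin k)) (Q P : Fin k → Finset (Fin n)) (a₀ : Fin n)
    (hQP : ∀ i ∈ B, Q i ⊆ P i) (hP : ∀ i ∈ B, (P i).Nonempty)
    {M : List (Fin k × Fin k)} (hM : M.Pairwise PairDisjoint)
    (hMF : ∀ x ∈ M, x.1 ∈ B ∧ x.2 ∈ B ∧ F.Adj x.1 x.2) :
    charSum p (graphOf ω) F B Q = ∑ τ ∈ Fintype.piFinset (fillRect a₀ B P),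
      matchingChar p M ω τ * matchingCoeff p F B Q (fillRect a₀ B P) M τ ω := by
  classical
  have hMsub : (M.map fun x => s(x.1, x.2)).toFinset ⊆ withinFinset F.edgeSet B := by
    intro e he
    rw [List.mem_toFinset, List.mem_map] at he
    obtain ⟨x, hx, rfl⟩ := he
    obtain ⟨h1, h2, h3⟩ := hMF x hx
    exact mem_withinFinset.2 ⟨h3, by simpa using ⟨h1, h2⟩⟩
  set A := supportIn F B
  let g : (Fin k → Fin n) → ℝ := fun τ => (if ∀ i ∈ A, τ i ∈ Q i then 1 else 0) *
    ∏ e ∈ withinFinset F.edgeSet B, chiAt p (graphOf ω) τ e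
  have hoff : ∀ v ∈ B \ A, v ∉ F.support := fun v hv h =>
    (Finset.mem_sdiff.1 hv).2 (mem_supportIn.2 ⟨(Finset.mem_sdiff.1 hv).1, h⟩)
  have h1 : charSum p (graphOf ω) F B Q = ∑ τ ∈ Fintype.piFinset (fillRect a₀ B P),
      g τ * ∏ v ∈ B \ A, starFactor p ω F B Q v τ := by
    rw [charSum_eq p (graphOf ω) F B Q a₀]
    have hsub : Fintype.piFinset (fillRect a₀ B Q) ⊆ Fintype.piFinset (fillRect a₀ B P) := by
      refine Fintype.piFinset_subset _ _ fun i => ?_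
      by_cases hi : i ∈ B
      · simpa [fillRect, hi] using hQP i hi
      · simp [fillRect, hi]
    rw [← Finset.sum_subset hsub (f := fun τ => g τ * ∏ v ∈ B \ A, starFactor p ω F B Q v τ)]
    · refine Finset.sum_congr rfl fun τ hτ => ?_
      rw [Fintype.mem_piFinset] at hτ
      have hτB : ∀ i ∈ B, τ i ∈ Q i := fun i hi => by simpa [fillRect, hi] using hτ i
      simp only [g]
      rw [if_pos fun i hi => hτB i (mem_supportIn.1 hi).1, one_mul, prod_withinFinset_eStar]
      congr 1
      refine Finset.prod_congr rfl fun v hv => ?_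
      rw [starFactor, if_pos (hτB v (Finset.mem_sdiff.1 hv).1)]
      refine Finset.prod_congr rfl fun w hw => ?_
      rw [chiAt_graphOf p ω τ]
      rintro rfl
      exact hoff _ hv (mem_supportIn.1 (starNbrs_subset_supportIn (hoff _ hv) hw)).2
    · intro τ hτP hτ
      rw [Fintype.mem_piFinset] at hτ hτP
      push Not at hτ
      obtain ⟨i, hi⟩ := hτ
      have hiB : i ∈ B := by
        by_contra hiB
        have := hτP i
        simp only [fillRect, hiB, if_false] at this hi
        exact hi this
      rw [fillRect_of_mem a₀ Q hiB] at hi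
      by_cases hiA : i ∈ A
      · simp only [g]
        rw [if_neg fun h => hi (h i hiA), zero_mul, zero_mul]
      · rw [Finset.prod_eq_zero (Finset.mem_sdiff.2 ⟨hiB, hiA⟩) (by rw [starFactor, if_neg hi]),
          mul_zero]
  rw [h1, sum_mul_prod_eq_sum_mul_prod_sideAverage]
  · refine Finset.sum_congr rfl fun τ _ => ?_
    rw [matchingCoeff, matchingChar_eq_prod p hM (fun x hx => (hMF x hx).2.2.ne)]
    simp only [g]
    rw [← Finset.prod_sdiff hMsub]
    ring
  · intro v hv
    rw [fillRect_of_mem a₀ P (Finset.mem_sdiff.1 hv).1]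
    exact hP v (Finset.mem_sdiff.1 hv).1
  · intro v hv τ a
    have hvA := (Finset.mem_sdiff.1 hv).2
    simp only [g]
    congr 1
    · congr 1
      refine propext (forall₂_congr fun i hi => ?_)
      rw [Function.update_of_ne]
      rintro rfl
      exact hvA hi
    · refine Finset.prod_congr rfl fun e he => ?_
      obtain ⟨he, -⟩ := mem_withinFinset.1 he
      induction e using Sym2.ind with
      | _ x y =>
        have hx : x ≠ v := by rintro rfl; exact hoff _ hv ⟨y, he⟩
        have hy : y ≠ v := by rintro rfl; exact hoff _ hv ⟨x, he.symm⟩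
        rw [chiAt_graphOf p ω _ (F.ne_of_adj he), chiAt_graphOf p ω _ (F.ne_of_adj he),
          Function.update_of_ne hx, Function.update_of_ne hy]
  · intro v hv u hu huv τ a
    simp only [starFactor, Function.update_of_ne huv]
    congr 1
    refine Finset.prod_congr rfl fun w hw => ?_
    rw [Function.update_of_ne]
    rintro rfl
    exact hoff _ hv (mem_supportIn.1 (starNbrs_subset_supportIn (hoff _ hu) hw)).2

/-- The coefficients do not involve any edge between two blocks that are matched by `M`. -/
theorem dependsOn_matchingCoeff (p : ℝ) (F : SimpleGraph (Fin k)) (B : Finset (Fin k))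
    (Q R : Fin k → Finset (Fin n)) {M : List (Fin k × Fin k)}
    (hMF : ∀ x ∈ M, x.1 ∈ B ∧ x.2 ∈ B ∧ F.Adj x.1 x.2) (τ : Fin k → Fin n) :
    DependsOn (matchingCoeff p F B Q R M τ) (listEdges n M)ᶜ := by
  classical
  intro ω ω' h
  unfold matchingCoeff
  congr 1
  · congr 1
    refine Finset.prod_congr rfl fun e he => ?_
    rw [Finset.mem_sdiff, List.mem_toFinset, List.mem_map] at he
    obtain ⟨he1, he2⟩ := he
    have he1 := (mem_withinFinset.1 he1).1
    induction e using Sym2.ind with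
    | _ x y =>
      rw [chiAt_graphOf p ω _ (F.ne_of_adj he1), chiAt_graphOf p ω' _ (F.ne_of_adj he1), h]
      rintro ⟨z, hz, a, b, hab⟩
      refine he2 ⟨z, hz, ?_⟩
      have := congrArg (Sym2.map Prod.fst) hab
      simpa using this.symm
  · refine Finset.prod_congr rfl fun v hv => ?_
    have hv : v ∉ F.support := fun h =>
      (Finset.mem_sdiff.1 hv).2 (mem_supportIn.2 ⟨(Finset.mem_sdiff.1 hv).1, h⟩)
    unfold sideAverage starFactor
    congr 1
    refine Finset.sum_congr rfl fun a _ => ?_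
    congr 1
    refine Finset.prod_congr rfl fun w _ => ?_
    rw [h]
    rintro ⟨z, hz, a, b, hab⟩
    have hz3 := (hMF z hz).2.2
    have h1 := congrArg (Sym2.map Prod.fst) hab
    simp only [Sym2.map_mk] at h1
    rcases Sym2.eq_iff.1 h1 with h2 | h2
    · exact hv ⟨z.1, h2.2 ▸ hz3.symm⟩
    · exact hv ⟨z.2, h2.2 ▸ hz3⟩

/-- Each edge of `F[B]` outside of `M` contributes at most a factor `p⁻¹` to a coefficient, and each
isolated block at most a factor `1 + β ≤ exp β`. -/
theorem abs_matchingCoeff_le {p : ℝ} (hp0 : 0 < p) (hp1 : p ≤ 1) {β : ℝ} (hβ : 0 ≤ β)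
    {F : SimpleGraph (Fin k)} {B : Finset (Fin k)} {Q P : Fin k → Finset (Fin n)} (a₀ : Fin n)
    (hQP : ∀ i ∈ B, Q i ⊆ P i) (hP : ∀ i ∈ B, (P i).Nonempty)
    {M : List (Fin k × Fin k)} (hM : M.Pairwise PairDisjoint)
    (hMF : ∀ x ∈ M, x.1 ∈ B ∧ x.2 ∈ B ∧ F.Adj x.1 x.2) {ω : Sym2 (Vertex k n) → Bool}
    (hω : StarNbrsBounded β p F B Q P ω) (τ : Fin k → Fin n) :
    |matchingCoeff p F B Q (fillRect a₀ B P) M τ ω| ≤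
      Real.exp (β * k) * ((p ^ #(withinFinset F.edgeSet B))⁻¹ * p ^ M.length) := by
  classical
  have hbound0 : (0 : ℝ) ≤ Real.exp (β * k) *
      ((p ^ #(withinFinset F.edgeSet B))⁻¹ * p ^ M.length) := by positivity
  rw [matchingCoeff]
  split_ifs with hτ
  swap
  · simpa using hbound0
  rw [one_mul, abs_mul, Finset.abs_prod, Finset.abs_prod, mul_comm]
  have hMsub : (M.map fun x => s(x.1, x.2)).toFinset ⊆ withinFinset F.edgeSet B := by
    intro e he
    rw [List.mem_toFinset, List.mem_map] at he
    obtain ⟨x, hx, rfl⟩ := he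
    obtain ⟨h1, h2, h3⟩ := hMF x hx
    exact mem_withinFinset.2 ⟨h3, by simpa using ⟨h1, h2⟩⟩
  have hcard : #((M.map fun x => s(x.1, x.2)).toFinset) = M.length := by
    rw [List.toFinset_card_of_nodup (nodup_map_of_pairwise hM), List.length_map]
  refine mul_le_mul ?_ ?_ (Finset.prod_nonneg fun _ _ => abs_nonneg _) (Real.exp_pos _).le
  · have h1 : ∀ v ∈ B \ supportIn F B,
        |sideAverage (fillRect a₀ B P) v (starFactor p ω F B Q v) τ| ≤ Real.exp β := by
      intro v hv
      have hvB := (Finset.mem_sdiff.1 hv).1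
      have hvs : v ∉ F.support := fun h =>
        (Finset.mem_sdiff.1 hv).2 (mem_supportIn.2 ⟨hvB, h⟩)
      rw [sideAverage_starFactor hp0 ω F B Q _ hvs
        (by rw [fillRect_of_mem a₀ P hvB]; exact hQP v hvB), fillRect_of_mem a₀ P hvB,
        abs_of_nonneg (by positivity)]
      have hpos : (0 : ℝ) < #(P v) := by exact_mod_cast (hP v hvB).card_pos
      rw [div_le_iff₀ hpos, ← div_eq_mul_inv, div_le_iff₀ (by positivity)]
      refine (hω v hv τ hτ).trans ?_
      have := Real.add_one_le_exp β
      calc (1 + β) * (p ^ #(starNbrs F B v) * #(P v))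
          ≤ Real.exp β * (p ^ #(starNbrs F B v) * #(P v)) := by
            apply mul_le_mul_of_nonneg_right (by linarith) (by positivity)
        _ = _ := by ring
    refine (Finset.prod_le_prod (fun _ _ => abs_nonneg _) h1).trans ?_
    rw [Finset.prod_const, ← Real.exp_nat_mul, mul_comm]
    refine Real.exp_le_exp.2 (mul_le_mul_of_nonneg_left ?_ hβ)
    exact_mod_cast (Finset.card_le_univ _).trans (by simp)
  · have h1 : ∀ e ∈ withinFinset F.edgeSet B \ (M.map fun x => s(x.1, x.2)).toFinset,
        |chiAt p (graphOf ω) τ e| ≤ p⁻¹ := by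
      intro e he
      have he := (mem_withinFinset.1 (Finset.mem_sdiff.1 he).1).1
      induction e using Sym2.ind with
      | _ x y =>
        rw [chiAt_graphOf p ω _ (F.ne_of_adj he)]
        exact abs_chiVal_le hp0 hp1 _
    refine (Finset.prod_le_prod (fun _ _ => abs_nonneg _) h1).trans (le_of_eq ?_)
    rw [Finset.prod_const, Finset.card_sdiff_of_subset hMsub, hcard, inv_pow]
    have hle : M.length ≤ #(withinFinset F.edgeSet B) := hcard ▸ Finset.card_le_card hMsub
    rw [← Nat.sub_add_cancel hle, pow_add, Nat.add_sub_cancel]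
    field_simp

theorem length_le_of_pairwise {M : List (Fin k × Fin k)} (hM : M.Pairwise PairDisjoint) :
    M.length ≤ k := by
  have h : (M.map Prod.fst).Nodup := by
    rw [List.Nodup, List.pairwise_map]
    exact hM.imp fun h => h.1
  simpa using h.length_le_card

/-- A character sum exceeds its bound only with tiny probability, unless the common neighbourhoods
are too large: a matching of half the size of a minimum vertex cover gains a factor `g` for each of
its edges. -/
theorem prob_charSum_gt_le {q : Sym2 (Vertex k n) → ℝ} (hq : IsParam q) {p : ℝ}
    (hp0 : 0 < p) (hp1 : p ≤ 1) (hqp : ∀ i j : Fin k, i ≠ j → ∀ a b : Fin n, q s((i, a), (j, b)) = p)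
    (hn : 0 < n) {β : ℝ} (hβ : 0 ≤ β) (F : SimpleGraph (Fin k)) (B : Finset (Fin k))
    (Q P : Fin k → Finset (Fin n))
    (hQP : ∀ i ∈ B, Q i ⊆ P i) (hP : ∀ i ∈ B, (P i).Nonempty) {g N : ℝ} (hg0 : 0 < g)
    (hg1 : g ≤ 1) (hN : ∀ i ∈ B, ∀ j ∈ B, N ≤ 2 * (#(P i) * #(P j)) * g ^ 2) :
    prob q (fun ω => StarNbrsBounded β p F B Q P ω ∧
      Real.exp (β * k) * ((p ^ (restrict F B).edgeSet.ncard)⁻¹ *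
        (g ^ 2) ^ ((vc (restrict F B) : ℝ) / 4) * ∏ i ∈ B, (#(P i) : ℝ)) <
        |charSum p (graphOf ω) F B Q|) ≤
      k * ((n : ℝ) ^ k * (2 * Real.exp (-N))) := by
  obtain ⟨M, hM, hMF, hvc⟩ := exists_matching F B
  let a₀ : Fin n := ⟨0, hn⟩
  set C₀ := Real.exp (β * k) * ((p ^ #(withinFinset F.edgeSet B))⁻¹ * p ^ M.length) with hC₀
  have h1 := prob_sum_matchingChar_gt_le hq hp0 hp1 (fillRect a₀ B P) hg0.le (N := N) M hM
    (fun x hx => (hMF x hx).2.2.ne) (fun x hx => hqp _ _ (hMF x hx).2.2.ne)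
    (fun x hx => by
      rw [fillRect_of_mem a₀ P (hMF x hx).1, fillRect_of_mem a₀ P (hMF x hx).2.1]
      exact hN _ (hMF x hx).1 _ (hMF x hx).2.1)
    (matchingCoeff p F B Q (fillRect a₀ B P) M)
    (dependsOn_matchingCoeff p F B Q _ hMF) C₀
  refine (prob_mono hq fun ω hω => ?_).trans (h1.trans ?_)
  · refine ⟨fun τ _ => abs_matchingCoeff_le hp0 hp1 hβ a₀ hQP hP hM hMF hω.1 τ, ?_⟩
    rw [← charSum_eq_sum_matchingChar ω F B Q P a₀ hQP hP hM hMF]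
    refine lt_of_le_of_lt ?_ hω.2
    rw [card_piFinset_fillRect, ncard_edgeSet_restrict, hC₀]
    have hgm : g ^ M.length ≤ (g ^ 2) ^ ((vc (restrict F B) : ℝ) / 4) := by
      rw [← Real.rpow_natCast g 2, ← Real.rpow_mul hg0.le, ← Real.rpow_natCast g M.length]
      refine Real.rpow_le_rpow_of_exponent_ge hg0 hg1 ?_
      have : (vc (restrict F B) : ℝ) ≤ 2 * M.length := by exact_mod_cast hvc
      push_cast
      linarith
    have haux : ∀ a b c d r : ℝ, d ≠ 0 → r * (a * (b * d) * (c / d)) = a * (b * c * r) := by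
      intro a b c d r hd
      field_simp
    calc _ = Real.exp (β * k) * ((p ^ #(withinFinset F.edgeSet B))⁻¹ * g ^ M.length *
          ∏ i ∈ B, (#(P i) : ℝ)) := by
          rw [div_pow, haux _ _ _ _ _ (pow_pos hp0 _).ne']
      _ ≤ _ := by
          refine mul_le_mul_of_nonneg_left (mul_le_mul_of_nonneg_right
            (mul_le_mul_of_nonneg_left hgm ?_) ?_) (Real.exp_pos _).le
          · exact (inv_pos.2 (pow_pos hp0 _)).le
          · exact Finset.prod_nonneg fun _ _ => Nat.cast_nonneg _
  · have hcard : (#(Fintype.piFinset (fillRect a₀ B P)) : ℝ) ≤ (n : ℝ) ^ k := by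
      have : #(Fintype.piFinset (fillRect a₀ B P)) ≤ n ^ k :=
        (Finset.card_le_univ _).trans (by simp)
      exact_mod_cast this
    have hlen : (M.length : ℝ) ≤ k := by exact_mod_cast length_le_of_pairwise hM
    gcongr

end CharSums

/-! ### Concentration of common neighbourhoods -/

section Neighbourhoods

variable {k n : ℕ}

/-- The edges between the vertex set `T` and the vertices `(j, a)` with `a ∈ R`. -/
def starEdges (T : Finset (Vertex k n)) (j : Fin k) (R : Set (Fin n)) : Set (Sym2 (Vertex k n)) :=
  {e | ∃ u ∈ T, ∃ a ∈ R, e = s(u, (j, a))}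

/-- The number of common neighbours of the vertices in `T` among the vertices `(j, a)` with
`a ∈ R`. -/
def nbrCount (ω : Sym2 (Vertex k n) → Bool) (T : Finset (Vertex k n)) (j : Fin k)
    (R : Finset (Fin n)) : ℕ :=
  #(R.filter fun a => ∀ u ∈ T, ω s(u, (j, a)) = true)

/-- The number of common neighbours of `T` deviates from its expectation by more than a factor
`1 ± d`. -/
def Deviates (d p : ℝ) (T : Finset (Vertex k n)) (j : Fin k) (R : Finset (Fin n))
    (ω : Sym2 (Vertex k n) → Bool) : Prop :=
  d * (p ^ #T * #R) < |(nbrCount ω T j R : ℝ) - p ^ #T * #R|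

theorem sym2_eq_of_avoids {u u' : Vertex k n} {j : Fin k} {a a' : Fin n} (hu : u.1 ≠ j)
    (h : s(u, (j, a)) = s(u', (j, a'))) : u = u' ∧ a = a' := by
  rcases Sym2.eq_iff.1 h with h | h
  · exact ⟨h.1, (Prod.ext_iff.1 h.2).2⟩
  · exact absurd (congrArg Prod.fst h.1) hu

theorem expectation_exp_nbrCount {q : Sym2 (Vertex k n) → ℝ} {p : ℝ} {T : Finset (Vertex k n)}
    {j : Fin k} (hT : ∀ u ∈ T, u.1 ≠ j) (hq : ∀ u ∈ T, ∀ a, q s(u, (j, a)) = p)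
    (R : Finset (Fin n)) (l : ℝ) :
    expectation q (fun ω => Real.exp (l * nbrCount ω T j R)) =
      (1 + p ^ #T * (Real.exp l - 1)) ^ #R := by
  have h1 : ∀ ω : Sym2 (Vertex k n) → Bool, Real.exp (l * nbrCount ω T j R) =
      ∏ a ∈ R, (1 + (Real.exp l - 1) * ∏ u ∈ T, if ω s(u, (j, a)) = true then (1 : ℝ) else 0) := by
    intro ω
    rw [nbrCount, Finset.card_filter, Nat.cast_sum, Finset.mul_sum, Real.exp_sum]
    refine Finset.prod_congr rfl fun a _ => ?_
    by_cases h : ∀ u ∈ T, ω s(u, (j, a)) = true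
    · rw [if_pos h, Finset.prod_eq_one fun u hu => if_pos (h u hu)]
      simp
    · rw [if_neg h]
      push Not at h
      obtain ⟨u, hu, hun⟩ := h
      rw [Finset.prod_eq_zero hu (if_neg hun)]
      simp
  simp only [h1]
  rw [expectation_prod_of_dependsOn q R (fun a => starEdges T j {a})]
  · rw [← Finset.prod_const]
    refine Finset.prod_congr rfl fun a _ => ?_
    rw [expectation_add, expectation_const, expectation_const_mul,
      expectation_prod_of_dependsOn q T (fun u => {s(u, (j, a))})]
    · have h2 : ∀ u ∈ T, expectation q
          (fun ω => if ω s(u, (j, a)) = true then (1 : ℝ) else 0) = p := by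
        intro u hu
        rw [expectation_coord q s(u, (j, a)) fun b => if b = true then (1 : ℝ) else 0]
        simp [hq u hu a]
      rw [Finset.prod_congr rfl h2, Finset.prod_const]
      ring
    · intro u hu u' _ huu
      refine Set.disjoint_singleton.2 fun h => huu (sym2_eq_of_avoids (hT u hu) h).1
    · intro u _ ω ω' h
      simp only [h _ rfl]
  · intro a _ a' _ haa
    refine Set.disjoint_left.2 ?_
    rintro _ ⟨u, hu, b, rfl, rfl⟩ ⟨u', _, b', rfl, h⟩
    exact haa (sym2_eq_of_avoids (hT u hu) h).2
  · intro a _ ω ω' h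
    simp only
    congr 2
    refine Finset.prod_congr rfl fun u hu => ?_
    rw [h _ ⟨u, hu, a, rfl, rfl⟩]

theorem expectation_exp_nbrCount_le {q : Sym2 (Vertex k n) → ℝ} {p : ℝ} (hp0 : 0 ≤ p)
    (hp1 : p ≤ 1) {T : Finset (Vertex k n)}
    {j : Fin k} (hT : ∀ u ∈ T, u.1 ≠ j) (hq : ∀ u ∈ T, ∀ a, q s(u, (j, a)) = p)
    (R : Finset (Fin n)) {l : ℝ} (hl : |l| ≤ 1) :
    expectation q (fun ω => Real.exp (l * nbrCount ω T j R)) ≤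
      Real.exp (p ^ #T * #R * (l + l ^ 2)) := by
  rw [expectation_exp_nbrCount hT hq, mul_right_comm, mul_comm _ (#R : ℝ), Real.exp_nat_mul]
  have hpT1 : p ^ #T ≤ 1 := pow_le_one₀ hp0 hp1
  have hpT0 : 0 ≤ p ^ #T := pow_nonneg hp0 _
  have h1 : Real.exp l - 1 ≤ l + l ^ 2 := by
    have := (abs_le.1 (Real.abs_exp_sub_one_sub_id_le hl)).2
    linarith
  refine pow_le_pow_left₀ ?_ ?_ _
  · nlinarith [Real.exp_pos l]
  · have h2 := Real.add_one_le_exp (p ^ #T * (l + l ^ 2))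
    nlinarith

/-- Chernoff's bound for the number of common neighbours. -/
theorem prob_deviates_le {q : Sym2 (Vertex k n) → ℝ} (hq : IsParam q) {p : ℝ} (hp0 : 0 ≤ p)
    (hp1 : p ≤ 1) {T : Finset (Vertex k n)}
    {j : Fin k} (hT : ∀ u ∈ T, u.1 ≠ j) (hqp : ∀ u ∈ T, ∀ a, q s(u, (j, a)) = p)
    (R : Finset (Fin n)) {d : ℝ} (hd0 : 0 ≤ d) (hd1 : d ≤ 1) :
    prob q (Deviates d p T j R) ≤ 2 * Real.exp (-(d ^ 2 * (p ^ #T * #R) / 4)) := by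
  set m : ℝ := p ^ #T * #R with hm
  -- the exponential moments at `± d / 2`, for the upper and the lower tail
  have key : prob q (Deviates d p T j R) ≤ expectation q (fun ω =>
      Real.exp (-(d / 2 * m) - d ^ 2 * m / 2) * Real.exp (d / 2 * nbrCount ω T j R) +
      Real.exp (d / 2 * m - d ^ 2 * m / 2) * Real.exp (-(d / 2) * nbrCount ω T j R)) := by
    refine prob_le_expectation hq (fun ω => by positivity) fun ω h => ?_
    rw [← Real.exp_add, ← Real.exp_add]
    rcases lt_abs.1 h with h | h
    · refine le_trans (Real.one_le_exp ?_) (le_add_of_nonneg_right (Real.exp_pos _).le)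
      nlinarith
    · refine le_trans (Real.one_le_exp ?_) (le_add_of_nonneg_left (Real.exp_pos _).le)
      nlinarith
  refine key.trans ?_
  rw [expectation_add, expectation_const_mul, expectation_const_mul]
  have h1 := expectation_exp_nbrCount_le hp0 hp1 hT hqp R (l := d / 2)
    (by rw [abs_of_nonneg (by positivity)]; linarith)
  have h2 := expectation_exp_nbrCount_le hp0 hp1 hT hqp R (l := -(d / 2))
    (by rw [abs_neg, abs_of_nonneg (by positivity)]; linarith)
  rw [two_mul]
  refine add_le_add ?_ ?_
  · refine (mul_le_mul_of_nonneg_left h1 (Real.exp_pos _).le).trans (le_of_eq ?_)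
    rw [← Real.exp_add, ← hm]
    congr 1
    ring
  · refine (mul_le_mul_of_nonneg_left h2 (Real.exp_pos _).le).trans (le_of_eq ?_)
    rw [← Real.exp_add, ← hm]
    congr 1
    ring

/-- Disjoint vertex sets deviate independently. -/
theorem prob_forall_deviates_le {q : Sym2 (Vertex k n) → ℝ} (hq : IsParam q) {p : ℝ} (hp0 : 0 ≤ p)
    (hp1 : p ≤ 1) (𝒯 : Finset (Finset (Vertex k n)))
    (hdisj : (𝒯 : Set (Finset (Vertex k n))).PairwiseDisjoint id) {j : Fin k}
    (hT : ∀ T ∈ 𝒯, ∀ u ∈ T, u.1 ≠ j) (hqp : ∀ T ∈ 𝒯, ∀ u ∈ T, ∀ a, q s(u, (j, a)) = p)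
    (R : Finset (Fin n)) {d b : ℝ} (hd0 : 0 ≤ d) (hd1 : d ≤ 1)
    (hb : ∀ T ∈ 𝒯, b ≤ d ^ 2 * (p ^ #T * #R) / 4) :
    prob q (fun ω => ∀ T ∈ 𝒯, Deviates d p T j R ω) ≤ (2 * Real.exp (-b)) ^ #𝒯 := by
  classical
  have h1 : prob q (fun ω => ∀ T ∈ 𝒯, Deviates d p T j R ω) =
      expectation q (fun ω => ∏ T ∈ 𝒯, if Deviates d p T j R ω then (1 : ℝ) else 0) := by
    unfold prob
    congr 1
    funext ω
    by_cases h : ∀ T ∈ 𝒯, Deviates d p T j R ω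
    · rw [if_pos h, Finset.prod_eq_one fun T hT => if_pos (h T hT)]
    · rw [if_neg h]
      push Not at h
      obtain ⟨T, hT, hn⟩ := h
      rw [Finset.prod_eq_zero hT (if_neg hn)]
  rw [h1, expectation_prod_of_dependsOn q 𝒯 (fun T => starEdges T j Set.univ), ← Finset.prod_const]
  · refine Finset.prod_le_prod (fun T _ => ?_) fun T h => ?_
    · have := prob_nonneg hq (Deviates d p T j R)
      unfold prob at this
      convert this
    · have h2 := prob_deviates_le hq hp0 hp1 (hT T h) (hqp T h) R hd0 hd1
      unfold prob at h2
      refine le_trans (le_of_eq ?_) (h2.trans ?_)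
      · congr!
      · have := hb T h
        gcongr
  · intro T h T' h' hne
    refine Set.disjoint_left.2 ?_
    rintro _ ⟨u, hu, a, -, rfl⟩ ⟨u', hu', a', -, he⟩
    have := (sym2_eq_of_avoids (hT T h u hu) he).1
    subst this
    exact Finset.disjoint_left.1 (hdisj h h' hne) hu hu'
  · intro T _ ω ω' h
    have : nbrCount ω T j R = nbrCount ω' T j R := by
      unfold nbrCount
      congr 1
      refine Finset.filter_congr fun a _ => forall₂_congr fun u hu => ?_
      rw [h _ ⟨u, hu, a, trivial, rfl⟩]
    have hiff : Deviates d p T j R ω ↔ Deviates d p T j R ω' := by simp only [Deviates, this]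
    simp only [hiff]

/-- The vertices of a tuple. -/
def tupleSet {S : Finset (Fin k)} (t : S → Fin n) : Finset (Vertex k n) :=
  Finset.univ.image (vert t)

theorem card_tupleSet {S : Finset (Fin k)} (t : S → Fin n) : #(tupleSet t) = #S := by
  rw [tupleSet, Finset.card_image_of_injective, Finset.card_univ, Fintype.card_coe]
  exact fun x y h => Subtype.ext (Prod.ext_iff.1 h).1

theorem tupleSet_avoids {S : Finset (Fin k)} (t : S → Fin n) {j : Fin k} (hj : j ∉ S) :
    ∀ u ∈ tupleSet t, u.1 ≠ j := by
  intro u hu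
  obtain ⟨i, -, rfl⟩ := Finset.mem_image.1 hu
  rintro rfl
  exact hj i.2

theorem card_side (Q : Fin k → Finset (Fin n)) (j : Fin k) : #(side Q j) = #(Q j) :=
  Finset.card_image_of_injective _ fun _ _ h => (Prod.ext_iff.1 h).2

theorem card_commonNbrs_eq_nbrCount (ω : Sym2 (Vertex k n) → Bool) {S : Finset (Fin k)}
    (t : S → Fin n) {j : Fin k} (hj : j ∉ S) (Q : Fin k → Finset (Fin n)) :
    #(commonNbrs (graphOf ω) t (side Q j)) = nbrCount ω (tupleSet t) j (Q j) := by
  classical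
  rw [card_commonNbrs_side, nbrCount]
  congr 1
  refine Finset.filter_congr fun a _ => ?_
  have hne : ∀ i : S, vert t i ≠ (j, a) := fun i h => by
    have : (i : Fin k) = j := (Prod.ext_iff.1 h).1
    exact hj (this ▸ i.2)
  constructor
  · intro h u hu
    obtain ⟨i, -, rfl⟩ := Finset.mem_image.1 hu
    exact (graphOf_adj (hne i)).1 (h i)
  · intro h i
    exact (graphOf_adj (hne i)).2 (h _ (Finset.mem_image_of_mem _ (Finset.mem_univ i)))

theorem abs_sub_le_of_not_deviates {d p : ℝ} {ω : Sym2 (Vertex k n) → Bool} {S : Finset (Fin k)}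
    {t : S → Fin n} {j : Fin k} (hj : j ∉ S) {Q : Fin k → Finset (Fin n)}
    (h : ¬ Deviates d p (tupleSet t) j (Q j) ω) :
    |(#(commonNbrs (graphOf ω) t (side Q j)) : ℝ) - p ^ #S * #(Q j)| ≤ d * (p ^ #S * #(Q j)) := by
  rw [Deviates, not_lt, card_tupleSet] at h
  rwa [card_commonNbrs_eq_nbrCount ω t hj]

theorem expectedNbrs_of_not_deviates {d p : ℝ} {ω : Sym2 (Vertex k n) → Bool} {S : Finset (Fin k)}
    {t : S → Fin n} {j : Fin k} (hj : j ∉ S) {Q : Fin k → Finset (Fin n)}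
    (h : ¬ Deviates d p (tupleSet t) j (Q j) ω) :
    ExpectedNbrs (graphOf ω) d p t (side Q j) := by
  have h1 := abs_le.1 (abs_sub_le_of_not_deviates hj h)
  rw [ExpectedNbrs, card_side, Set.mem_Icc]
  constructor <;> linarith [h1.1, h1.2]

end Neighbourhoods

/-! ### Counting small sets -/

theorem one_add_inv_pow_le {N m : ℕ} (hN : 0 < N) (hm : m ≤ N) : (1 + (N : ℝ)⁻¹) ^ m ≤ 3 := by
  have hN' : (0 : ℝ) < N := by exact_mod_cast hN
  have h1 : (1 : ℝ) + (N : ℝ)⁻¹ ≤ Real.exp (N : ℝ)⁻¹ := by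
    linarith [Real.add_one_le_exp (N : ℝ)⁻¹]
  calc (1 + (N : ℝ)⁻¹) ^ m ≤ (1 + (N : ℝ)⁻¹) ^ N :=
        pow_le_pow_right₀ (by linarith [inv_pos.2 hN']) hm
    _ ≤ Real.exp (N : ℝ)⁻¹ ^ N := pow_le_pow_left₀ (by positivity) h1 _
    _ = Real.exp 1 := by rw [← Real.exp_nat_mul, mul_inv_cancel₀ hN'.ne']
    _ ≤ 3 := by linarith [Real.exp_one_lt_d9]

theorem sum_inv_pow_card_le {α : Type*} [Fintype α] {N : ℕ} (hN : 0 < N)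
    (hα : Fintype.card α ≤ N) : ∑ S : Finset α, ((N : ℝ)⁻¹) ^ #S ≤ 3 := by
  have h := Fintype.sum_pow_mul_eq_add_pow α (N : ℝ)⁻¹ 1
  simp only [one_pow, mul_one] at h
  rw [h, add_comm]
  exact one_add_inv_pow_le hN hα

/-- Weighting a set `S` by `N ^ (-#S)` bounds the number of small sets. -/
theorem card_filter_card_le {α : Type*} [Fintype α] {N : ℕ} (hN : 0 < N)
    (hα : Fintype.card α ≤ N) (m : ℕ) :
    (#((Finset.univ : Finset (Finset α)).filter fun S => #S ≤ m) : ℝ) ≤ 3 * (N : ℝ) ^ m := by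
  have hN' : (1 : ℝ) ≤ N := by exact_mod_cast hN
  have h1 : (#((Finset.univ : Finset (Finset α)).filter fun S => #S ≤ m) : ℝ) * ((N : ℝ)⁻¹) ^ m ≤
      ∑ S : Finset α, ((N : ℝ)⁻¹) ^ #S := by
    rw [← nsmul_eq_mul]
    refine (Finset.card_nsmul_le_sum _ (fun S : Finset α => ((N : ℝ)⁻¹) ^ #S) _ fun S hS => ?_).trans
      (Finset.sum_le_sum_of_subset_of_nonneg (Finset.filter_subset _ _) fun S _ _ => by positivity)
    exact pow_le_pow_of_le_one (by positivity) (inv_le_one_of_one_le₀ hN') (Finset.mem_filter.1 hS).2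
  have h2 := h1.trans (sum_inv_pow_card_le hN hα)
  rw [inv_pow, ← div_eq_mul_inv, div_le_iff₀ (by positivity)] at h2
  exact h2

/-! ### Error sets -/

section ErrorSets

variable {k n : ℕ}

/-- `𝒯` consists of pairwise disjoint sets of at most `l` vertices outside of block `j`. -/
def IsDisjointFamily (l : ℕ) (j : Fin k) (𝒯 : Finset (Finset (Vertex k n))) : Prop :=
  (𝒯 : Set (Finset (Vertex k n))).PairwiseDisjoint id ∧ ∀ T ∈ 𝒯, #T ≤ l ∧ ∀ u ∈ T, u.1 ≠ j

/-- No `r` disjoint sets of at most `l` vertices deviate simultaneously with respect to a set of at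
least `m` vertices of a block. -/
def FewDeviations (d p m : ℝ) (l r : ℕ) (ω : Sym2 (Vertex k n) → Bool) : Prop :=
  ∀ (j : Fin k) (R : Finset (Fin n)), m ≤ (#R : ℝ) →
    ∀ 𝒯 : Finset (Finset (Vertex k n)), IsDisjointFamily l j 𝒯 → #𝒯 = r →
      ¬ ∀ T ∈ 𝒯, Deviates d p T j R ω

theorem not_deviates_empty {d p : ℝ} (hd : 0 ≤ d) (j : Fin k) (R : Finset (Fin n))
    (ω : Sym2 (Vertex k n) → Bool) : ¬ Deviates d p ∅ j R ω := by
  simp only [Deviates, nbrCount, Finset.card_empty, pow_zero, one_mul, Finset.notMem_empty,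
    false_imp_iff, implies_true, Finset.filter_true, sub_self, abs_zero, not_lt]
  positivity

theorem not_deviates_of_empty {d p : ℝ} (T : Finset (Vertex k n)) (j : Fin k)
    (ω : Sym2 (Vertex k n) → Bool) : ¬ Deviates d p T j ∅ ω := by
  simp [Deviates, nbrCount]

theorem fewDeviations_zero {d p m : ℝ} (hd : 0 ≤ d) (ω : Sym2 (Vertex k n) → Bool) :
    FewDeviations d p m 0 1 ω := by
  intro j R _ 𝒯 h𝒯 hcard hdev
  obtain ⟨T, hT⟩ := Finset.card_pos.1 (by omega : 0 < #𝒯)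
  have h0 : T = ∅ := Finset.card_eq_zero.1 (Nat.le_zero.1 (h𝒯.2 T hT).1)
  exact not_deviates_empty hd j R ω (h0 ▸ hdev T hT)

/-- A maximal family of disjoint deviating sets meets every deviating set. -/
theorem exists_maximal_deviating {d p m : ℝ} (hd : 0 ≤ d) {l r : ℕ} {ω : Sym2 (Vertex k n) → Bool}
    (h : FewDeviations d p m l r ω) (j : Fin k) (R : Finset (Fin n))
    (hR : m ≤ (#R : ℝ) ∨ #R = 0) :
    ∃ X : Finset (Vertex k n), #X ≤ r * l ∧ ∀ T : Finset (Vertex k n), #T ≤ l →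
      (∀ u ∈ T, u.1 ≠ j) → Disjoint T X → ¬ Deviates d p T j R ω := by
  classical
  rcases hR with hR | hR
  swap
  · rw [Finset.card_eq_zero.1 hR]
    exact ⟨∅, by simp, fun T _ _ _ => not_deviates_of_empty T j ω⟩
  obtain ⟨𝒯, h𝒯, hmax⟩ := (Finset.univ.filter fun 𝒯 : Finset (Finset (Vertex k n)) =>
    IsDisjointFamily l j 𝒯 ∧ ∀ T ∈ 𝒯, Deviates d p T j R ω).exists_max_image (fun 𝒯 => #𝒯)
    ⟨∅, by simp [IsDisjointFamily]⟩
  obtain ⟨-, hfam, hdev⟩ := Finset.mem_filter.1 h𝒯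
  have hcard : #𝒯 ≤ r := by
    by_contra! hlt
    obtain ⟨𝒯', hsub, hcard'⟩ := Finset.exists_subset_card_eq hlt.le
    exact h j R hR 𝒯' ⟨hfam.1.subset (by exact_mod_cast hsub), fun T hT => hfam.2 T (hsub hT)⟩
      hcard' fun T hT => hdev T (hsub hT)
  refine ⟨𝒯.biUnion id, ?_, fun T hTl hTj hdisj hTdev => ?_⟩
  · exact (Finset.card_biUnion_le_card_mul _ _ _ fun T hT => (hfam.2 T hT).1).trans
      (Nat.mul_le_mul_right _ hcard)
  · have hTne : T.Nonempty := by
      rw [Finset.nonempty_iff_ne_empty]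
      rintro rfl
      exact not_deviates_empty hd j R ω hTdev
    have hT𝒯 : T ∉ 𝒯 := by
      intro hT
      obtain ⟨u, hu⟩ := hTne
      exact Finset.disjoint_left.1 hdisj hu (Finset.mem_biUnion.2 ⟨T, hT, hu⟩)
    have := hmax (insert T 𝒯) (by
      refine Finset.mem_filter.2 ⟨Finset.mem_univ _, ⟨?_, ?_⟩, ?_⟩
      · rw [Finset.coe_insert]
        refine hfam.1.insert fun T' hT' _ => ?_
        exact hdisj.mono_right (Finset.subset_biUnion_of_mem id hT')
      · intro T' hT'
        rcases Finset.mem_insert.1 hT' with rfl | hT'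
        · exact ⟨hTl, hTj⟩
        · exact hfam.2 T' hT'
      · intro T' hT'
        rcases Finset.mem_insert.1 hT' with rfl | hT'
        · exact hTdev
        · exact hdev T' hT')
    rw [Finset.card_insert_of_notMem hT𝒯] at this
    omega

/-- Removing a small set of vertices from `R` hardly affects the common neighbourhoods. -/
theorem expectedNbrs_sdiff {x p w : ℝ} (hp0 : 0 < p) (hp1 : p ≤ 1) (hx0 : 0 ≤ x) (hx1 : x ≤ 1)
    (G : SimpleGraph (Vertex k n)) {S : Finset (Fin k)} (t : S → Fin n)
    (R W : Finset (Vertex k n)) (hW : (#W : ℝ) ≤ w) (hw : w ≤ p ^ #S * #R * x / 16)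
    (h : |(#(commonNbrs G t R) : ℝ) - p ^ #S * #R| ≤ x / 2 * (p ^ #S * #R)) :
    ExpectedNbrs G x p t (R \ W) := by
  classical
  have hP0 : 0 < p ^ #S := pow_pos hp0 _
  have hP1 : p ^ #S ≤ 1 := pow_le_one₀ hp0.le hp1
  have h1 : (#(R \ W) : ℝ) ≤ #R := by exact_mod_cast Finset.card_le_card Finset.sdiff_subset
  have h2 : (#R : ℝ) ≤ #(R \ W) + #W := by
    exact_mod_cast (Finset.card_le_card (by
      intro v hv
      by_cases hvW : v ∈ W <;> simp [hv, hvW])).trans (Finset.card_union_le (R \ W) W)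
  have h3 : (#(commonNbrs G t (R \ W)) : ℝ) ≤ #(commonNbrs G t R) := by
    exact_mod_cast Finset.card_le_card (Finset.filter_subset_filter _ Finset.sdiff_subset)
  have h4 : (#(commonNbrs G t R) : ℝ) ≤ #(commonNbrs G t (R \ W)) + #W := by
    exact_mod_cast (Finset.card_le_card (by
      intro v hv
      have hv := Finset.mem_filter.1 hv
      by_cases hvW : v ∈ W
      · exact Finset.mem_union_right _ hvW
      · exact Finset.mem_union_left _ (Finset.mem_filter.2
          ⟨Finset.mem_sdiff.2 ⟨hv.1, hvW⟩, hv.2⟩))).trans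
          (Finset.card_union_le (commonNbrs G t (R \ W)) W)
  obtain ⟨h5, h6⟩ := abs_le.1 h
  set c : ℝ := (#(commonNbrs G t R) : ℝ)
  set c' : ℝ := (#(commonNbrs G t (R \ W)) : ℝ)
  set m : ℝ := (#(R \ W) : ℝ)
  set Rr : ℝ := (#R : ℝ)
  set P := p ^ #S
  have hR0 : 0 ≤ Rr := Nat.cast_nonneg _
  have hPR : 0 ≤ P * Rr := by positivity
  have hPm : P * m ≤ P * Rr := mul_le_mul_of_nonneg_left h1 hP0.le
  rw [ExpectedNbrs, Set.mem_Icc]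
  constructor
  · have : (1 - x) * (P * m) ≤ (1 - x) * (P * Rr) :=
      mul_le_mul_of_nonneg_left hPm (by linarith)
    nlinarith
  · have hw' : P * w ≤ P * (Rr * x / 16) := by
      refine mul_le_mul_of_nonneg_left ?_ hP0.le
      have : P * (Rr * x) ≤ 1 * (Rr * x) := mul_le_mul_of_nonneg_right hP1 (by positivity)
      nlinarith
    have h7 : P * Rr - P * w ≤ P * m := by
      rw [← mul_sub]
      exact mul_le_mul_of_nonneg_left (by linarith) hP0.le
    have h8 : P * Rr * (1 - x / 16) ≤ P * m := by linarith
    have h9 : (1 + x) * (P * Rr * (1 - x / 16)) ≤ (1 + x) * (P * m) :=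
      mul_le_mul_of_nonneg_left h8 (by linarith)
    have h10 : (1 + x / 2) * (P * Rr) ≤ (1 + x) * (P * Rr * (1 - x / 16)) := by
      have : 0 ≤ (P * Rr) * (x * (7 - x)) := mul_nonneg hPR (mul_nonneg hx0 (by linarith))
      nlinarith
    linarith

/-- If no large family of disjoint sets deviates, then the union of maximal families of deviating
sets, one for each block, is an error set. -/
theorem boundedErrorSets_of_fewDeviations {p s m : ℝ} (hk : 0 < k) (hp0 : 0 < p) (hp1 : p ≤ 1)
    {l r : ℕ} (hm : m ≤ 2 * s) {ω : Sym2 (Vertex k n) → Bool}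
    (h : FewDeviations (1 / (2 * k : ℝ)) p m l r ω)
    (hr : (k : ℝ) * (r * l) ≤ p ^ l * s / (8 * k)) :
    BoundedErrorSets (graphOf ω) (2 * s) s (1 / k) p l := by
  classical
  intro Q hQ
  have hk0 : (0 : ℝ) < k := by exact_mod_cast hk
  have hk1 : (1 : ℝ) ≤ k := by exact_mod_cast hk
  have hpl : 0 < p ^ l := pow_pos hp0 l
  have hs0 : 0 ≤ s := by
    have h1 : 0 ≤ p ^ l * s / (8 * k) := le_trans (by positivity) hr
    by_contra! hneg
    have : p ^ l * s / (8 * k) < 0 := div_neg_of_neg_of_pos (mul_neg_of_pos_of_neg hpl hneg)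
      (by positivity)
    linarith
  have hex := fun j => exists_maximal_deviating (d := 1 / (2 * k : ℝ)) (by positivity) h j (Q j)
    ((hQ j).imp_left hm.trans)
  choose X hXcard hX using hex
  let W := Finset.univ.biUnion X
  have hWcard : (#W : ℝ) ≤ p ^ l * s / (8 * k) := by
    refine le_trans ?_ hr
    have := Finset.card_biUnion_le_card_mul (Finset.univ : Finset (Fin k)) X (r * l)
      fun j _ => hXcard j
    rw [Finset.card_univ, Fintype.card_fin] at this
    exact_mod_cast this
  refine ⟨W, hWcard.trans ?_, fun S hS t ht j hj => ?_⟩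
  · rw [div_le_iff₀ (by positivity)]
    have : p ^ l * s ≤ 1 * s := mul_le_mul_of_nonneg_right (pow_le_one₀ hp0.le hp1) hs0
    nlinarith
  · have hdisj : Disjoint (tupleSet t) (X j) := by
      refine Finset.disjoint_left.2 fun u hu huX => ?_
      obtain ⟨i, -, rfl⟩ := Finset.mem_image.1 hu
      exact (Finset.mem_sdiff.1 (ht i)).2 (Finset.mem_biUnion.2 ⟨j, Finset.mem_univ _, huX⟩)
    have hnd := hX j (tupleSet t) (by rwa [card_tupleSet]) (tupleSet_avoids t hj) hdisj
    have habs := abs_sub_le_of_not_deviates hj hnd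
    rcases hQ j with hQj | hQj
    · refine expectedNbrs_sdiff hp0 hp1 (by positivity) (by rw [div_le_one hk0]; exact hk1) _ t _ W
        hWcard ?_ ?_
      · rw [card_side]
        have h1 : p ^ l ≤ p ^ #S := pow_le_pow_of_le_one hp0.le hp1 hS
        have h2 : p ^ l * (2 * s) ≤ p ^ #S * #(Q j) :=
          mul_le_mul h1 hQj (by positivity) (by positivity)
        rw [div_le_div_iff₀ (by positivity) (by norm_num)]
        have : p ^ #S * ↑(#(Q j)) * (1 / ↑k) * (8 * ↑k) = 8 * (p ^ #S * ↑(#(Q j))) := by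
          field_simp
        rw [this]
        linarith
      · rw [card_side]
        refine habs.trans (le_of_eq ?_)
        congr 1
        field_simp
    · have hempty : side Q j = ∅ := by
        rw [← Finset.card_eq_zero, card_side, hQj]
      rw [hempty, Finset.empty_sdiff, ExpectedNbrs]
      simp [commonNbrs]

open Classical in
/-- Large families of disjoint deviating sets are unlikely: the `r` deviations are independent, which
beats the number of choices of the family and of the set `R`. -/
theorem prob_not_fewDeviations_le {q : Sym2 (Vertex k n) → ℝ} (hq : IsParam q) {p : ℝ}
    (hp0 : 0 < p) (hp1 : p ≤ 1) (hqp : ∀ i j : Fin k, i ≠ j → ∀ a b : Fin n, q s((i, a), (j, b)) = p)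
    (hk : 0 < k) (hkn : k ≤ n) (hn : 6 ≤ n) {l r : ℕ} (hl : 0 < l) {m : ℝ}
    (hm : 96 * (k : ℝ) ^ 2 * l * Real.log n ≤ p ^ l * m)
    (hr : 160 * (k : ℝ) ^ 2 * Real.log n / p ^ l ≤ r) :
    prob q (fun ω => ¬ FewDeviations (1 / (2 * k : ℝ)) p m l r ω) ≤ 3 * ((n : ℝ) ^ 3)⁻¹ := by
  have hk0 : (0 : ℝ) < k := by exact_mod_cast hk
  have hk1 : (1 : ℝ) ≤ k := by exact_mod_cast hk
  have hn6 : (6 : ℝ) ≤ n := by exact_mod_cast hn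
  have hn0 : (0 : ℝ) < n := by linarith
  have hkn' : (k : ℝ) ≤ n := by exact_mod_cast hkn
  have hlog : 0 < Real.log n := Real.log_pos (by linarith)
  have hpl : 0 < p ^ l := pow_pos hp0 l
  have hl0 : (0 : ℝ) < l := by exact_mod_cast hl
  have hm0 : 0 < m := by
    have : 0 < p ^ l * m := lt_of_lt_of_le (by positivity) hm
    exact (pos_iff_pos_of_mul_pos this).1 hpl
  let fam : Finset (Finset (Finset (Vertex k n))) :=
    ((Finset.univ : Finset (Finset (Vertex k n))).filter fun T => #T ≤ l).powersetCard r
  have hfam : (#fam : ℝ) ≤ (3 * ((k : ℝ) * n) ^ l) ^ r := by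
    have h1 : #fam ≤ #((Finset.univ : Finset (Finset (Vertex k n))).filter fun T => #T ≤ l) ^ r := by
      rw [Finset.card_powersetCard]
      exact Nat.choose_le_pow _ _
    have h2 := card_filter_card_le (α := Vertex k n) (N := k * n) (by positivity) (by simp) l
    push_cast at h2
    have h3 : (#fam : ℝ) ≤
        (#((Finset.univ : Finset (Finset (Vertex k n))).filter fun T => #T ≤ l) : ℝ) ^ r := by
      exact_mod_cast h1
    exact h3.trans (pow_le_pow_left₀ (Nat.cast_nonneg _) h2 r)
  let A : Fin k → Finset (Fin n) → (Sym2 (Vertex k n) → Bool) → Prop := fun j R ω =>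
    m ≤ (#R : ℝ) ∧ ∃ 𝒯 ∈ fam, IsDisjointFamily l j 𝒯 ∧
      ∀ T ∈ 𝒯, Deviates (1 / (2 * k : ℝ)) p T j R ω
  have hA : ∀ j R, prob q (A j R) ≤ ((n : ℝ) ^ 4)⁻¹ * ((n : ℝ)⁻¹) ^ #R := by
    intro j R
    by_cases hR : m ≤ (#R : ℝ)
    swap
    · refine (prob_le_expectation hq (f := fun _ => 0) (fun _ => le_rfl)
        fun ω h => absurd h.1 hR).trans ?_
      rw [expectation_const]
      positivity
    have hR0 : 0 < #R := by
      have : (0 : ℝ) < #R := lt_of_lt_of_le hm0 hR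
      exact_mod_cast this
    -- half of the exponent `b` of each deviation pays for the choice of the deviating set,
    -- the other halves together pay for the choice of `R`
    set b : ℝ := p ^ l * #R / (16 * (k : ℝ) ^ 2) with hb
    have hb1 : 6 * l * Real.log n ≤ b := by
      rw [hb, le_div_iff₀ (by positivity)]
      have : p ^ l * m ≤ p ^ l * #R := mul_le_mul_of_nonneg_left hR hpl.le
      nlinarith
    have hb2 : 5 * #R * Real.log n ≤ r * (b / 2) := by
      calc 5 * #R * Real.log n = 160 * (k : ℝ) ^ 2 * Real.log n / p ^ l * (b / 2) := by
            rw [hb]; field_simp; ring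
        _ ≤ _ := mul_le_mul_of_nonneg_right hr (by positivity)
    have h1 : ∀ 𝒯 ∈ fam, prob q (fun ω => IsDisjointFamily l j 𝒯 ∧
        ∀ T ∈ 𝒯, Deviates (1 / (2 * k : ℝ)) p T j R ω) ≤ (2 * Real.exp (-b)) ^ r := by
      intro 𝒯 h𝒯
      obtain ⟨-, hcard⟩ := Finset.mem_powersetCard.1 h𝒯
      by_cases hD : IsDisjointFamily l j 𝒯
      swap
      · refine (prob_le_expectation hq (f := fun _ => 0) (fun _ => le_rfl)
          fun ω h => absurd h.1 hD).trans ?_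
        rw [expectation_const]
        positivity
      refine (prob_mono hq fun ω h => h.2).trans ?_
      rw [← hcard]
      refine prob_forall_deviates_le hq hp0.le hp1 𝒯 hD.1 (fun T hT => (hD.2 T hT).2)
        (fun T hT u hu a => hqp u.1 j ((hD.2 T hT).2 u hu) u.2 a) R (by positivity) ?_ ?_
      · rw [div_le_one (by positivity)]
        linarith
      · intro T hT
        have h2 : p ^ l ≤ p ^ #T := pow_le_pow_of_le_one hp0.le hp1 (hD.2 T hT).1
        have h3 : p ^ l * #R ≤ p ^ #T * #R := mul_le_mul_of_nonneg_right h2 (by positivity)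
        calc b ≤ p ^ #T * #R / (16 * (k : ℝ) ^ 2) := by
              rw [hb]; exact div_le_div_of_nonneg_right h3 (by positivity)
          _ = _ := by field_simp; norm_num
    have h2 : prob q (A j R) ≤ (3 * ((k : ℝ) * n) ^ l) ^ r * (2 * Real.exp (-b)) ^ r := by
      refine (prob_mono hq fun ω h => h.2).trans ((prob_exists_le hq fam _).trans ?_)
      refine (Finset.sum_le_card_nsmul _ _ _ h1).trans ?_
      rw [nsmul_eq_mul]
      exact mul_le_mul_of_nonneg_right hfam (by positivity)
    refine h2.trans ?_
    have h3 : 3 * ((k : ℝ) * n) ^ l * (2 * Real.exp (-b)) ≤ Real.exp (-(b / 2)) := by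
      have h4 : 6 * ((k : ℝ) * n) ^ l ≤ Real.exp (b / 2) := by
        have h5 : ((k : ℝ) * n) ^ l ≤ (n : ℝ) ^ (2 * l) := by
          rw [pow_mul]
          exact pow_le_pow_left₀ (by positivity) (by nlinarith) l
        have h6 : (6 : ℝ) ≤ (n : ℝ) ^ l := hn6.trans (le_self_pow₀ (by linarith) hl.ne')
        calc 6 * ((k : ℝ) * n) ^ l ≤ (n : ℝ) ^ l * (n : ℝ) ^ (2 * l) :=
              mul_le_mul h6 h5 (by positivity) (by positivity)
          _ = Real.exp ((3 * l : ℕ) * Real.log n) := by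
              rw [Real.exp_nat_mul, Real.exp_log hn0, ← pow_add]; congr 1; ring
          _ ≤ _ := Real.exp_le_exp.2 (by push_cast; linarith)
      have h7 : Real.exp (-b) = Real.exp (-(b / 2)) * Real.exp (-(b / 2)) := by
        rw [← Real.exp_add]; congr 1; ring
      have h8 : Real.exp (b / 2) * Real.exp (-(b / 2)) = 1 := by
        rw [← Real.exp_add]; simp
      calc _ = 6 * ((k : ℝ) * n) ^ l * Real.exp (-(b / 2)) * Real.exp (-(b / 2)) := by
            rw [h7]; ring
        _ ≤ Real.exp (b / 2) * Real.exp (-(b / 2)) * Real.exp (-(b / 2)) := by gcongr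
        _ = _ := by rw [h8, one_mul]
    rw [← mul_pow]
    refine (pow_le_pow_left₀ (by positivity) h3 r).trans ?_
    rw [← Real.exp_nat_mul]
    calc Real.exp (r * -(b / 2)) ≤ Real.exp ((5 * #R : ℕ) * -Real.log n) :=
          Real.exp_le_exp.2 (by push_cast; linarith)
      _ = ((n : ℝ)⁻¹) ^ (5 * #R) := by
          rw [Real.exp_nat_mul, Real.exp_neg, Real.exp_log hn0]
      _ ≤ ((n : ℝ)⁻¹) ^ (4 + #R) :=
          pow_le_pow_of_le_one (by positivity) (inv_le_one_of_one_le₀ (by linarith)) (by omega)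
      _ = _ := by rw [pow_add, inv_pow]
  have hsub : ∀ ω, ¬ FewDeviations (1 / (2 * k : ℝ)) p m l r ω →
      ∃ j ∈ (Finset.univ : Finset (Fin k)), ∃ R ∈ (Finset.univ : Finset (Finset (Fin n))),
        A j R ω := by
    intro ω h
    simp only [FewDeviations] at h
    push Not at h
    obtain ⟨j, R, hR, 𝒯, hD, hcard, hdev⟩ := h
    refine ⟨j, Finset.mem_univ _, R, Finset.mem_univ _, hR, 𝒯, ?_, hD, hdev⟩
    exact Finset.mem_powersetCard.2 ⟨fun T hT => Finset.mem_filter.2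
      ⟨Finset.mem_univ _, (hD.2 T hT).1⟩, hcard⟩
  refine (prob_mono hq hsub).trans ((prob_exists_le hq _ _).trans ?_)
  have h1 : ∀ j ∈ (Finset.univ : Finset (Fin k)),
      prob q (fun ω => ∃ R ∈ (Finset.univ : Finset (Finset (Fin n))), A j R ω) ≤
        ((n : ℝ) ^ 4)⁻¹ * 3 := by
    intro j _
    refine (prob_exists_le hq _ _).trans ((Finset.sum_le_sum fun R _ => hA j R).trans ?_)
    rw [← Finset.mul_sum]
    exact mul_le_mul_of_nonneg_left
      (sum_inv_pow_card_le (α := Fin n) (by omega) (by simp)) (by positivity)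
  refine (Finset.sum_le_card_nsmul _ _ _ h1).trans ?_
  rw [nsmul_eq_mul, Finset.card_univ, Fintype.card_fin]
  calc (k : ℝ) * (((n : ℝ) ^ 4)⁻¹ * 3) ≤ n * (((n : ℝ) ^ 4)⁻¹ * 3) := by gcongr
    _ = _ := by field_simp

end ErrorSets

/-! ### The random graph as a finite product space -/

section Transfer

variable {k n : ℕ}

open Classical in
/-- The probabilities with which the potential edges are present. -/
noncomputable def edgeParam (k n : ℕ) (p : ℝ) (e : Sym2 (Vertex k n)) : ℝ :=
  if e ∈ potentialEdges k n then p else 0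

theorem isParam_edgeParam {p : ℝ} (hp0 : 0 ≤ p) (hp1 : p ≤ 1) : IsParam (edgeParam k n p) := by
  intro e
  unfold edgeParam
  split_ifs
  · exact ⟨hp0, hp1⟩
  · exact ⟨le_rfl, zero_le_one⟩

theorem edgeParam_of_ne (p : ℝ) {i j : Fin k} (h : i ≠ j) (a b : Fin n) :
    edgeParam k n p s((i, a), (j, b)) = p :=
  if_pos ⟨(i, a), (j, b), h, rfl⟩

/-- The outcome with the edges in `s`. -/
noncomputable def outcomeOf {ι : Type*} (s : Set ι) (i : ι) : Bool := by
  classical exact decide (i ∈ s)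

theorem outcomeOf_eq_true {ι : Type*} {s : Set ι} {i : ι} : outcomeOf s i = true ↔ i ∈ s := by
  simp [outcomeOf]

theorem setBernoulli_real_singleton_eq_weight (p : unitInterval) (s : Set (Sym2 (Vertex k n))) :
    (ProbabilityTheory.setBernoulli (potentialEdges k n) p).real {s} =
      weight (edgeParam k n p) (outcomeOf s) := by
  classical
  by_cases hs : s ⊆ potentialEdges k n
  · rw [ProbabilityTheory.setBernoulli_real_singleton p hs (Set.toFinite _), weight]
    have h1 : ∀ e : Sym2 (Vertex k n), (if outcomeOf s e = true then edgeParam k n p e else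
        1 - edgeParam k n p e) =
        (if e ∈ s then (p : ℝ) else 1) *
          (if e ∈ potentialEdges k n \ s then (1 - p : ℝ) else 1) := by
      intro e
      by_cases h : e ∈ s
      · simp [outcomeOf_eq_true, h, edgeParam, hs h]
      · by_cases h' : e ∈ potentialEdges k n <;> simp [outcomeOf_eq_true, h, edgeParam, h']
    simp only [h1, Finset.prod_mul_distrib]
    rw [← Finset.prod_filter, ← Finset.prod_filter, Finset.prod_const, Finset.prod_const]
    congr 2
    · rw [← Set.ncard_coe_finset]; congr 1; ext; simp
    · rw [← Set.ncard_coe_finset]; congr 1; ext; simp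
  · rw [MeasureTheory.measureReal_def,
      ProbabilityTheory.setBernoulli_singleton_of_not_subset p hs, ENNReal.toReal_zero]
    obtain ⟨e, he, hne⟩ := Set.not_subset.1 hs
    symm
    exact Finset.prod_eq_zero (Finset.mem_univ e) (by simp [outcomeOf_eq_true, he, edgeParam, hne])

/-- Probabilities in the finite product space bound those of the random graph from below; this needs
no measurability. -/
theorem prob_le_randomGraph_real (p : unitInterval) (Φ : SimpleGraph (Vertex k n) → Prop) :
    prob (edgeParam k n p) (fun ω => Φ (graphOf ω)) ≤ (randomGraph n k p).real {G | Φ G} := by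
  classical
  set P := ProbabilityTheory.setBernoulli (potentialEdges k n) p
  have h1 : P.real (SimpleGraph.fromEdgeSet ⁻¹' {G | Φ G}) ≤ (randomGraph n k p).real {G | Φ G} := by
    refine ENNReal.toReal_mono (MeasureTheory.measure_ne_top _ _) ?_
    exact MeasureTheory.Measure.le_map_apply SimpleGraph.measurable_fromEdgeSet.aemeasurable _
  refine le_trans (le_of_eq ?_) h1
  let e : Set (Sym2 (Vertex k n)) ≃ (Sym2 (Vertex k n) → Bool) :=
    ⟨outcomeOf, fun ω => {e | ω e = true}, fun s => by ext; simp [outcomeOf_eq_true],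
      fun ω => by funext i; rw [Bool.eq_iff_iff, outcomeOf_eq_true]; rfl⟩
  have h2 : (SimpleGraph.fromEdgeSet ⁻¹' {G | Φ G} : Set (Set (Sym2 (Vertex k n)))) =
      ((Finset.univ.filter fun s : Set (Sym2 (Vertex k n)) => Φ (SimpleGraph.fromEdgeSet s) :
        Finset (Set (Sym2 (Vertex k n)))) : Set (Set (Sym2 (Vertex k n)))) := by
    ext s; simp
  rw [h2, ← MeasureTheory.sum_measureReal_singleton, prob, expectation, ← e.sum_comp,
    Finset.sum_filter]
  refine Finset.sum_congr rfl fun s _ => ?_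
  have h3 : graphOf (e s) = SimpleGraph.fromEdgeSet s := by
    unfold graphOf
    congr 1
    ext
    exact outcomeOf_eq_true
  rw [h3, setBernoulli_real_singleton_eq_weight]
  split_ifs
  · exact mul_one _
  · exact mul_zero _

/-- Every edge of the graph is a potential edge. -/
def OnlyPotentialEdges (ω : Sym2 (Vertex k n) → Bool) : Prop :=
  ∀ e, ω e = true → e ∈ potentialEdges k n

theorem prob_not_onlyPotentialEdges {p : ℝ} (hp0 : 0 ≤ p) (hp1 : p ≤ 1) :
    prob (edgeParam k n p) (fun ω => ¬ OnlyPotentialEdges ω) ≤ 0 := by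
  classical
  have hq := isParam_edgeParam (k := k) (n := n) hp0 hp1
  let s : Finset (Sym2 (Vertex k n)) := Finset.univ.filter fun e => e ∉ potentialEdges k n
  refine (prob_mono hq (B := fun ω => ∃ e ∈ s, ω e = true) fun ω h => ?_).trans
    ((prob_exists_le hq s _).trans (le_of_eq ?_))
  · simp only [OnlyPotentialEdges] at h
    push Not at h
    obtain ⟨e, he, hne⟩ := h
    exact ⟨e, by simpa [s] using hne, he⟩
  · refine Finset.sum_eq_zero fun e he => prob_coord_eq_zero ?_
    exact if_neg (Finset.mem_filter.1 he).2

theorem kPartite_of_onlyPotentialEdges {ω : Sym2 (Vertex k n) → Bool} (h : OnlyPotentialEdges ω)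
    (u v : Vertex k n) (huv : (graphOf ω).Adj u v) : u.1 ≠ v.1 := by
  rw [graphOf_adj huv.ne] at huv
  obtain ⟨u', v', hne, he⟩ := h _ huv
  rcases Sym2.eq_iff.1 he with ⟨rfl, rfl⟩ | ⟨rfl, rfl⟩
  · exact hne
  · exact hne.symm

end Transfer

/-! ### The exceptional events -/

section Events

variable {k n : ℕ}

/-- No set of at most `l` vertices outside of a block deviates by more than a factor `1 ± d` with
respect to the whole block. -/
def NoDeviation (d p : ℝ) (l : ℕ) (ω : Sym2 (Vertex k n) → Bool) : Prop :=
  ∀ (j : Fin k) (T : Finset (Vertex k n)), #T ≤ l → (∀ u ∈ T, u.1 ≠ j) →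
    ¬ Deviates d p T j Finset.univ ω

theorem boundedCommonNbrsInBlocks_of_noDeviation {d p D : ℝ} {ω : Sym2 (Vertex k n) → Bool}
    (h : NoDeviation d p ⌊D⌋₊ ω) : BoundedCommonNbrsInBlocks (graphOf ω) d p D := by
  intro A hA i hi B hB t _
  have hiB : i ∉ B := fun h => hi (hB h)
  refine expectedNbrs_of_not_deviates hiB (h i _ ?_ (tupleSet_avoids t hiB))
  rw [card_tupleSet]
  exact Nat.le_floor ((Nat.cast_le.2 (Finset.card_le_card hB)).trans hA)

theorem prob_not_noDeviation_le {q : Sym2 (Vertex k n) → ℝ} (hq : IsParam q) {p : ℝ}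
    (hp0 : 0 < p) (hp1 : p ≤ 1) (hqp : ∀ i j : Fin k, i ≠ j → ∀ a b : Fin n, q s((i, a), (j, b)) = p)
    (hk : 0 < k) (hn : 0 < n) (l : ℕ) :
    prob q (fun ω => ¬ NoDeviation (1 / k) p l ω) ≤
      k * (3 * ((k : ℝ) * n) ^ l * (2 * Real.exp (-(p ^ l * n / (4 * (k : ℝ) ^ 2))))) := by
  classical
  have hk0 : (0 : ℝ) < k := by exact_mod_cast hk
  have hk1 : (1 : ℝ) ≤ k := by exact_mod_cast hk
  let s := (Finset.univ : Finset (Finset (Vertex k n))).filter fun T => #T ≤ l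
  have hs : (#s : ℝ) ≤ 3 * ((k : ℝ) * n) ^ l := by
    have := card_filter_card_le (α := Vertex k n) (N := k * n) (by positivity) (by simp) l
    push_cast at this
    exact this
  let A : Fin k → Finset (Vertex k n) → (Sym2 (Vertex k n) → Bool) → Prop := fun j T ω =>
    (∀ u ∈ T, u.1 ≠ j) ∧ Deviates (1 / k) p T j Finset.univ ω
  have hA : ∀ j, ∀ T ∈ s, prob q (A j T) ≤ 2 * Real.exp (-(p ^ l * n / (4 * (k : ℝ) ^ 2))) := by
    intro j T hT
    have hTl := (Finset.mem_filter.1 hT).2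
    by_cases hTj : ∀ u ∈ T, u.1 ≠ j
    swap
    · refine (prob_le_expectation hq (f := fun _ => 0) (fun _ => le_rfl)
        fun ω h => absurd h.1 hTj).trans ?_
      rw [expectation_const]
      positivity
    refine (prob_mono hq fun ω h => h.2).trans ((prob_deviates_le hq hp0.le hp1 hTj
      (fun u hu a => hqp u.1 j (hTj u hu) u.2 a) Finset.univ (by positivity)
      (by rw [div_le_one hk0]; exact hk1)).trans ?_)
    have h2 : p ^ l ≤ p ^ #T := pow_le_pow_of_le_one hp0.le hp1 hTl
    have h3 : p ^ l * n ≤ p ^ #T * n := mul_le_mul_of_nonneg_right h2 (by positivity)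
    have h4 : p ^ l * n / (4 * (k : ℝ) ^ 2) ≤
        (1 / (k : ℝ)) ^ 2 * (p ^ #T * #(Finset.univ : Finset (Fin n))) / 4 := by
      rw [Finset.card_univ, Fintype.card_fin]
      calc _ ≤ p ^ #T * n / (4 * (k : ℝ) ^ 2) := div_le_div_of_nonneg_right h3 (by positivity)
        _ = _ := by field_simp
    linarith [Real.exp_le_exp.2 (neg_le_neg h4)]
  refine (prob_mono hq (B := fun ω => ∃ j ∈ (Finset.univ : Finset (Fin k)), ∃ T ∈ s, A j T ω)
    fun ω h => ?_).trans ((prob_exists_le hq _ _).trans ?_)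
  · simp only [NoDeviation] at h
    push Not at h
    obtain ⟨j, T, h1, h2, h3⟩ := h
    exact ⟨j, Finset.mem_univ _, T, by simpa [s] using h1, h2, h3⟩
  · have h1 : ∀ j ∈ (Finset.univ : Finset (Fin k)), prob q (fun ω => ∃ T ∈ s, A j T ω) ≤
        3 * ((k : ℝ) * n) ^ l * (2 * Real.exp (-(p ^ l * n / (4 * (k : ℝ) ^ 2)))) := by
      intro j _
      refine (prob_exists_le hq _ _).trans ((Finset.sum_le_card_nsmul _ _ _ (hA j)).trans ?_)
      rw [nsmul_eq_mul]
      exact mul_le_mul_of_nonneg_right hs (by positivity)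
    refine (Finset.sum_le_card_nsmul _ _ _ h1).trans ?_
    rw [nsmul_eq_mul, Finset.card_univ, Fintype.card_fin]

/-- The character sum of `F` over `Q_B` gains a factor `g` for every two vertices of a minimum vertex
cover, unless the common neighbourhoods are too large. -/
def CharSumGain (β p g : ℝ) (F : SimpleGraph (Fin k)) (B : Finset (Fin k))
    (Q P : Fin k → Finset (Fin n)) (ω : Sym2 (Vertex k n) → Bool) : Prop :=
  StarNbrsBounded β p F B Q P ω → |charSum p (graphOf ω) F B Q| ≤
    Real.exp (β * k) * ((p ^ (restrict F B).edgeSet.ncard)⁻¹ *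
      (g ^ 2) ^ ((vc (restrict F B) : ℝ) / 4) * ∏ i ∈ B, (#(P i) : ℝ))

theorem card_simpleGraph_le (k : ℕ) : Fintype.card (SimpleGraph (Fin k)) ≤ 2 ^ (k * k) := by
  classical
  have h : Function.Injective fun (H : SimpleGraph (Fin k)) (x : Fin k × Fin k) =>
      decide (H.Adj x.1 x.2) := by
    intro H H' h
    ext i j
    simpa using congrFun h (i, j)
  simpa using Fintype.card_le_of_injective _ h

/-- A union bound over all pattern graphs and all rectangles. Extending the sums to the full blocks
makes the tail `exp (-2nk)` beat the `2 ^ (nk)` rectangles. -/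
theorem prob_not_charSumGain_global_le {q : Sym2 (Vertex k n) → ℝ} (hq : IsParam q) {p : ℝ}
    (hp0 : 0 < p) (hp1 : p ≤ 1) (hqp : ∀ i j : Fin k, i ≠ j → ∀ a b : Fin n, q s((i, a), (j, b)) = p)
    (hk : 0 < k) (hkn : k ≤ n) :
    prob q (fun ω => ¬ ∀ (F : SimpleGraph (Fin k)) (Q : Fin k → Finset (Fin n)),
      CharSumGain (1 / k) p (√(k / n)) F Finset.univ Q (fun _ => Finset.univ) ω) ≤
      2 ^ (k * k) * (2 ^ (n * k) * (k * ((n : ℝ) ^ k * (2 * Real.exp (-(2 * n * k)))))) := by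
  classical
  have hn : 0 < n := hk.trans_le hkn
  have hk0 : (0 : ℝ) < k := by exact_mod_cast hk
  have hn0 : (0 : ℝ) < n := by exact_mod_cast hn
  have hkn' : (k : ℝ) ≤ n := by exact_mod_cast hkn
  have hg : √((k : ℝ) / n) ^ 2 = k / n := Real.sq_sqrt (by positivity)
  have h1 : ∀ (F : SimpleGraph (Fin k)) (Q : Fin k → Finset (Fin n)),
      prob q (fun ω => ¬ CharSumGain (1 / k) p (√(k / n)) F Finset.univ Q
        (fun _ => Finset.univ) ω) ≤ k * ((n : ℝ) ^ k * (2 * Real.exp (-(2 * n * k)))) := by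
    intro F Q
    refine (prob_mono hq fun ω h => ?_).trans (prob_charSum_gt_le hq hp0 hp1 hqp hn
      (β := 1 / k) (by positivity) F Finset.univ Q (fun _ => Finset.univ)
      (fun _ _ => Finset.subset_univ _) (fun _ _ => ⟨⟨0, hn⟩, Finset.mem_univ _⟩)
      (g := √(k / n)) (N := 2 * n * k) (by positivity) ?_ ?_)
    · rw [CharSumGain, Classical.not_imp, not_le] at h
      exact h
    · rw [Real.sqrt_le_one, div_le_one hn0]
      exact hkn'
    · intro i _ j _
      rw [hg, Finset.card_univ, Fintype.card_fin]
      refine le_of_eq ?_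
      field_simp
  refine (prob_mono hq (B := fun ω => ∃ F ∈ (Finset.univ : Finset (SimpleGraph (Fin k))),
    ∃ Q ∈ (Finset.univ : Finset (Fin k → Finset (Fin n))),
      ¬ CharSumGain (1 / k) p (√(k / n)) F Finset.univ Q (fun _ => Finset.univ) ω)
    fun ω h => by push Not at h; simpa using h).trans ((prob_exists_le hq _ _).trans ?_)
  have h2 : ∀ F ∈ (Finset.univ : Finset (SimpleGraph (Fin k))),
      prob q (fun ω => ∃ Q ∈ (Finset.univ : Finset (Fin k → Finset (Fin n))),
        ¬ CharSumGain (1 / k) p (√(k / n)) F Finset.univ Q (fun _ => Finset.univ) ω) ≤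
      2 ^ (n * k) * (k * ((n : ℝ) ^ k * (2 * Real.exp (-(2 * n * k))))) := by
    intro F _
    refine (prob_exists_le hq _ _).trans
      ((Finset.sum_le_card_nsmul _ _ _ fun Q _ => h1 F Q).trans (le_of_eq ?_))
    rw [nsmul_eq_mul]
    congr 1
    simp [pow_mul]
  refine (Finset.sum_le_card_nsmul _ _ _ h2).trans ?_
  rw [nsmul_eq_mul]
  refine mul_le_mul_of_nonneg_right ?_ (by positivity)
  rw [Finset.card_univ]
  exact_mod_cast card_simpleGraph_le k

/-- The sides of `Q` have at most `4m` elements, and at least `m` in the blocks in `B`. -/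
def IsBalanced (m : ℕ) (B : Finset (Fin k)) (Q : Fin k → Finset (Fin n)) : Prop :=
  (∀ i, #(Q i) ≤ 4 * m) ∧ ∀ i ∈ B, m ≤ #(Q i)

/-- A union bound over all pattern graphs and all rectangles with sides of size between `m` and `4m`,
for `x` of the order `k log n`: the tail `exp (-2mx)` beats the roughly `n ^ (4mk)` rectangles. -/
theorem prob_not_charSumGain_local_le {q : Sym2 (Vertex k n) → ℝ} (hq : IsParam q) {p : ℝ}
    (hp0 : 0 < p) (hp1 : p ≤ 1) (hqp : ∀ i j : Fin k, i ≠ j → ∀ a b : Fin n, q s((i, a), (j, b)) = p)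
    (hn : 0 < n) {x : ℝ} (hx : 0 < x) (m : ℕ) (hm : x ≤ m) :
    prob q (fun ω => ¬ ∀ (F : SimpleGraph (Fin k)) (B : Finset (Fin k))
      (Q : Fin k → Finset (Fin n)), IsBalanced m B Q →
        CharSumGain (3 / k) p (√(x / m)) F B Q Q ω) ≤
      2 ^ (k * k) * (2 ^ k * ((3 * (n : ℝ) ^ (4 * m)) ^ k *
        (k * ((n : ℝ) ^ k * (2 * Real.exp (-(2 * m * x))))))) := by
  classical
  have hm0 : (0 : ℝ) < m := hx.trans_le hm
  have hm0' : 0 < m := by exact_mod_cast hm0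
  have hg : √(x / m) ^ 2 = x / m := Real.sq_sqrt (by positivity)
  set b : ℝ := k * ((n : ℝ) ^ k * (2 * Real.exp (-(2 * m * x))))
  have hb0 : 0 ≤ b := by positivity
  let s : Finset (Fin k → Finset (Fin n)) := Fintype.piFinset fun _ =>
    (Finset.univ : Finset (Finset (Fin n))).filter fun S => #S ≤ 4 * m
  have hs : (#s : ℝ) ≤ (3 * (n : ℝ) ^ (4 * m)) ^ k := by
    rw [Fintype.card_piFinset_const, Nat.cast_pow]
    exact pow_le_pow_left₀ (Nat.cast_nonneg _)
      (card_filter_card_le (α := Fin n) hn (by simp) (4 * m)) k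
  have h1 : ∀ (F : SimpleGraph (Fin k)) (B : Finset (Fin k)) (Q : Fin k → Finset (Fin n)),
      prob q (fun ω => IsBalanced m B Q ∧ ¬ CharSumGain (3 / k) p (√(x / m)) F B Q Q ω) ≤ b := by
    intro F B Q
    by_cases hQ : IsBalanced m B Q
    swap
    · refine (prob_le_expectation hq (f := fun _ => 0) (fun _ => le_rfl)
        fun ω h => absurd h.1 hQ).trans ?_
      rw [expectation_const]
      exact hb0
    refine (prob_mono hq fun ω h => ?_).trans (prob_charSum_gt_le hq hp0 hp1 hqp hn
      (β := 3 / k) (by positivity) F B Q Q (fun _ _ => le_rfl)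
      (fun i hi => Finset.card_pos.1 (hm0'.trans_le (hQ.2 i hi)))
      (g := √(x / m)) (N := 2 * m * x) (by positivity) ?_ ?_)
    · have h := h.2
      rw [CharSumGain, Classical.not_imp, not_le] at h
      exact h
    · rw [Real.sqrt_le_one, div_le_one hm0]
      exact hm
    · intro i hi j hj
      have hi' : (m : ℝ) ≤ #(Q i) := by exact_mod_cast hQ.2 i hi
      have hj' : (m : ℝ) ≤ #(Q j) := by exact_mod_cast hQ.2 j hj
      rw [hg]
      calc 2 * (m : ℝ) * x = 2 * (m * m) * (x / m) := by field_simp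
        _ ≤ _ := by gcongr
  refine (prob_mono hq (B := fun ω => ∃ F ∈ (Finset.univ : Finset (SimpleGraph (Fin k))),
    ∃ B ∈ (Finset.univ : Finset (Finset (Fin k))), ∃ Q ∈ s,
      IsBalanced m B Q ∧ ¬ CharSumGain (3 / k) p (√(x / m)) F B Q Q ω)
    fun ω h => ?_).trans ((prob_exists_le hq _ _).trans ?_)
  · push Not at h
    obtain ⟨F, B, Q, hQ, h⟩ := h
    exact ⟨F, Finset.mem_univ _, B, Finset.mem_univ _, Q,
      Fintype.mem_piFinset.2 fun i => by simpa using hQ.1 i, hQ, h⟩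
  have h2 : ∀ (F : SimpleGraph (Fin k)) (B : Finset (Fin k)),
      prob q (fun ω => ∃ Q ∈ s, IsBalanced m B Q ∧
        ¬ CharSumGain (3 / k) p (√(x / m)) F B Q Q ω) ≤ (3 * (n : ℝ) ^ (4 * m)) ^ k * b := by
    intro F B
    refine (prob_exists_le hq _ _).trans
      ((Finset.sum_le_card_nsmul _ _ _ fun Q _ => h1 F B Q).trans ?_)
    rw [nsmul_eq_mul]
    exact mul_le_mul_of_nonneg_right hs hb0
  have h3 : ∀ F ∈ (Finset.univ : Finset (SimpleGraph (Fin k))),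
      prob q (fun ω => ∃ B ∈ (Finset.univ : Finset (Finset (Fin k))), ∃ Q ∈ s,
        IsBalanced m B Q ∧ ¬ CharSumGain (3 / k) p (√(x / m)) F B Q Q ω) ≤
      2 ^ k * ((3 * (n : ℝ) ^ (4 * m)) ^ k * b) := by
    intro F _
    refine (prob_exists_le hq _ _).trans
      ((Finset.sum_le_card_nsmul _ _ _ fun B _ => h2 F B).trans (le_of_eq ?_))
    rw [nsmul_eq_mul]
    congr 1
    simp
  refine (Finset.sum_le_card_nsmul _ _ _ h3).trans ?_
  rw [nsmul_eq_mul]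
  refine mul_le_mul_of_nonneg_right ?_ (by positivity)
  rw [Finset.card_univ]
  exact_mod_cast card_simpleGraph_le k

end Events

/-! ### Typical outcomes are well-behaved -/

section Typical

variable {k n : ℕ}

theorem vc_le_vc_restrict_univ (F : SimpleGraph (Fin k)) :
    vc F ≤ vc (restrict F Finset.univ) := by
  have h : F.IsContained (restrict F Finset.univ) :=
    ⟨⟨⟨fun i => ⟨i, Finset.mem_univ i⟩, fun h => h⟩, fun i j h => congrArg Subtype.val h⟩⟩
  exact ENat.toNat_le_toNat h.vertexCoverNum_le_vertexCoverNum
    SimpleGraph.vertexCoverNum_ne_top_of_finite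

theorem vc_restrict_empty (F : SimpleGraph (Fin k)) : vc (restrict F ∅) = 0 := by
  rw [vc, SimpleGraph.vertexCoverNum_of_subsingleton]
  rfl

theorem starNbrsBounded_of_boundedCommonNbrsInBlocks {b p d : ℝ} {ω : Sym2 (Vertex k n) → Bool}
    (h : BoundedCommonNbrsInBlocks (graphOf ω) b p d) {F : SimpleGraph (Fin k)}
    (hF : (vc F : ℝ) ≤ d) (Q : Fin k → Finset (Fin n)) :
    StarNbrsBounded b p F Finset.univ Q (fun _ => Finset.univ) ω := by
  classical
  intro v hv τ _
  have hvF : v ∉ F.support := fun h => (Finset.mem_sdiff.1 hv).2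
    (mem_supportIn.2 ⟨Finset.mem_univ v, h⟩)
  have h1 := h (coreW F) (by rw [card_coreW]; exact hF) v
    (fun hvW => hvF (mem_support_of_mem_coreW hvW)) (starNbrs F Finset.univ v)
    (starNbrs_subset_coreW hvF) (fun i => τ i) fun _ => Finset.mem_univ _
  rw [ExpectedNbrs, Set.mem_Icc, card_side] at h1
  refine le_trans ?_ h1.2
  have h2 : side Q v ⊆ side (fun _ => Finset.univ) v :=
    Finset.image_subset_image (Finset.subset_univ _)
  exact_mod_cast Finset.card_le_card (Finset.filter_subset_filter _ h2)

theorem starNbrsBounded_of_boundedCommonNbrs {b p : ℝ} {ω : Sym2 (Vertex k n) → Bool}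
    {F : SimpleGraph (Fin k)} {B : Finset (Fin k)} {Q : Fin k → Finset (Fin n)}
    (h : ∀ i ∈ B \ supportIn F B,
      BoundedCommonNbrs (graphOf ω) b p (supportIn F B) Q (side Q i)) :
    StarNbrsBounded b p F B Q Q ω := by
  intro v hv τ hτ
  have hvF : v ∉ F.support := fun h => (Finset.mem_sdiff.1 hv).2
    (mem_supportIn.2 ⟨(Finset.mem_sdiff.1 hv).1, h⟩)
  have hsub := starNbrs_subset_supportIn (B := B) hvF
  have h1 := h v hv (starNbrs F B v) hsub (fun i => τ i) fun i => hτ i (hsub i.2)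
  rw [ExpectedNbrs, Set.mem_Icc, card_side] at h1
  exact h1.2

/-- With `g² = k / n < n ^ (-λ)`, a gain of `g` per edge of the matching is the bound over the full
blocks. -/
theorem boundedCharSums_global {p lam : ℝ} (hp0 : 0 < p) (hk : 0 < k) (hkn : k ≤ n) (hn : 1 < n)
    {ω : Sym2 (Vertex k n) → Bool} {F : SimpleGraph (Fin k)} {Q : Fin k → Finset (Fin n)}
    (hs : StarNbrsBounded (1 / k) p F Finset.univ Q (fun _ => Finset.univ) ω)
    (h : CharSumGain (1 / k) p (√(k / n)) F Finset.univ Q (fun _ => Finset.univ) ω)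
    (hlam : lam < 1 - Real.log k / Real.log n) :
    BoundedCharSums p (graphOf ω) F Finset.univ Q
      (6 * (p ^ F.edgeSet.ncard)⁻¹ * (n : ℝ) ^ ((k : ℝ) - lam * vc F / 4)) := by
  have hk0 : (0 : ℝ) < k := by exact_mod_cast hk
  have hn1 : (1 : ℝ) < n := by exact_mod_cast hn
  have hn0 : (0 : ℝ) < n := by linarith
  have hlog : 0 < Real.log n := Real.log_pos hn1
  have hkn' : (k : ℝ) ≤ n := by exact_mod_cast hkn
  refine (h hs).trans ?_
  rw [Real.sq_sqrt (by positivity), ncard_edgeSet_restrict, ← ncard_edgeSet,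
    Finset.prod_const, Finset.card_univ, Finset.card_univ, Fintype.card_fin, Fintype.card_fin]
  have h1 : Real.exp (1 / k * k) ≤ 6 := by
    rw [one_div_mul_cancel hk0.ne']
    linarith [Real.exp_one_lt_d9]
  have h2 : ((k : ℝ) / n) ≤ (n : ℝ) ^ (-lam) := by
    rw [Real.rpow_def_of_pos hn0]
    nth_rw 1 [← Real.exp_log (show (0 : ℝ) < k / n by positivity)]
    rw [Real.exp_le_exp, Real.log_div hk0.ne' hn0.ne']
    have : lam * Real.log n ≤ (1 - Real.log k / Real.log n) * Real.log n :=
      mul_le_mul_of_nonneg_right hlam.le hlog.le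
    rw [sub_mul, div_mul_cancel₀ _ hlog.ne'] at this
    linarith
  have h3 : ((k : ℝ) / n) ^ ((vc (restrict F Finset.univ) : ℝ) / 4) ≤
      (n : ℝ) ^ (-lam * (vc F / 4)) := by
    calc ((k : ℝ) / n) ^ ((vc (restrict F Finset.univ) : ℝ) / 4)
        ≤ ((k : ℝ) / n) ^ ((vc F : ℝ) / 4) := by
          refine Real.rpow_le_rpow_of_exponent_ge (by positivity) ((div_le_one hn0).2 hkn') ?_
          have : (vc F : ℝ) ≤ vc (restrict F Finset.univ) := by
            exact_mod_cast vc_le_vc_restrict_univ F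
          linarith
      _ ≤ ((n : ℝ) ^ (-lam)) ^ ((vc F : ℝ) / 4) :=
          Real.rpow_le_rpow (by positivity) h2 (by positivity)
      _ = _ := by rw [← Real.rpow_mul hn0.le]
  have h4 : (n : ℝ) ^ ((k : ℝ) - lam * vc F / 4) = (n : ℝ) ^ (-lam * (vc F / 4)) * (n : ℝ) ^ k := by
    rw [← Real.rpow_natCast, ← Real.rpow_add hn0]
    congr 1
    ring
  rw [h4]
  have hpe : 0 ≤ (p ^ F.edgeSet.ncard)⁻¹ := by positivity
  calc _ ≤ 6 * ((p ^ F.edgeSet.ncard)⁻¹ * (n : ℝ) ^ (-lam * (vc F / 4)) * (n : ℝ) ^ k) := by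
        gcongr
    _ = _ := by ring

/-- The events for integers `m` cover all real thresholds `L`, as `m = ⌊L⌋ + 1` still bounds the sides
from below. -/
theorem boundedCharSums_local {p L x : ℝ} (hp0 : 0 < p) (hk : 0 < k)
    {ω : Sym2 (Vertex k n) → Bool}
    (hx0 : 0 < x) (hxn : 2 * x ≤ n) (hxL : 2 * x ≤ L)
    (h : ∀ m ∈ (Finset.range (n + 1)).filter fun m : ℕ => 2 * x ≤ (m : ℝ),
      ∀ (F : SimpleGraph (Fin k)) (B : Finset (Fin k)) (Q : Fin k → Finset (Fin n)),
        IsBalanced m B Q → CharSumGain (3 / k) p (√(x / m)) F B Q Q ω)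
    (F : SimpleGraph (Fin k)) {B : Finset (Fin k)} {Q : Fin k → Finset (Fin n)}
    (hsmall : IsSmall (4 * L) Q) (hlarge : IsLarge L B Q)
    (hs : StarNbrsBounded (3 / k) p F B Q Q ω) :
    BoundedCharSums p (graphOf ω) F B Q
      (Real.exp 3 * ((p ^ (restrict F B).edgeSet.ncard)⁻¹ *
        (L / x) ^ (-(vc (restrict F B) : ℝ) / 4) * ∏ i ∈ B, (#(Q i) : ℝ))) := by
  classical
  have hk0 : (0 : ℝ) < k := by exact_mod_cast hk
  have hL0 : 0 < L := by linarith
  have hexp : Real.exp (3 / k * k) = Real.exp 3 := by rw [div_mul_cancel₀ _ hk0.ne']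
  have hprod : 0 ≤ ∏ i ∈ B, (#(Q i) : ℝ) := Finset.prod_nonneg fun _ _ => Nat.cast_nonneg _
  have hpe : 0 ≤ (p ^ (restrict F B).edgeSet.ncard)⁻¹ := by positivity
  -- an integer `m` that is at least `L`, unless `B` is empty and its value is irrelevant
  have key : ∃ m : ℕ, (m ∈ (Finset.range (n + 1)).filter fun m : ℕ => 2 * x ≤ (m : ℝ)) ∧ IsBalanced m B Q ∧
      (x / m) ^ ((vc (restrict F B) : ℝ) / 4) ≤ (L / x) ^ (-(vc (restrict F B) : ℝ) / 4) := by
    rcases B.eq_empty_or_nonempty with rfl | ⟨i₀, hi₀⟩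
    · refine ⟨n, ?_, ⟨fun i => ?_, by simp⟩, ?_⟩
      · exact Finset.mem_filter.2 ⟨by simp, hxn⟩
      · have := (Finset.card_le_univ (Q i)).trans (by simp : Fintype.card (Fin n) ≤ n)
        omega
      · simp [vc_restrict_empty]
    · have hmQ : ∀ i ∈ B, ⌊L⌋₊ + 1 ≤ #(Q i) := fun i hi =>
        Nat.succ_le_of_lt ((Nat.floor_lt hL0.le).2 (hlarge i hi))
      have hLm : L < ((⌊L⌋₊ + 1 : ℕ) : ℝ) := by exact_mod_cast Nat.lt_floor_add_one L
      refine ⟨⌊L⌋₊ + 1, Finset.mem_filter.2 ⟨?_, by linarith⟩, ⟨fun i => ?_, hmQ⟩, ?_⟩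
      · have := (hmQ i₀ hi₀).trans
          ((Finset.card_le_univ (Q i₀)).trans (by simp : Fintype.card (Fin n) ≤ n))
        exact Finset.mem_range.2 (by omega)
      · have h1 := hsmall i
        have h2 : (#(Q i) : ℝ) ≤ ((4 * (⌊L⌋₊ + 1) : ℕ) : ℝ) := by
          push_cast at hLm ⊢
          linarith
        exact_mod_cast h2
      · rw [neg_div, Real.rpow_neg (by positivity), ← Real.inv_rpow (by positivity), inv_div]
        refine Real.rpow_le_rpow (by positivity) ?_ (by positivity)
        exact div_le_div_of_nonneg_left hx0.le hL0 hLm.le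
  obtain ⟨m, hm, hbal, hle⟩ := key
  have h1 := h m hm F B Q hbal hs
  rw [Real.sq_sqrt (by positivity), hexp] at h1
  refine h1.trans ?_
  gcongr

/-- The size from which on the sides of a rectangle have error sets for tuples of size `l`. The constant
`1288 = 8 * 161` makes `k` families of `familySize` sets of `l` vertices a fraction `p ^ l / (8 * k)` of
it. -/
noncomputable def errorSize (k n : ℕ) (p : ℝ) (l : ℕ) : ℝ :=
  1288 * (k : ℝ) ^ 4 * l * Real.log n / p ^ (2 * l)

/-- The number of disjoint deviating sets of size at most `l` that is ruled out. -/
noncomputable def familySize (k n : ℕ) (p : ℝ) (l : ℕ) : ℕ :=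
  ⌈160 * (k : ℝ) ^ 2 * Real.log n / p ^ l⌉₊

theorem familySize_le {p : ℝ} (hp0 : 0 < p) (hp1 : p ≤ 1) (hk : 0 < k) (hlog : 1 ≤ Real.log n)
    (l : ℕ) : (familySize k n p l : ℝ) ≤ 161 * (k : ℝ) ^ 2 * Real.log n / p ^ l := by
  have hk1 : (1 : ℝ) ≤ k := by exact_mod_cast hk
  have hpl : 0 < p ^ l := pow_pos hp0 l
  have h1 : 1 ≤ (k : ℝ) ^ 2 * Real.log n / p ^ l := by
    rw [le_div_iff₀ hpl, one_mul]
    calc p ^ l ≤ 1 := pow_le_one₀ hp0.le hp1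
      _ ≤ (k : ℝ) ^ 2 * Real.log n := by nlinarith [one_le_pow₀ (n := 2) hk1]
  have h2 := (Nat.ceil_lt_add_one
    (show 0 ≤ 160 * (k : ℝ) ^ 2 * Real.log n / p ^ l by positivity)).le
  calc (familySize k n p l : ℝ) ≤ 160 * (k : ℝ) ^ 2 * Real.log n / p ^ l + 1 := h2
    _ ≤ 160 * (k : ℝ) ^ 2 * Real.log n / p ^ l + (k : ℝ) ^ 2 * Real.log n / p ^ l := by gcongr
    _ = _ := by ring

theorem boundedErrorSets_of_typical {p : ℝ} (hp0 : 0 < p) (hp1 : p ≤ 1) (hk : 0 < k)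
    (hlog : 1 ≤ Real.log n) {ω : Sym2 (Vertex k n) → Bool} {l : ℕ} {s : ℝ}
    (h : 1 ≤ l → FewDeviations (1 / (2 * k : ℝ)) p (2 * errorSize k n p l) l
      (familySize k n p l) ω)
    (hs : errorSize k n p l ≤ s) :
    BoundedErrorSets (graphOf ω) (2 * s) s (1 / k) p l := by
  have hk0 : (0 : ℝ) < k := by exact_mod_cast hk
  have hpl : 0 < p ^ l := pow_pos hp0 l
  rcases Nat.eq_zero_or_pos l with rfl | hl
  · have hs0 : 0 ≤ s := by simpa [errorSize] using hs
    refine boundedErrorSets_of_fewDeviations (m := 2 * s) (r := 1) hk hp0 hp1 le_rfl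
      (fewDeviations_zero (by positivity) ω) ?_
    simp only [Nat.cast_zero, mul_zero, pow_zero, one_mul]
    positivity
  · refine boundedErrorSets_of_fewDeviations (m := 2 * errorSize k n p l) hk hp0 hp1
      (by linarith) (h hl) ?_
    have h1 := familySize_le hp0 hp1 hk hlog l
    calc (k : ℝ) * (familySize k n p l * l)
        ≤ k * (161 * (k : ℝ) ^ 2 * Real.log n / p ^ l * l) := by gcongr
      _ = p ^ l * errorSize k n p l / (8 * k) := by
          rw [errorSize, pow_mul']; field_simp; norm_num
      _ ≤ _ := by gcongr

/-- The conjunction of the typical properties of the random graph. -/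
structure Typical (p D : ℝ) (ω : Sym2 (Vertex k n) → Bool) : Prop where
  onlyPotentialEdges : OnlyPotentialEdges ω
  noDeviation : NoDeviation (1 / k) p ⌊D / 4⌋₊ ω
  fewDeviations : ∀ l ∈ Finset.Icc 1 ⌊D / 4⌋₊,
    FewDeviations (1 / (2 * k : ℝ)) p (2 * errorSize k n p l) l (familySize k n p l) ω
  global : ∀ (F : SimpleGraph (Fin k)) (Q : Fin k → Finset (Fin n)),
    CharSumGain (1 / k) p (√(k / n)) F Finset.univ Q (fun _ => Finset.univ) ω
  localSums : ∀ m ∈ (Finset.range (n + 1)).filter fun m : ℕ =>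
      2 * (10 * k * Real.logb 2 n) ≤ (m : ℝ),
    ∀ (F : SimpleGraph (Fin k)) (B : Finset (Fin k)) (Q : Fin k → Finset (Fin n)),
      IsBalanced m B Q → CharSumGain (3 / k) p (√(10 * k * Real.logb 2 n / m)) F B Q Q ω

theorem Typical.wellBehaved {p D : ℝ} (hp0 : 0 < p) (hp1 : p ≤ 1) (hpD : p = edgeProb n D)
    (hk : 0 < k) (hkn : 2 * (10 * k * Real.logb 2 n) ≤ n) (hlog : 1 ≤ Real.log n)
    {ω : Sym2 (Vertex k n) → Bool} (h : Typical p D ω) :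
    WellBehaved 1288 (Real.exp 3) D (graphOf ω) := by
  have hk0 : (0 : ℝ) < k := by exact_mod_cast hk
  have hlogb : 1 ≤ Real.logb 2 n := by
    rw [Real.logb, one_le_div (Real.log_pos one_lt_two)]
    linarith [Real.log_two_lt_d9]
  have hkn' : k ≤ n := by
    have : (k : ℝ) ≤ n := by nlinarith
    exact_mod_cast this
  have hn1 : 1 < n := by
    by_contra! hle
    interval_cases n <;> norm_num at hlog
  have hblocks : BoundedCommonNbrsInBlocks (graphOf ω) (1 / k) p (D / 4) :=
    boundedCommonNbrsInBlocks_of_noDeviation h.noDeviation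
  subst hpD
  exact
    { kPartite := kPartite_of_onlyPotentialEdges h.onlyPotentialEdges
      commonNbrs := hblocks
      errorSets := fun l s hl hs => boundedErrorSets_of_typical hp0 hp1 hk hlog
        (fun hl1 => h.fewDeviations l (Finset.mem_Icc.2 ⟨hl1, Nat.le_floor hl⟩)) hs
      charSums := fun F _ hF Q _ lam hlam => boundedCharSums_global hp0 hk hkn' hn1
        (starNbrsBounded_of_boundedCommonNbrsInBlocks hblocks hF Q) (h.global F Q) hlam
      localCharSums := fun F _ _ L hL B Q hsmall hlarge hnbrs =>
        boundedCharSums_local hp0 hk (by positivity) hkn (by linarith) h.localSums F hsmall hlarge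
          (starNbrsBounded_of_boundedCommonNbrs hnbrs) }

end Typical

/-! ### Estimates of the exceptional probabilities -/

section Estimates

/-- The exceptional probability for the character sums over large rectangles. -/
theorem global_estimate {k n : ℕ} (hk : 0 < k) (hkn : 10 * (k : ℝ) ≤ n)
    (hlog : 10 * Real.log n ≤ n) :
    2 ^ (k * k) * (2 ^ (n * k) * (k * ((n : ℝ) ^ k * (2 * Real.exp (-(2 * n * k)))))) ≤
      1 / (n : ℝ) := by
  have hk0 : (0 : ℝ) < k := by exact_mod_cast hk
  have hk1 : (1 : ℝ) ≤ k := by exact_mod_cast hk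
  have hn0 : (0 : ℝ) < n := by linarith
  have h2 : (2 : ℝ) = Real.exp (Real.log 2) := (Real.exp_log two_pos).symm
  have hnn : (n : ℝ) = Real.exp (Real.log n) := (Real.exp_log hn0).symm
  have e1 : (2 : ℝ) ^ (k * k) = Real.exp (k * k * Real.log 2) := by
    conv_lhs => rw [h2]
    rw [← Real.exp_nat_mul]; push_cast; rfl
  have e2 : (2 : ℝ) ^ (n * k) = Real.exp (n * k * Real.log 2) := by
    conv_lhs => rw [h2]
    rw [← Real.exp_nat_mul]; push_cast; rfl
  have e3 : (n : ℝ) ^ k = Real.exp (k * Real.log n) := by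
    conv_lhs => rw [hnn]
    rw [← Real.exp_nat_mul]
  have e4 : 1 / (n : ℝ) = Real.exp (-Real.log n) := by
    rw [Real.exp_neg, Real.exp_log hn0, one_div]
  have e5 : (k : ℝ) ≤ Real.exp k := by linarith [Real.add_one_le_exp (k : ℝ)]
  have e6 : (2 : ℝ) ≤ Real.exp 1 := by linarith [Real.add_one_le_exp (1 : ℝ)]
  rw [e1, e2, e3, e4]
  calc _ ≤ Real.exp (k * k * Real.log 2) * (Real.exp (n * k * Real.log 2) *
        (Real.exp k * (Real.exp (k * Real.log n) * (Real.exp 1 * Real.exp (-(2 * n * k)))))) := by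
        gcongr
    _ = Real.exp (k * k * Real.log 2 + n * k * Real.log 2 + k + k * Real.log n + 1 - 2 * n * k) := by
        simp only [← Real.exp_add]; congr 1; ring
    _ ≤ _ := by
        refine Real.exp_le_exp.2 ?_
        have hl2 := Real.log_two_lt_d9
        have hl20 := Real.log_pos one_lt_two
        have a1 : (k : ℝ) * k * Real.log 2 ≤ n * k / 10 := by
          have : (k : ℝ) * k ≤ n * k / 10 := by nlinarith
          nlinarith
        have a2 : (n : ℝ) * k * Real.log 2 ≤ n * k * 0.7 := by
          have : (0 : ℝ) ≤ n * k := by positivity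
          nlinarith
        have a3 : (k : ℝ) ≤ n * k / 10 := by nlinarith
        have a4 : k * Real.log n ≤ n * k / 10 := by nlinarith
        have a5 : Real.log n ≤ n * k / 10 := by nlinarith
        have a6 : 1 ≤ n * (k : ℝ) / 10 := by nlinarith
        have a7 : (0 : ℝ) ≤ n * k := by positivity
        linarith

/-- The exceptional probability for the character sums over rectangles with sides of size about `m`. -/
theorem local_estimate {k n m : ℕ} (hk : 0 < k) (hkn : k ≤ n) (hn : 3 ≤ n) (hkm : k ≤ m) :
    2 ^ (k * k) * (2 ^ k * ((3 * (n : ℝ) ^ (4 * m)) ^ k * (k * ((n : ℝ) ^ k *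
      (2 * Real.exp (-(2 * m * (10 * k * Real.logb 2 n)))))))) ≤ ((n : ℝ) ^ 3)⁻¹ := by
  have hn3 : (3 : ℝ) ≤ n := by exact_mod_cast hn
  have hn1 : (1 : ℝ) ≤ n := by linarith
  have hn0 : (0 : ℝ) < n := by linarith
  have hm : 0 < m := hk.trans_le hkm
  have hb : 1 ≤ k * m := Nat.mul_pos hk hm
  have hlog : 0 ≤ Real.log n := Real.log_nonneg hn1
  have a1 : (2 : ℝ) ^ (k * k) ≤ (n : ℝ) ^ (k * m) :=
    (pow_le_pow_left₀ (by norm_num) (by linarith) _).trans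
      (pow_le_pow_right₀ hn1 (Nat.mul_le_mul_left k hkm))
  have a2 : (2 : ℝ) ^ k ≤ (n : ℝ) ^ (k * m) :=
    (pow_le_pow_left₀ (by norm_num) (by linarith) _).trans
      (pow_le_pow_right₀ hn1 (Nat.le_mul_of_pos_right k hm))
  have a3 : (3 * (n : ℝ) ^ (4 * m)) ^ k ≤ (n : ℝ) ^ (5 * (k * m)) := by
    have h : 3 * (n : ℝ) ^ (4 * m) ≤ (n : ℝ) ^ (5 * m) := by
      calc 3 * (n : ℝ) ^ (4 * m) ≤ (n : ℝ) ^ m * (n : ℝ) ^ (4 * m) :=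
            mul_le_mul_of_nonneg_right (hn3.trans (le_self_pow₀ hn1 hm.ne')) (by positivity)
        _ = _ := by rw [← pow_add]; congr 1; ring
    refine (pow_le_pow_left₀ (by positivity) h k).trans (le_of_eq ?_)
    rw [← pow_mul]; congr 1; ring
  have a4 : (k : ℝ) ≤ (n : ℝ) ^ (k * m) :=
    (show (k : ℝ) ≤ n by exact_mod_cast hkn).trans (le_self_pow₀ hn1 (by omega))
  have a5 : (n : ℝ) ^ k ≤ (n : ℝ) ^ (k * m) :=
    pow_le_pow_right₀ hn1 (Nat.le_mul_of_pos_right k hm)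
  have a6 : (2 : ℝ) ≤ (n : ℝ) ^ (k * m) :=
    (show (2 : ℝ) ≤ n by linarith).trans (le_self_pow₀ hn1 (by omega))
  have a7 : Real.exp (-(2 * m * (10 * k * Real.logb 2 n))) ≤ ((n : ℝ) ^ (20 * (k * m)))⁻¹ := by
    rw [← Real.exp_log (show (0 : ℝ) < ((n : ℝ) ^ (20 * (k * m)))⁻¹ by positivity),
      Real.exp_le_exp, Real.log_inv, Real.log_pow]
    have : Real.log n ≤ Real.logb 2 n := by
      rw [Real.logb, le_div_iff₀ (Real.log_pos one_lt_two)]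
      nlinarith [Real.log_two_lt_d9]
    push_cast
    have h0 : (0 : ℝ) ≤ k * m := by positivity
    nlinarith
  calc _ ≤ (n : ℝ) ^ (k * m) * ((n : ℝ) ^ (k * m) * ((n : ℝ) ^ (5 * (k * m)) *
        ((n : ℝ) ^ (k * m) * ((n : ℝ) ^ (k * m) *
          ((n : ℝ) ^ (k * m) * ((n : ℝ) ^ (20 * (k * m)))⁻¹))))) := by gcongr
    _ = ((n : ℝ) ^ (10 * (k * m)))⁻¹ := by
        have h1 : (n : ℝ) ^ (5 * (k * m)) = ((n : ℝ) ^ (k * m)) ^ 5 := by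
          rw [← pow_mul]; congr 1; ring
        have h2 : (n : ℝ) ^ (20 * (k * m)) = ((n : ℝ) ^ (k * m)) ^ 20 := by
          rw [← pow_mul]; congr 1; ring
        have h3 : (n : ℝ) ^ (10 * (k * m)) = ((n : ℝ) ^ (k * m)) ^ 10 := by
          rw [← pow_mul]; congr 1; ring
        rw [h1, h2, h3]
        have : (n : ℝ) ^ (k * m) ≠ 0 := by positivity
        generalize (n : ℝ) ^ (k * m) = y at *
        field_simp
    _ ≤ _ := inv_anti₀ (by positivity) (pow_le_pow_right₀ hn1 (by omega))

/-- The exceptional probability for the common neighbourhoods, for `l ≤ log n / 2`. -/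
theorem noDeviation_estimate {k n l : ℕ} {D : ℝ} (hk : 0 < k) (hn : 3 ≤ n)
    (hkn : (k : ℝ) ≤ (n : ℝ) ^ (1 / 5 : ℝ)) (hD4 : 4 ≤ D) (hD : D ≤ 2 * Real.logb 2 n)
    (hl : (l : ℝ) ≤ D / 4) :
    k * (3 * ((k : ℝ) * n) ^ l * (2 * Real.exp (-(edgeProb n D ^ l * n / (4 * (k : ℝ) ^ 2))))) ≤
      6 * n * Real.exp (Real.logb 2 n * Real.log n - (n : ℝ) ^ (1 / 10 : ℝ) / 4) := by
  have hk0 : (0 : ℝ) < k := by exact_mod_cast hk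
  have hn3 : (3 : ℝ) ≤ n := by exact_mod_cast hn
  have hn1 : (1 : ℝ) ≤ n := by linarith
  have hn0 : (0 : ℝ) < n := by linarith
  have hlog : 0 ≤ Real.log n := Real.log_nonneg hn1
  have hkn1 : (k : ℝ) ≤ n := hkn.trans (by
    conv_rhs => rw [← Real.rpow_one (n : ℝ)]
    exact Real.rpow_le_rpow_of_exponent_le hn1 (by norm_num))
  have h1 : ((k : ℝ) * n) ^ l ≤ Real.exp (Real.logb 2 n * Real.log n) := by
    calc ((k : ℝ) * n) ^ l ≤ ((n : ℝ) * n) ^ l := by gcongr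
      _ = Real.exp ((2 * l : ℕ) * Real.log n) := by
          rw [Real.exp_nat_mul, Real.exp_log hn0, pow_mul, sq]
      _ ≤ _ := by
          refine Real.exp_le_exp.2 (mul_le_mul_of_nonneg_right ?_ hlog)
          push_cast
          linarith
  have h2 : (n : ℝ) ^ (1 / 2 : ℝ) ≤ edgeProb n D ^ l * n := by
    rw [edgeProb, ← Real.rpow_natCast, ← Real.rpow_mul hn0.le]
    nth_rw 3 [← Real.rpow_one (n : ℝ)]
    rw [← Real.rpow_add hn0]
    refine Real.rpow_le_rpow_of_exponent_le hn1 ?_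
    have : 2 / D * l ≤ 2 / D * (D / 4) := mul_le_mul_of_nonneg_left hl (by positivity)
    have h3 : 2 / D * (D / 4) = 1 / 2 := by field_simp; norm_num
    have h4 : -2 / D * l = -(2 / D * l) := by ring
    linarith
  have h3 : (k : ℝ) ^ 2 ≤ (n : ℝ) ^ (2 / 5 : ℝ) := by
    calc (k : ℝ) ^ 2 ≤ ((n : ℝ) ^ (1 / 5 : ℝ)) ^ 2 := by gcongr
      _ = _ := by
          rw [← Real.rpow_natCast, ← Real.rpow_mul hn0.le]; norm_num
  have h4 : (n : ℝ) ^ (1 / 10 : ℝ) / 4 ≤ edgeProb n D ^ l * n / (4 * (k : ℝ) ^ 2) := by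
    rw [div_le_div_iff₀ (by norm_num) (by positivity)]
    calc (n : ℝ) ^ (1 / 10 : ℝ) * (4 * (k : ℝ) ^ 2)
        ≤ (n : ℝ) ^ (1 / 10 : ℝ) * (4 * (n : ℝ) ^ (2 / 5 : ℝ)) := by gcongr
      _ = (n : ℝ) ^ (1 / 2 : ℝ) * 4 := by
          rw [mul_left_comm, ← Real.rpow_add hn0, mul_comm]; norm_num
      _ ≤ _ := by gcongr
  calc _ ≤ n * (3 * Real.exp (Real.logb 2 n * Real.log n) *
        (2 * Real.exp (-((n : ℝ) ^ (1 / 10 : ℝ) / 4)))) := by gcongr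
    _ = _ := by rw [sub_eq_add_neg, Real.exp_add]; ring

open Filter Topology in
/-- The elementary inequalities between functions of `n` that hold for all large `n`. -/
theorem eventually_estimates : ∀ᶠ n : ℕ in atTop, 6 ≤ n ∧ 1 ≤ Real.log n ∧ 10 * Real.log n ≤ n ∧
    10 * (n : ℝ) ^ (1 / 5 : ℝ) ≤ n ∧
    2 * (10 * (n : ℝ) ^ (1 / 5 : ℝ) * Real.logb 2 n) ≤ n ∧
    6 * n * Real.exp (Real.logb 2 n * Real.log n - (n : ℝ) ^ (1 / 10 : ℝ) / 4) ≤ 1 / (n : ℝ) := by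
  have hlo : ∀ (c s : ℝ), 0 < c → 0 < s → ∀ᶠ n : ℕ in atTop, Real.log n ≤ c * (n : ℝ) ^ s := by
    intro c s hc hs
    have h := tendsto_natCast_atTop_atTop (R := ℝ) |>.eventually
      ((isLittleO_log_rpow_atTop hs).def hc)
    filter_upwards [h] with n hn
    refine (le_abs_self _).trans (hn.trans (le_of_eq ?_))
    rw [Real.norm_of_nonneg (Real.rpow_nonneg (Nat.cast_nonneg n) s)]
  have hpow : ∀ᶠ n : ℕ in atTop, (10 : ℝ) ≤ (n : ℝ) ^ (4 / 5 : ℝ) :=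
    tendsto_natCast_atTop_atTop (R := ℝ) |>.eventually
      ((tendsto_rpow_atTop (by norm_num : (0 : ℝ) < 4 / 5)).eventually_ge_atTop 10)
  have hlog1 : ∀ᶠ n : ℕ in atTop, 1 ≤ Real.log n :=
    tendsto_natCast_atTop_atTop (R := ℝ) |>.eventually
      (Real.tendsto_log_atTop.eventually_ge_atTop 1)
  filter_upwards [eventually_ge_atTop 6, hlog1, hpow, hlo (1 / 10) 1 (by norm_num) one_pos,
    hlo (1 / 40) (4 / 5) (by norm_num) (by norm_num),
    hlo (1 / 8) (1 / 20) (by norm_num) (by norm_num),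
    hlo (1 / 32) (1 / 10) (by norm_num) (by norm_num)] with n h6 h1 hp ha hb hc hd
  have hn6 : (6 : ℝ) ≤ n := by exact_mod_cast h6
  have hn0 : (0 : ℝ) < n := lt_of_lt_of_le (by norm_num) hn6
  rw [Real.rpow_one] at ha
  have hlogb : Real.logb 2 n ≤ 2 * Real.log n := by
    rw [Real.logb, div_le_iff₀ (Real.log_pos one_lt_two)]
    nlinarith [Real.log_two_gt_d9]
  have hsplit : (n : ℝ) ^ (1 / 5 : ℝ) * (n : ℝ) ^ (4 / 5 : ℝ) = n := by
    rw [← Real.rpow_add hn0]; norm_num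
  have hr : 0 < (n : ℝ) ^ (1 / 5 : ℝ) := Real.rpow_pos_of_pos hn0 _
  refine ⟨h6, h1, ?_, ?_, ?_, ?_⟩
  · linarith
  · calc 10 * (n : ℝ) ^ (1 / 5 : ℝ) ≤ (n : ℝ) ^ (4 / 5 : ℝ) * (n : ℝ) ^ (1 / 5 : ℝ) := by gcongr
      _ = n := by rw [mul_comm, hsplit]
  · calc 2 * (10 * (n : ℝ) ^ (1 / 5 : ℝ) * Real.logb 2 n)
        ≤ 2 * (10 * (n : ℝ) ^ (1 / 5 : ℝ) * (2 * (1 / 40 * (n : ℝ) ^ (4 / 5 : ℝ)))) := by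
          have : Real.logb 2 n ≤ 2 * (1 / 40 * (n : ℝ) ^ (4 / 5 : ℝ)) := by linarith
          gcongr
      _ = (n : ℝ) ^ (1 / 5 : ℝ) * (n : ℝ) ^ (4 / 5 : ℝ) := by ring
      _ = n := hsplit
      _ ≤ n := le_rfl
  · have hsq : ((n : ℝ) ^ (1 / 20 : ℝ)) ^ 2 = (n : ℝ) ^ (1 / 10 : ℝ) := by
      rw [← Real.rpow_natCast, ← Real.rpow_mul hn0.le]; norm_num
    set y : ℝ := (n : ℝ) ^ (1 / 10 : ℝ)
    have h2 : Real.logb 2 n * Real.log n ≤ y / 32 := by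
      calc Real.logb 2 n * Real.log n ≤ 2 * Real.log n * Real.log n :=
            mul_le_mul_of_nonneg_right hlogb (by linarith)
        _ = 2 * Real.log n ^ 2 := by ring
        _ ≤ 2 * (1 / 8 * (n : ℝ) ^ (1 / 20 : ℝ)) ^ 2 := by gcongr
        _ = _ := by rw [mul_pow, hsq]; ring
    have h3 : 6 * (n : ℝ) * n ≤ Real.exp (4 * Real.log n) := by
      have : Real.exp (4 * Real.log n) = (n : ℝ) ^ 4 := by
        rw [show (4 : ℝ) = (4 : ℕ) by norm_num, Real.exp_nat_mul, Real.exp_log hn0]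
      rw [this]
      have : (6 : ℝ) ≤ n ^ 2 := hn6.trans (le_self_pow₀ (by linarith) two_ne_zero)
      calc 6 * (n : ℝ) * n = 6 * n ^ 2 := by ring
        _ ≤ n ^ 2 * n ^ 2 := by gcongr
        _ = _ := by ring
    rw [le_div_iff₀ hn0]
    calc _ = 6 * (n : ℝ) * n * Real.exp (Real.logb 2 n * Real.log n - y / 4) := by ring
      _ ≤ Real.exp (4 * Real.log n) * Real.exp (Real.logb 2 n * Real.log n - y / 4) := by gcongr
      _ = Real.exp (4 * Real.log n + (Real.logb 2 n * Real.log n - y / 4)) :=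
          (Real.exp_add _ _).symm
      _ ≤ 1 := Real.exp_le_one_iff.2 (by linarith)

end Estimates

/-! ### The random graph is typical -/

/-- An atypical outcome has probability at most `4 / n`. -/
theorem prob_not_typical_le {k n : ℕ} {p D : ℝ} (hp0 : 0 < p) (hp1 : p ≤ 1)
    (hpD : p = edgeProb n D) (hk : 0 < k) (hkn : (k : ℝ) ≤ (n : ℝ) ^ (1 / 5 : ℝ))
    (hD4 : 4 ≤ D) (hD : D ≤ 2 * Real.logb 2 n) (h6 : 6 ≤ n) (hlog1 : 1 ≤ Real.log n)
    (hlog : 10 * Real.log n ≤ n) (h10 : 10 * (n : ℝ) ^ (1 / 5 : ℝ) ≤ n)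
    (hest : 6 * n * Real.exp (Real.logb 2 n * Real.log n - (n : ℝ) ^ (1 / 10 : ℝ) / 4) ≤
      1 / (n : ℝ)) :
    prob (edgeParam k n p) (fun ω => ¬ Typical p D ω) ≤ 4 / n := by
  have hq := isParam_edgeParam (k := k) (n := n) hp0.le hp1
  have hqp : ∀ i j : Fin k, i ≠ j → ∀ a b : Fin n, edgeParam k n p s((i, a), (j, b)) = p :=
    fun i j h a b => edgeParam_of_ne p h a b
  have hn6 : (6 : ℝ) ≤ n := by exact_mod_cast h6
  have hn0 : (0 : ℝ) < n := by linarith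
  have hk0 : (0 : ℝ) < k := by exact_mod_cast hk
  have hk1 : (1 : ℝ) ≤ k := by exact_mod_cast hk
  have hkn10 : 10 * (k : ℝ) ≤ n := by linarith
  have hkn' : k ≤ n := by
    have : (k : ℝ) ≤ n := by linarith
    exact_mod_cast this
  have hlogb : 1 ≤ Real.logb 2 n := by
    rw [Real.logb, one_le_div (Real.log_pos one_lt_two)]
    linarith [Real.log_two_lt_d9]
  -- `I` and `J` list the tuple sizes and the side lengths in the union bound
  set I := Finset.Icc 1 ⌊D / 4⌋₊ with hI
  set J := (Finset.range (n + 1)).filter fun m : ℕ =>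
    2 * (10 * k * Real.logb 2 n) ≤ (m : ℝ) with hJ
  have hsub : ∀ ω, ¬ Typical p D ω → ((((¬ OnlyPotentialEdges ω) ∨
      ¬ NoDeviation (1 / k) p ⌊D / 4⌋₊ ω) ∨
      ∃ l ∈ I, ¬ FewDeviations (1 / (2 * k : ℝ)) p (2 * errorSize k n p l) l
        (familySize k n p l) ω) ∨
      ¬ ∀ (F : SimpleGraph (Fin k)) (Q : Fin k → Finset (Fin n)),
        CharSumGain (1 / k) p (√(k / n)) F Finset.univ Q (fun _ => Finset.univ) ω) ∨
      ∃ m ∈ J, ¬ ∀ (F : SimpleGraph (Fin k)) (B : Finset (Fin k)) (Q : Fin k → Finset (Fin n)),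
        IsBalanced m B Q →
          CharSumGain (3 / k) p (√(10 * k * Real.logb 2 n / m)) F B Q Q ω := by
    intro ω h
    by_contra! hn
    obtain ⟨⟨⟨⟨h1, h2⟩, h3⟩, h4⟩, h5⟩ := hn
    exact h ⟨h1, h2, h3, h4, h5⟩
  refine (prob_mono hq hsub).trans ?_
  have b1 := prob_not_onlyPotentialEdges (k := k) (n := n) hp0.le hp1
  have b2 : prob (edgeParam k n p) (fun ω => ¬ NoDeviation (1 / k) p ⌊D / 4⌋₊ ω) ≤ 1 / n := by
    refine (prob_not_noDeviation_le hq hp0 hp1 hqp hk (by omega) _).trans ?_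
    rw [hpD]
    exact (noDeviation_estimate hk (by omega) hkn hD4 hD (Nat.floor_le (by linarith))).trans hest
  have b3 : prob (edgeParam k n p) (fun ω => ∃ l ∈ I,
      ¬ FewDeviations (1 / (2 * k : ℝ)) p (2 * errorSize k n p l) l
        (familySize k n p l) ω) ≤ 1 / n := by
    have h1 : ∀ l ∈ I, prob (edgeParam k n p) (fun ω =>
        ¬ FewDeviations (1 / (2 * k : ℝ)) p (2 * errorSize k n p l) l
          (familySize k n p l) ω) ≤ 3 * ((n : ℝ) ^ 3)⁻¹ := by
      intro l hl
      have hl1 : 0 < l := (Finset.mem_Icc.1 hl).1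
      have hpl : 0 < p ^ l := pow_pos hp0 l
      refine prob_not_fewDeviations_le hq hp0 hp1 hqp hk hkn' h6 hl1 ?_ (Nat.le_ceil _)
      have hpl1 : p ^ l ≤ 1 := pow_le_one₀ hp0.le hp1
      have hk2 : (1 : ℝ) ≤ (k : ℝ) ^ 2 := one_le_pow₀ hk1
      calc 96 * (k : ℝ) ^ 2 * l * Real.log n
          ≤ 2576 * ((k : ℝ) ^ 2 * k ^ 2) * l * Real.log n / p ^ l := by
            rw [le_div_iff₀ hpl]
            have hX : 0 ≤ (k : ℝ) ^ 2 * l * Real.log n := by positivity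
            calc 96 * (k : ℝ) ^ 2 * l * Real.log n * p ^ l
                ≤ 96 * (k : ℝ) ^ 2 * l * Real.log n * 1 := by gcongr
              _ ≤ 2576 * ((k : ℝ) ^ 2 * l * Real.log n) * 1 := by linarith
              _ ≤ 2576 * ((k : ℝ) ^ 2 * l * Real.log n) * (k : ℝ) ^ 2 := by gcongr
              _ = _ := by ring
        _ = _ := by rw [errorSize, pow_mul']; field_simp; norm_num
    refine (prob_exists_le hq I _).trans ((Finset.sum_le_card_nsmul _ _ _ h1).trans ?_)
    rw [nsmul_eq_mul]
    have hcard : (#I : ℝ) ≤ n := by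
      rw [hI, Nat.card_Icc, Nat.add_sub_cancel]
      refine (Nat.floor_le (by linarith)).trans ?_
      have : Real.logb 2 n ≤ 2 * Real.log n := by
        rw [Real.logb, div_le_iff₀ (Real.log_pos one_lt_two)]
        nlinarith [Real.log_two_gt_d9]
      linarith
    calc (#I : ℝ) * (3 * ((n : ℝ) ^ 3)⁻¹) ≤ n * (n * ((n : ℝ) ^ 3)⁻¹) := by
          gcongr
          linarith
      _ = 1 / n := by field_simp
  have b4 : prob (edgeParam k n p) (fun ω => ¬ ∀ (F : SimpleGraph (Fin k))
      (Q : Fin k → Finset (Fin n)), CharSumGain (1 / k) p (√(k / n)) F Finset.univ Q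
        (fun _ => Finset.univ) ω) ≤ 1 / n :=
    (prob_not_charSumGain_global_le hq hp0 hp1 hqp hk hkn').trans
      (global_estimate hk hkn10 hlog)
  have b5 : prob (edgeParam k n p) (fun ω => ∃ m ∈ J, ¬ ∀ (F : SimpleGraph (Fin k))
      (B : Finset (Fin k)) (Q : Fin k → Finset (Fin n)), IsBalanced m B Q →
        CharSumGain (3 / k) p (√(10 * k * Real.logb 2 n / m)) F B Q Q ω) ≤ 1 / n := by
    have h1 : ∀ m ∈ J, prob (edgeParam k n p) (fun ω => ¬ ∀ (F : SimpleGraph (Fin k))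
        (B : Finset (Fin k)) (Q : Fin k → Finset (Fin n)), IsBalanced m B Q →
          CharSumGain (3 / k) p (√(10 * k * Real.logb 2 n / m)) F B Q Q ω) ≤
        ((n : ℝ) ^ 3)⁻¹ := by
      intro m hm
      have hm := (Finset.mem_filter.1 hm).2
      have hx : 0 < 10 * k * Real.logb 2 n := by positivity
      refine (prob_not_charSumGain_local_le hq hp0 hp1 hqp (by omega) hx m (by linarith)).trans
        (local_estimate hk hkn' (by omega) ?_)
      have : (k : ℝ) ≤ m := by nlinarith
      exact_mod_cast this
    refine (prob_exists_le hq J _).trans ((Finset.sum_le_card_nsmul _ _ _ h1).trans ?_)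
    rw [nsmul_eq_mul]
    have hcard : (#J : ℝ) ≤ n * n := by
      have h2 : #J ≤ n + 1 := (Finset.card_filter_le _ _).trans (by simp)
      have h3 : (#J : ℝ) ≤ n + 1 := by exact_mod_cast h2
      nlinarith
    calc (#J : ℝ) * ((n : ℝ) ^ 3)⁻¹ ≤ n * n * ((n : ℝ) ^ 3)⁻¹ := by gcongr
      _ = 1 / n := by field_simp
  refine (prob_or_le hq _ _).trans ?_
  have c1 := prob_or_le hq (fun ω => (((¬ OnlyPotentialEdges ω) ∨
      ¬ NoDeviation (1 / k) p ⌊D / 4⌋₊ ω) ∨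
      ∃ l ∈ I, ¬ FewDeviations (1 / (2 * k : ℝ)) p (2 * errorSize k n p l) l
        (familySize k n p l) ω))
      (fun ω => ¬ ∀ (F : SimpleGraph (Fin k)) (Q : Fin k → Finset (Fin n)),
        CharSumGain (1 / k) p (√(k / n)) F Finset.univ Q (fun _ => Finset.univ) ω)
  have c2 := prob_or_le hq (fun ω => ((¬ OnlyPotentialEdges ω) ∨
      ¬ NoDeviation (1 / k) p ⌊D / 4⌋₊ ω))
      (fun ω => ∃ l ∈ I, ¬ FewDeviations (1 / (2 * k : ℝ)) p (2 * errorSize k n p l) l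
        (familySize k n p l) ω)
  have c3 := prob_or_le hq (fun ω => (¬ OnlyPotentialEdges ω))
      (fun ω => ¬ NoDeviation (1 / k) p ⌊D / 4⌋₊ ω)
  have h4 : (4 : ℝ) / n = 1 / n + 1 / n + 1 / n + 1 / n := by ring
  linarith

end CliqueSA

theorem mainTheorem3 :
    ∃ C > (0 : ℝ), ∃ K > (0 : ℝ), ∀ ε > (0 : ℝ), ∃ N : ℕ, ∀ n : ℕ, N ≤ n →
      ∀ (k : ℕ) (D : ℝ), 1 ≤ k → (k : ℝ) ≤ (n : ℝ) ^ (1 / 5 : ℝ) →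
        4 ≤ D → D ≤ 2 * Real.logb 2 n →
        ∀ p : unitInterval, (p : ℝ) = CliqueSA.edgeProb n D →
          1 - ε ≤ (CliqueSA.randomGraph n k p).real
            {G | CliqueSA.WellBehaved C K D G} := by
  refine ⟨1288, by norm_num, Real.exp 3, Real.exp_pos 3, fun ε hε => ?_⟩
  obtain ⟨N, hN⟩ := Filter.eventually_atTop.1 CliqueSA.eventually_estimates
  refine ⟨max N ⌈4 / ε⌉₊, fun n hn k D hk hkn hD4 hD p hp => ?_⟩
  obtain ⟨h6, hlog1, hlog, h10, hlogb, hest⟩ := hN n ((le_max_left _ _).trans hn)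
  have hn0 : (0 : ℝ) < n := by
    have : (6 : ℝ) ≤ n := by exact_mod_cast h6
    linarith
  have hp0 : 0 < (p : ℝ) := hp ▸ Real.rpow_pos_of_pos hn0 _
  have hp1 : (p : ℝ) ≤ 1 := p.2.2
  have hε' : 4 / (n : ℝ) ≤ ε := by
    rw [div_le_iff₀ hn0, ← div_le_iff₀' hε]
    exact (Nat.le_ceil _).trans (by exact_mod_cast (le_max_right _ _).trans hn)
  have hkn20 : 2 * (10 * (k : ℝ) * Real.logb 2 n) ≤ n := by
    refine le_trans ?_ hlogb
    have : 0 ≤ Real.logb 2 n := by linarith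
    gcongr
  have h1 := CliqueSA.prob_not_typical_le hp0 hp1 hp hk hkn hD4 hD h6 hlog1 hlog h10 hest
  have h2 := CliqueSA.prob_not (CliqueSA.edgeParam k n p) (CliqueSA.Typical (p : ℝ) D)
  calc 1 - ε ≤ CliqueSA.prob (CliqueSA.edgeParam k n p) (CliqueSA.Typical (p : ℝ) D) := by linarith
    _ ≤ CliqueSA.prob (CliqueSA.edgeParam k n p) (fun ω =>
        CliqueSA.WellBehaved 1288 (Real.exp 3) D (CliqueSA.graphOf ω)) :=
      CliqueSA.prob_mono (CliqueSA.isParam_edgeParam hp0.le hp1) fun ω hω =>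
        hω.wellBehaved hp0 hp1 hp hk hkn20 hlog1
    _ ≤ _ := CliqueSA.prob_le_randomGraph_real p _
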